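/- Let $K$ be a field. Let $T$ be a Brauer graph (a finite connected graph with a cyclic ordering of the half-edges at each vertex) whose only cycle is a loop, attached at a vertex $S$, such that the loop is its own direct successor at $S$. Let $1$ denote the loop and let $1,2,\dots,r$ be the edges at $S$ in their cyclic order. The Brauer quiver $Q_T$ has the edges of $T$ as vertices, and an arrow $i\to j$ whenever $j$ is the successor of $i$ in the cyclic order at a vertex of $T$. It is a union of oriented cycles, divided into $\alpha$-cycles and $\beta$-cycles such that every vertex $i$ of $Q_T$ lies on exactly one cycle of each kind; the loop $\alpha_1$ at the vertex $1$ (given by the two halves of the loop of $T$) is an $\alpha$-cycle, and the cycle $1\to 2\to\dots\to r\to 1$ with arrows $\beta_1,\dots,\beta_r$ is a $\beta$-cycle, called exceptional. Write $\alpha_i,\beta_i$ for the arrows starting at $i$ on these cycles, and $\alpha(i),\beta(i)$ for their ends; let $A_i$, $B_i$ be the complete turns around the $\alpha$- and the $\beta$-cycle starting at $i$, and for $2\le j\le r$ put $B'_j=\beta_j\cdots\beta_r\alpha_1\beta_1\cdots\beta_{j-1}$. Paths are written from left to right. Let $\Omega(T)$ be the quotient of the path algebra $KQ_T$ by the ideal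 generated by - $\beta_{\beta^{-1}(i)}\alpha_i$ and $\alpha_{\alpha^{-1}(i)}\beta_i$ for $i\ne 1$, and $\beta_r\beta_1$; - $A_i-B_i$ for all $i$ not on the exceptional cycle, and $A_j-B'_j$ for $2\le j\le r$; - $\alpha_1^2-\alpha_1\beta_1\cdots\beta_r$ and $\alpha_1\beta_1\cdots\beta_r+\beta_1\cdots\beta_r\alpha_1$. For $n\ge 1$ let $\Omega(n)$ be the bound quiver algebra over $K$ of the quiver with vertices $1,\dots,n$, a loop $\alpha$ at $1$ and arrows $\beta_i:i\to i+1$ (indices modulo $n$), with relations $\alpha^2=\alpha\beta_1\cdots\beta_n$, $\alpha\beta_1\cdots\beta_n+\beta_1\cdots\beta_n\alpha=0$, $\beta_n\beta_1=0$ and $\beta_j\cdots\beta_n\alpha\beta_1\cdots\beta_j=0$ for $2\le j\le n$. For an edge $z$ let $P(z)=\Omega(T)e_z$ be the corresponding projective $\Omega(T)$-module. If $z$ is an edge at $S$, let $Q(z)$ be the complex with $P(z)$ in degree $0$ and zero elsewhere. For any other edge $z$ let $z_0=i,z_1,\dots,z_l=z$ be the unique shortest path in $T$ from an edge $i$ at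 $S$ to $z$ (the edges of the path in the tree $T\setminus\{1\}$ which starts at $S$ and whose last edge is $z$), and let $$Q(z):\quad 0\to P(z_0)\to P(z_1)\to\dots\to P(z_l)\to 0$$ with $P(z_0)$ in degree $0$, where $P(z_j)\to P(z_{j+1})$ is right multiplication by the path in $Q_T$ from $z_j$ to $z_{j+1}$ around their common vertex in $T$. Let $Q=\bigoplus_z Q(z)$, the sum over all edges $z$ of $T$. Then each space $\operatorname{Hom}_{\Omega(T)}(P(z_j),P(z_{j+1}))$ is one-dimensional and the differential $P(z_j)\to P(z_{j+1})$ is non-zero (so it is, up to a scalar, the unique non-zero homomorphism). Moreover, with $\operatorname{Hom}$ and $\operatorname{End}$ taken in the homotopy category of complexes of $\Omega(T)$-modules: 1. For all edges $z,z'$ of $T$, $$\dim_K\operatorname{Hom}(Q(z),Q(z'))=\begin{cases}4&\text{if }z=z'=1,\\2&\text{if }z=z'\ne 1,\\2&\text{if }z\neq z'\text{ and exactly one of }z,z'\text{ equals }1,\\1&\text{otherwise.}\end{cases}$$ 2. $\operatorname{End}(Q)$ is isomorphic as a $K$-algebra to $\Omega(n)$, where $n$ is the number of edges of $T$ (including the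 loop). -/

import Mathlib

open CategoryTheory CategoryTheory.Limits

/-! ### Path algebras -/

section PathAlgebra

universe u₁ u₂ u₃

variable (K : Type u₁) [Field K] {I : Type u₂} {J : Type u₃}

/-- The defining relations of the path algebra of the quiver with vertex set `I`, arrow set `J`
and with source and target maps `s`, `t`.  The generator `Sum.inl i` is the trivial path at `i`
and `Sum.inr a` is the arrow `a`.  Paths are written from left to right:
`a * b` is "first `a`, then `b`". -/
inductive PathRel (s t : J → I) :
    FreeAlgebra K (I ⊕ J) → FreeAlgebra K (I ⊕ J) → Prop
  | idem (i : I) : PathRel s t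
      (FreeAlgebra.ι K (Sum.inl i) * FreeAlgebra.ι K (Sum.inl i)) (FreeAlgebra.ι K (Sum.inl i))
  | orth (i j : I) (hij : i ≠ j) : PathRel s t
      (FreeAlgebra.ι K (Sum.inl i) * FreeAlgebra.ι K (Sum.inl j)) 0
  | source (a : J) : PathRel s t
      (FreeAlgebra.ι K (Sum.inl (s a)) * FreeAlgebra.ι K (Sum.inr a)) (FreeAlgebra.ι K (Sum.inr a))
  | target (a : J) : PathRel s t
      (FreeAlgebra.ι K (Sum.inr a) * FreeAlgebra.ι K (Sum.inl (t a))) (FreeAlgebra.ι K (Sum.inr a))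
  | one : PathRel s t (∑ᶠ i : I, FreeAlgebra.ι K (Sum.inl i)) 1

/-- The path algebra over `K` of the (finite) quiver with vertices `I`, arrows `J`, source map `s`
and target map `t`. -/
def PathAlgebra (s t : J → I) : Type (max u₁ u₂ u₃) := RingQuot (PathRel K s t)

namespace PathAlgebra

variable (s t : J → I)

noncomputable instance : Ring (PathAlgebra K s t) := inferInstanceAs (Ring (RingQuot _))

noncomputable instance : Algebra K (PathAlgebra K s t) := inferInstanceAs (Algebra K (RingQuot _))

/-- The quotient map from the free algebra. -/
noncomputable def mk : FreeAlgebra K (I ⊕ J) →ₐ[K] PathAlgebra K s t :=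
  RingQuot.mkAlgHom K (PathRel K s t)

/-- The trivial path at the vertex `i`. -/
noncomputable def vertex (i : I) : PathAlgebra K s t := mk K s t (FreeAlgebra.ι K (Sum.inl i))

/-- The arrow `a`, as a path of length one. -/
noncomputable def arrow (a : J) : PathAlgebra K s t := mk K s t (FreeAlgebra.ι K (Sum.inr a))

theorem vertex_mul_self (i : I) : vertex K s t i * vertex K s t i = vertex K s t i := by
  rw [vertex, ← map_mul]
  exact RingQuot.mkAlgHom_rel K (PathRel.idem i)

theorem arrow_mul_vertex (a : J) : arrow K s t a * vertex K s t (t a) = arrow K s t a := by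
  rw [vertex, arrow, ← map_mul]
  exact RingQuot.mkAlgHom_rel K (PathRel.target a)

end PathAlgebra

end PathAlgebra

/-! ### The algebras `Ω(n)` -/

/-- The quiver of `Ω(n)` has the vertices `0, …, n - 1` and the arrows
`α = none : 0 → 0` and `β_{i+1} = some i : i → i + 1` (cyclically).  This is the source map. -/
def NormalForm.source (n : ℕ) [NeZero n] : Option (Fin n) → Fin n
  | none => 0
  | some i => i

/-- The target map of the quiver of `Ω(n)`. -/
def NormalForm.target (n : ℕ) [NeZero n] : Option (Fin n) → Fin n
  | none => 0
  | some i => i + 1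

section NormalForm

universe u

variable (K : Type u) [Field K] (n : ℕ) [NeZero n]

/-- The loop `α` in the path algebra of the quiver of `Ω(n)`. -/
noncomputable def NormalForm.α : PathAlgebra K (source n) (target n) :=
  PathAlgebra.arrow K _ _ none

/-- The arrow `β_{i+1}`, from `i` to `i + 1`, in the path algebra of the quiver of `Ω(n)`. -/
noncomputable def NormalForm.β (i : Fin n) : PathAlgebra K (source n) (target n) :=
  PathAlgebra.arrow K _ _ (some i)

/-- The product of the arrows `β` along a list of indices. -/
noncomputable def NormalForm.βs (l : List (Fin n)) : PathAlgebra K (source n) (target n) :=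
  (l.map (NormalForm.β K n)).prod

open NormalForm in
/-- The relations of `Ω(n)`:
`α² = α β₁ ⋯ βₙ`, `α β₁ ⋯ βₙ + β₁ ⋯ βₙ α = 0`, `βₙ β₁ = 0` and
`βⱼ ⋯ βₙ α β₁ ⋯ βⱼ = 0` for `2 ≤ j ≤ n`. -/
inductive NormalForm.Rel :
    PathAlgebra K (source n) (target n) → PathAlgebra K (source n) (target n) → Prop
  | sq : NormalForm.Rel (α K n * α K n) (α K n * βs K n (List.finRange n))
  | anti : NormalForm.Rel
      (α K n * βs K n (List.finRange n) + βs K n (List.finRange n) * α K n) 0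
  | zero : NormalForm.Rel (β K n (-1) * β K n 0) 0
  | cycle (j : Fin n) (hj : j ≠ 0) : NormalForm.Rel
      (βs K n ((List.finRange n).drop (j : ℕ)) * α K n * βs K n ((List.finRange n).take ((j : ℕ) + 1))) 0

/-- The bound quiver algebra `Ω(n)`. -/
def NormalForm : Type u := RingQuot (NormalForm.Rel K n)

noncomputable instance : Ring (NormalForm K n) := inferInstanceAs (Ring (RingQuot _))

noncomputable instance : Algebra K (NormalForm K n) := inferInstanceAs (Algebra K (RingQuot _))

end NormalForm

/-! ### Brauer graphs with one loop -/

/-- A Brauer graph whose only cycle is a loop which is its own direct successor: a tree on the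
finite vertex set `V`, a vertex `S` to which one loop is attached, and a cyclic ordering of the
half-edges at every vertex.  The half-edges of the tree are its darts `d` (`d` is the half of the
edge `d.edge` at the vertex `d.fst`); the loop has the two half-edges `Sum.inr false` and
`Sum.inr true` at `S`.  The cyclic orderings at all vertices are collected in one permutation
`next`, the cycles of which are precisely the sets of half-edges at the vertices. -/
structure LoopBrauerGraph (V : Type*) [Finite V] where
  graph : SimpleGraph V
  isTree : graph.IsTree
  S : V
  next : Equiv.Perm (graph.Dart ⊕ Bool)
  sameCycle_iff : ∀ h h' : graph.Dart ⊕ Bool, next.SameCycle h h' ↔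
    Sum.elim (fun d => d.fst) (fun _ => S) h = Sum.elim (fun d => d.fst) (fun _ => S) h'
  next_loop : next (Sum.inr false) = Sum.inr true

namespace LoopBrauerGraph

universe u v

variable {V : Type v} [Finite V] (T : LoopBrauerGraph V)

/-- The half-edges of `T`. -/
abbrev HalfEdge : Type v := T.graph.Dart ⊕ Bool

instance : Finite T.graph.Dart :=
  Finite.of_injective (fun d => d.toProd) SimpleGraph.Dart.toProd_injective

/-- The edges of `T`: the edges of the tree and the loop `none` (the edge called `1`). -/
abbrev Edge : Type v := Option T.graph.edgeSet

instance : NeZero (Nat.card T.Edge) := ⟨Nat.card_pos.ne'⟩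

/-- The edge to which a half-edge belongs. -/
def edge : T.HalfEdge → T.Edge
  | Sum.inl d => some ⟨d.edge, d.edge_mem⟩
  | Sum.inr _ => none

/-- The other half of the same edge. -/
def opp : T.HalfEdge → T.HalfEdge
  | Sum.inl d => Sum.inl d.symm
  | Sum.inr b => Sum.inr (!b)

/-- The path algebra of the Brauer quiver of `T`.  Its vertices are the edges of `T`, and there is
one arrow for each half-edge `h`, from the edge of `h` to the next edge at the same vertex of `T`.
The arrow of `Sum.inr false` is the loop `α₁` at the vertex `1`, and that of `Sum.inr true`
is `β₁`. -/
abbrev PathAlg (K : Type u) [Field K] : Type (max u v) :=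
  PathAlgebra K T.edge (fun h => T.edge (T.next h))

variable (K : Type u) [Field K]

/-- The arrow of the Brauer quiver starting at the half-edge `h`. -/
noncomputable def arrow (h : T.HalfEdge) : T.PathAlg K := PathAlgebra.arrow K _ _ h

/-- The number of steps, at least one, from `h` to `h'` in the cyclic order. -/
noncomputable def steps (h h' : T.HalfEdge) : ℕ := sInf {k | 0 < k ∧ (T.next ^ k) h = h'}

/-- For half-edges `h`, `h'` at the same vertex, the path of positive length in the Brauer quiver
which goes from `h` to `h'` around this vertex.  In particular `T.arc K h h` is a complete turn
around the vertex, starting with `h`. -/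
noncomputable def arc (h h' : T.HalfEdge) : T.PathAlg K :=
  ((List.range (T.steps h h')).map (fun k => T.arrow K ((T.next ^ k) h))).prod

/-- The relations of `Ω(T)`.  The two cycles of the Brauer quiver through an edge `≠ 1` with the
halves `d` and `d.symm` belong to different camps (`α` or `β`).  The cycle of the half-edges at `S`
is the composite `α₁ β₁ ⋯ βᵣ` of the loop `α₁` and the exceptional cycle; so for an edge `j ≠ 1`
at `S` the complete turn around `S` starting with `j` is `βⱼ ⋯ βᵣ α₁ β₁ ⋯ βⱼ₋₁`. -/
inductive Rel : T.PathAlg K → T.PathAlg K → Prop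
  /-- `β_{β⁻¹(i)} αᵢ = 0` and `α_{α⁻¹(i)} βᵢ = 0` for every edge `i ≠ 1`. -/
  | zero (d : T.graph.Dart) : Rel
      (T.arrow K (T.next⁻¹ (Sum.inl d.symm)) * T.arrow K (Sum.inl d)) 0
  /-- `βᵣ β₁ = 0`. -/
  | loop_zero : Rel
      (T.arrow K (T.next⁻¹ (Sum.inr false)) * T.arrow K (Sum.inr true)) 0
  /-- `Aᵢ = Bᵢ`, and `Aⱼ = βⱼ ⋯ βᵣ α₁ β₁ ⋯ βⱼ₋₁` on the exceptional cycle. -/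
  | turn (d : T.graph.Dart) : Rel
      (T.arc K (Sum.inl d) (Sum.inl d)) (T.arc K (Sum.inl d.symm) (Sum.inl d.symm))
  /-- `α₁² = α₁ β₁ ⋯ βᵣ`. -/
  | loop_sq : Rel
      (T.arrow K (Sum.inr false) * T.arrow K (Sum.inr false))
      (T.arc K (Sum.inr false) (Sum.inr false))
  /-- `α₁ β₁ ⋯ βᵣ + β₁ ⋯ βᵣ α₁ = 0`. -/
  | loop_anti : Rel
      (T.arc K (Sum.inr false) (Sum.inr false) + T.arc K (Sum.inr true) (Sum.inr true)) 0

/-- The bound quiver algebra `Ω(T)`. -/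
def Omega : Type (max u v) := RingQuot (T.Rel K)

noncomputable instance : Ring (T.Omega K) := inferInstanceAs (Ring (RingQuot _))

noncomputable instance : Algebra K (T.Omega K) := inferInstanceAs (Algebra K (RingQuot _))

/-- The quotient map `K Q_T → Ω(T)`. -/
noncomputable def toOmega : T.PathAlg K →ₐ[K] T.Omega K := RingQuot.mkAlgHom K (T.Rel K)

/-- The primitive idempotent of `Ω(T)` of an edge of `T`. -/
noncomputable def e (z : T.Edge) : T.Omega K := T.toOmega K (PathAlgebra.vertex K _ _ z)

/-! ### The complexes `Q(z)` -/

theorem exists_path (z : T.graph.edgeSet) :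
    ∃ (v : V) (p : T.graph.Walk T.S v), p.IsPath ∧ p.edges.getLast? = some (z : Sym2 V) := by
  classical
  obtain ⟨z, hz⟩ := z
  induction z with
  | _ a b =>
  have hab : T.graph.Adj a b := hz
  obtain ⟨p, hp⟩ := (T.isTree.existsUnique_path T.S a).exists
  by_cases hb : b ∈ p.support
  · refine ⟨a, (p.takeUntil b hb).concat hab.symm, ?_, ?_⟩
    · refine (hp.takeUntil hb).concat ?_ _
      exact SimpleGraph.Walk.endpoint_notMem_support_takeUntil hp hb hab.ne
    · simp [SimpleGraph.Walk.edges_concat, Sym2.eq_swap]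
  · refine ⟨b, p.concat hab, hp.concat hb _, ?_⟩
    simp [SimpleGraph.Walk.edges_concat]

/-- The shortest path `i = z₀, z₁, …, z_r = z` from the cycle at `S` to the edge `z`, as a list of
half-edges, each at the end closer to `S`.  For a tree edge `z` this is the path in the tree which
starts at `S` and has `z` as its last edge; for the loop it consists of the loop only. -/
noncomputable def route : T.Edge → List T.HalfEdge
  | none => [Sum.inr true]
  | some z => (T.exists_path z).choose_spec.choose.darts.map Sum.inl

/-- The `j`-th half-edge on the route to `z`, if there is one. -/
noncomputable def routeAt (z : T.Edge) : ℤ → Option T.HalfEdge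
  | Int.ofNat j => (T.route z)[j]?
  | Int.negSucc _ => none

/-- The idempotent `e_{z_j}`, or `0` in the degrees `j` outside of `0, …, r`. -/
noncomputable def idem (z : T.Edge) (j : ℤ) : T.Omega K :=
  ((T.routeAt z j).map (fun h => T.e K (T.edge h))).getD 0

/-- The path from `z_j` to `z_{j+1}` around their common vertex, or `0` in the degrees in which
one of the two does not exist. -/
noncomputable def diffElt (z : T.Edge) (j : ℤ) : T.Omega K :=
  match T.routeAt z j, T.routeAt z (j + 1) with
  | some h, some h' => T.toOmega K (T.arc K (T.opp h) h')
  | _, _ => 0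

/-- The left module `Ω(T) x`; for `x = e_z` it is the projective module `P(z)`. -/
noncomputable abbrev P (x : T.Omega K) : ModuleCat.{max u v} (T.Omega K) :=
  ModuleCat.of (T.Omega K) (Ideal.span {x})

/-- Right multiplication `Ω(T) x → Ω(T) y` by `p y`; this is right multiplication by `p` if `p`
ends with `y`, i.e. `p y = p`. -/
noncomputable def rightMulLinear (x y p : T.Omega K) :
    Ideal.span {x} →ₗ[T.Omega K] Ideal.span {y} where
  toFun := fun a => ⟨(a : T.Omega K) * p * y, Ideal.mul_mem_left _ _ (Ideal.subset_span rfl)⟩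
  map_add' := fun a b => by ext; simp [add_mul]
  map_smul' := fun c a => by ext; simp [mul_assoc]

/-- `rightMulLinear` as a morphism of modules. -/
noncomputable def rightMul (x y p : T.Omega K) : T.P K x ⟶ T.P K y :=
  ModuleCat.ofHom (T.rightMulLinear K x y p)

theorem toOmega_rel {x y : T.PathAlg K} (h : T.Rel K x y) : T.toOmega K x = T.toOmega K y :=
  RingQuot.mkAlgHom_rel K h

theorem steps_spec {h h' : T.HalfEdge} (H : T.next.SameCycle h h') :
    0 < T.steps h h' ∧ (T.next ^ T.steps h h') h = h' := by
  obtain ⟨k, hk, -, hk'⟩ := H.exists_pow_eq''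
  exact Nat.sInf_mem (s := {k | 0 < k ∧ (T.next ^ k) h = h'}) ⟨k, hk, hk'⟩

theorem arc_eq_mul_last {h h' : T.HalfEdge} (H : T.next.SameCycle h h') :
    ∃ x, T.arc K h h' = x * T.arrow K (T.next⁻¹ h') := by
  obtain ⟨h0, h1⟩ := T.steps_spec H
  obtain ⟨m, hm⟩ := Nat.exists_eq_succ_of_ne_zero h0.ne'
  have h2 : T.next⁻¹ h' = (T.next ^ m) h := by
    rw [Equiv.Perm.inv_eq_iff_eq, ← h1, hm, pow_succ', Equiv.Perm.mul_apply]
  refine ⟨((List.range m).map (fun k => T.arrow K ((T.next ^ k) h))).prod, ?_⟩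
  rw [arc, hm, List.prod_range_succ, h2]

theorem arc_eq_first_mul {h h' : T.HalfEdge} (H : T.next.SameCycle h h') :
    ∃ x, T.arc K h h' = T.arrow K h * x := by
  obtain ⟨h0, -⟩ := T.steps_spec H
  obtain ⟨m, hm⟩ := Nat.exists_eq_succ_of_ne_zero h0.ne'
  refine ⟨((List.range m).map (fun k => T.arrow K ((T.next ^ (k + 1)) h))).prod, ?_⟩
  rw [arc, hm, List.prod_range_succ']
  simp

/-- The path from `h` to `h'` ends at the edge of `h'`. -/
theorem arc_mul_e {h h' : T.HalfEdge} (H : T.next.SameCycle h h') :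
    T.toOmega K (T.arc K h h') * T.e K (T.edge h') = T.toOmega K (T.arc K h h') := by
  obtain ⟨x, hx⟩ := T.arc_eq_mul_last K H
  have := PathAlgebra.arrow_mul_vertex K T.edge (fun h => T.edge (T.next h)) (T.next⁻¹ h')
  have h2 : T.next (T.next⁻¹ h') = h' := Equiv.apply_symm_apply T.next h'
  rw [h2] at this
  rw [hx, e, ← map_mul, mul_assoc, arrow, this]

/-- Two consecutive differentials compose to zero. -/
theorem arc_mul_arc (h h' : T.HalfEdge) (d : T.graph.Dart)
    (H : T.next.SameCycle h (Sum.inl d)) (H' : T.next.SameCycle (Sum.inl d.symm) h') :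
    T.toOmega K (T.arc K h (Sum.inl d)) * T.toOmega K (T.arc K (Sum.inl d.symm) h') = 0 := by
  obtain ⟨x, hx⟩ := T.arc_eq_mul_last K H
  obtain ⟨y, hy⟩ := T.arc_eq_first_mul K H'
  have := T.toOmega_rel K (Rel.zero (K := K) d.symm)
  rw [SimpleGraph.Dart.symm_symm, map_zero] at this
  rw [hx, hy, ← map_mul, mul_assoc, ← mul_assoc (T.arrow K _) _ y, map_mul, map_mul, this]
  simp

/-- Consecutive half-edges on a route meet at a vertex, and all of them come from the tree. -/
theorem route_consecutive (z : T.Edge) (j : ℕ) (h h' : T.HalfEdge)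
    (hj : (T.route z)[j]? = some h) (hj' : (T.route z)[j + 1]? = some h') :
    ∃ d d' : T.graph.Dart, h = Sum.inl d ∧ h' = Sum.inl d' ∧
      T.next.SameCycle (Sum.inl d.symm) (Sum.inl d') := by
  cases z with
  | none => simp [route] at hj'
  | some z =>
    simp only [route, List.getElem?_map, Option.map_eq_some_iff] at hj hj'
    obtain ⟨d, hd, rfl⟩ := hj
    obtain ⟨d', hd', rfl⟩ := hj'
    refine ⟨d, d', rfl, rfl, ?_⟩
    rw [T.sameCycle_iff]
    have hc := (T.exists_path z).choose_spec.choose.isChain_dartAdj_darts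
    rw [List.isChain_iff_getElem] at hc
    obtain ⟨hl, rfl⟩ := List.getElem?_eq_some_iff.1 hd'
    obtain ⟨hl', rfl⟩ := List.getElem?_eq_some_iff.1 hd
    exact hc j hl

theorem rightMul_comp (z : T.Edge) (j : ℤ) :
    T.rightMul K (T.idem K z j) (T.idem K z (j + 1)) (T.diffElt K z j) ≫
      T.rightMul K (T.idem K z (j + 1)) (T.idem K z (j + 1 + 1)) (T.diffElt K z (j + 1)) = 0 := by
  have key : T.diffElt K z j * T.idem K z (j + 1) * T.diffElt K z (j + 1) = 0 := by
    cases j with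
    | negSucc j => simp [diffElt, routeAt]
    | ofNat j =>
      have e1 : (Int.ofNat j + 1 : ℤ) = Int.ofNat (j + 1) := rfl
      have e2 : (Int.ofNat (j + 1) + 1 : ℤ) = Int.ofNat (j + 1 + 1) := rfl
      simp only [diffElt, idem, e1, e2, routeAt]
      rcases h0 : (T.route z)[j]? with _ | h
      · simp
      rcases h1 : (T.route z)[j + 1]? with _ | h'
      · simp
      rcases h2 : (T.route z)[j + 1 + 1]? with _ | h''
      · simp
      obtain ⟨d, d', rfl, rfl, H⟩ := T.route_consecutive z j h h' h0 h1
      obtain ⟨d₁, d'', hd, rfl, H'⟩ := T.route_consecutive z (j + 1) _ h'' h1 h2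
      cases hd
      simp only [Option.map_some, Option.getD_some, opp]
      rw [T.arc_mul_e K H, T.arc_mul_arc K _ _ d' H H']
  have key' : (T.rightMulLinear K (T.idem K z (j + 1)) (T.idem K z (j + 1 + 1))
      (T.diffElt K z (j + 1))).comp
      (T.rightMulLinear K (T.idem K z j) (T.idem K z (j + 1)) (T.diffElt K z j)) = 0 := by
    ext a
    change (a : T.Omega K) * T.diffElt K z j * T.idem K z (j + 1) * T.diffElt K z (j + 1) *
      T.idem K z (j + 1 + 1) = 0
    rw [mul_assoc (a : T.Omega K), mul_assoc (a : T.Omega K), key]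
    simp
  rw [rightMul, rightMul, ← ModuleCat.ofHom_comp, key']
  rfl

/-- The complex `Q(z) : 0 → P(z₀) → P(z₁) → ⋯ → P(z_r) → 0` with `P(z₀)` in degree `0`, where
`z₀, …, z_r = z` is the route to `z`.  The differential `P(z_j) → P(z_{j+1})` is right
multiplication with the path from `z_j` to `z_{j+1}` around their common vertex. -/
noncomputable def Q (z : T.Edge) : CochainComplex (ModuleCat.{max u v} (T.Omega K)) ℤ :=
  CochainComplex.of (fun j => T.P K (T.idem K z j))
    (fun j => T.rightMul K (T.idem K z j) (T.idem K z (j + 1)) (T.diffElt K z j))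
    (T.rightMul_comp K z)

instance : HasFiniteBiproducts (CochainComplex (ModuleCat.{max u v} (T.Omega K)) ℤ) :=
  Abelian.hasFiniteBiproducts

/-- The complex `Q`, the direct sum of the complexes `Q(z)` over all edges `z`. -/
noncomputable def tilting : CochainComplex (ModuleCat.{max u v} (T.Omega K)) ℤ :=
  ⨁ fun z : T.Edge => T.Q K z

/-- A complex of `Ω(T)`-modules as an object of the homotopy category. -/
noncomputable abbrev toHomotopy (X : CochainComplex (ModuleCat.{max u v} (T.Omega K)) ℤ) :
    HomotopyCategory (ModuleCat.{max u v} (T.Omega K)) (ComplexShape.up ℤ) :=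
  (HomotopyCategory.quotient _ _).obj X

end LoopBrauerGraph

/-!
Both `Ω(T)` and `Ω(n)` are generated by idempotents and by letters which a permutation `σ` arranges
in cycles; a product of two letters vanishes unless the second one is the successor of the first,
the only exception being `α₁²`.  The common laws are collected in `IsCyclicSystem`.  They imply that
words longer than a full turn vanish, so that the algebra is spanned by the words of at most one
full turn (`IsCyclicSystem.span_words`).  For `Ω(T)`, an explicit regular representation yields a
linear form which is `± 1` on the full turns and zero on all shorter words
(`LoopBrauerGraph.exists_socleForm`); hence all words of at most one full turn are nonzero.

A homomorphism `Ω(T)x → Ω(T)y` between modules generated by idempotents is right multiplication by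
an element of `xΩ(T)y`.  So the chain maps `Q(z) → Q(z')` are families of elements of `Ω(T)`, and
morphisms in the homotopy category are such families modulo boundaries of homotopies
(`toHom_surjective`, `toHom_eq_zero_iff`).  A homomorphism between the terms of degree `j` can be
nonzero only if the routes to `z` and `z'` agree up to the vertex at which their edges number `j`
start.  The routes are exact enough (`exists_factor`) that a chain map whose component in degree
`0` is a multiple of the full turn is homotopic to one concentrated in degree `0`
(`exists_turn_of_zero`).  The full turn in degree `0` is not null-homotopic as an endomorphism of
`Q(z)`, because the alternating sum of the values of the socle form on the components of a
null-homotopic endomorphism is zero (`turn_not_null`).  It is null-homotopic as a map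
`Q(z) → Q(z')` if the routes separate such that `z` comes first
(`Separates.turn_mem_nullMaps`), and in this case there is a chain map `Q(z) → Q(z')` which is the
identity as long as the routes agree, but none in the opposite direction.

Let `z` precede `z'` if the route to `z` starts earlier on the exceptional cycle than that to `z'`,
or if the routes have a common start and then separate in this way.  This is a linear order of the
edges with the loop at its end (`Precedes`).  For tree edges `z ≠ z'`, the space of morphisms
`Q(z) → Q(z')` is generated by a chain map beginning with the path along the exceptional cycle if
`z` precedes `z'`, and by the path through the loop otherwise; the composition of the two is the
full turn, so that both are nonzero.  In the same way, composition detects the linear independence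
of the other generators, and the dimensions follow.  Their sum is `n² + 3n` (`finrank_end`).

Numbering the edges against this order, with the loop first, the chain maps between consecutive
edges are the images of the arrows `β` of `Ω(n)`, while the image of the last arrow is the path from
the loop to the first edge in the order, with a minus sign: composition reverses products, and
`β₁⋯βᵣα₁ = -α₁β₁⋯βᵣ`.  The relations of `Ω(n)` hold for these images
(`IsRealization.map_rel`); the relation `βⱼ⋯βₙαβ₁⋯βⱼ = 0` does because the path through the loop
from an edge to a later one is null-homotopic (`single_through_mem_nullMaps`).  The resulting
homomorphism from `Ω(n)` to `End(Q)` is surjective, as all the generators above are products of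
images (`IsRealization.surjective`).  Since `Ω(n)` is spanned by `n² + 3n` words
(`NormalForm.finrank_le`), it is an isomorphism.
-/

/-! ### Words along the cycles of a permutation -/

section CyclicWords

/-- The product of `k` consecutive letters `a h * a (σ h) * ⋯ * a (σ^(k-1) h)`. -/
def cycProd {A H : Type*} [Monoid A] (σ : Equiv.Perm H) (a : H → A) (h : H) (k : ℕ) : A :=
  ((List.range k).map (fun j => a ((σ ^ j) h))).prod

section Monoid

variable {A H : Type*} [Monoid A] (σ : Equiv.Perm H) (a : H → A)

@[simp] theorem cycProd_zero (h : H) : cycProd σ a h 0 = 1 := by simp [cycProd]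

@[simp] theorem cycProd_one (h : H) : cycProd σ a h 1 = a h := by simp [cycProd]

theorem cycProd_succ (h : H) (k : ℕ) :
    cycProd σ a h (k + 1) = cycProd σ a h k * a ((σ ^ k) h) := by
  simp [cycProd, List.prod_range_succ]

theorem cycProd_add (h : H) (k m : ℕ) :
    cycProd σ a h (k + m) = cycProd σ a h k * cycProd σ a ((σ ^ k) h) m := by
  induction m with
  | zero => simp
  | succ m ih =>
    rw [← add_assoc, cycProd_succ, ih, cycProd_succ, mul_assoc, ← Equiv.Perm.mul_apply, ← pow_add,
      add_comm m k]

theorem cycProd_succ' (h : H) (k : ℕ) :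
    cycProd σ a h (k + 1) = a h * cycProd σ a (σ h) k := by
  rw [add_comm, cycProd_add]; simp

theorem map_cycProd {B : Type*} [Monoid B] (f : A →* B) (h : H) (k : ℕ) :
    f (cycProd σ a h k) = cycProd σ (fun x => f (a x)) h k := by
  simp [cycProd, map_list_prod, Function.comp_def]

end Monoid

/-- The laws shared by `Ω(T)` and `Ω(n)`.  The letters `a h` are permuted cyclically by `σ`, the
cycle of `h` has length `p h`, and `e` is a complete family of orthogonal idempotents.
A composable product of two letters is zero unless the second one is the successor of the first;
the only exception is the square of the letter `a l`, which is a full turn starting with `l`.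
The full turns starting with `l` and `σ l` are opposite to each other, and a word which is one
letter longer than a full turn is zero.  The law `long` states this only
away from `l` and `σ l`; for these two letters it follows from the other laws. -/
structure IsCyclicSystem {A H I : Type*} (K : Type*) [Field K] [Ring A] [Algebra K A] [Fintype I]
    (σ : Equiv.Perm H) (edge : H → I) (e : I → A) (a : H → A) (p : H → ℕ) (l : H) : Prop where
  e_mul_self (i : I) : e i * e i = e i
  e_orth (i j : I) : i ≠ j → e i * e j = 0
  sum_e : ∑ i, e i = 1
  edge_surj : Function.Surjective edge
  e_mul_a (h : H) : e (edge h) * a h = a h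
  a_mul_e (h : H) : a h * e (edge (σ h)) = a h
  adjoin_eq_top : Algebra.adjoin K (Set.range e ∪ Set.range a) = ⊤
  p_apply (h : H) : p (σ h) = p h
  pow_p (h : H) : (σ ^ p h) h = h
  two_le : 2 ≤ p l
  loop_ne : σ l ≠ l
  edge_loop : edge (σ l) = edge l
  mul_eq_zero (h k : H) : edge (σ h) = edge k → k ≠ σ h → ¬ (h = l ∧ k = l) → a h * a k = 0
  sq : a l * a l = cycProd σ a l (p l)
  anti : cycProd σ a l (p l) + cycProd σ a (σ l) (p l) = 0
  long (h : H) : h ≠ l → h ≠ σ l → cycProd σ a h (p h + 1) = 0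

/-- The word of `k` consecutive letters starting with `h`, as a path with a well-defined source:
for `k = 0` it is the idempotent of the edge of `h`. -/
def cycWord {A H I : Type*} [Monoid A] (σ : Equiv.Perm H) (edge : H → I) (e : I → A) (a : H → A)
    (h : H) (k : ℕ) : A := e (edge h) * cycProd σ a h k

section

variable {A H I : Type*} [Monoid A] (σ : Equiv.Perm H) (edge : H → I) (e : I → A) (a : H → A)

theorem cycWord_zero (h : H) : cycWord σ edge e a h 0 = e (edge h) := by simp [cycWord]

theorem cycWord_succ (h : H) (k : ℕ) :
    cycWord σ edge e a h (k + 1) = cycWord σ edge e a h k * a ((σ ^ k) h) := by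
  rw [cycWord, cycProd_succ, ← mul_assoc]; rfl

end

namespace IsCyclicSystem

variable {K A H I : Type*} [Field K] [Ring A] [Algebra K A] [Fintype I]
  {σ : Equiv.Perm H} {edge : H → I} {e : I → A} {a : H → A} {p : H → ℕ} {l : H}
  (hs : IsCyclicSystem K σ edge e a p l)

local notation "W" => cycWord σ edge e a

include hs

theorem p_pow (h : H) (k : ℕ) : p ((σ ^ k) h) = p h := by
  induction k with
  | zero => simp
  | succ k ih => rw [pow_succ', Equiv.Perm.mul_apply, hs.p_apply, ih]

theorem pow_inj_p {h h' : H} {k : ℕ} (hk : (σ ^ k) h = h') : p h' = p h := by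
  rw [← hk, hs.p_pow]

theorem word_pos (h : H) (k : ℕ) (hk : 0 < k) : W h k = cycProd σ a h k := by
  obtain ⟨k, rfl⟩ := Nat.exists_eq_succ_of_ne_zero hk.ne'
  rw [cycWord, Nat.succ_eq_add_one, cycProd_succ', ← mul_assoc, hs.e_mul_a]

theorem word_one (h : H) : W h 1 = a h := by rw [hs.word_pos h 1 one_pos, cycProd_one]

theorem e_mul_word (h : H) (k : ℕ) : e (edge h) * W h k = W h k := by
  rw [cycWord, ← mul_assoc, hs.e_mul_self]

theorem word_mul_e (h : H) (k : ℕ) : W h k * e (edge ((σ ^ k) h)) = W h k := by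
  cases k with
  | zero => simpa [cycWord] using hs.e_mul_self _
  | succ k => rw [cycWord_succ, pow_succ', Equiv.Perm.mul_apply, mul_assoc, hs.a_mul_e]

theorem word_mul_word (h : H) (k m : ℕ) : W h k * W ((σ ^ k) h) m = W h (k + m) := by
  rw [cycWord.eq_def σ edge e a ((σ ^ k) h), ← mul_assoc, hs.word_mul_e, cycWord, mul_assoc,
    ← cycProd_add, cycWord]

theorem word_mul_word' {h h' : H} {k : ℕ} (hk : (σ ^ k) h = h') (m : ℕ) :
    W h k * W h' m = W h (k + m) := by rw [← hk, hs.word_mul_word]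

theorem e_mul_word_of_ne {h : H} {i : I} (k : ℕ) (hi : edge h ≠ i) : e i * W h k = 0 := by
  rw [← hs.e_mul_word, ← mul_assoc, hs.e_orth _ _ hi.symm, zero_mul]

theorem word_mul_e_of_ne {h : H} {k : ℕ} {i : I} (hi : edge ((σ ^ k) h) ≠ i) :
    W h k * e i = 0 := by
  rw [← hs.word_mul_e, mul_assoc, hs.e_orth _ _ hi, mul_zero]

theorem word_mul_word_of_ne {h h' : H} {k : ℕ} (m : ℕ) (hi : edge ((σ ^ k) h) ≠ edge h') :
    W h k * W h' m = 0 := by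
  rw [← hs.e_mul_word h', ← mul_assoc, hs.word_mul_e_of_ne hi, zero_mul]

/-- Two words meeting at an edge multiply to zero if the second one continues around the other
vertex of that edge. -/
theorem word_mul_word_eq_zero {h h' : H} {k m : ℕ} (hk : 0 < k) (hm : 0 < m)
    (hne : h' ≠ (σ ^ k) h) (hl : h' ≠ l) : W h k * W h' m = 0 := by
  by_cases hi : edge ((σ ^ k) h) = edge h'
  · obtain ⟨k, rfl⟩ := Nat.exists_eq_succ_of_ne_zero hk.ne'
    obtain ⟨m, rfl⟩ := Nat.exists_eq_succ_of_ne_zero hm.ne'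
    rw [pow_succ', Equiv.Perm.mul_apply] at hi hne
    rw [Nat.succ_eq_add_one, cycWord_succ, hs.word_pos h' _ hm, cycProd_succ', ← mul_assoc,
      mul_assoc (W h k), hs.mul_eq_zero _ _ hi hne (fun h => hl h.2), mul_zero, zero_mul]
  · exact hs.word_mul_word_of_ne m hi

/-- A word which runs through more than a full turn is zero. -/
theorem cycProd_long (h : H) : cycProd σ a h (p h + 1) = 0 := by
  have two := hs.two_le
  have hl := hs.pow_p l
  obtain ⟨q, hq⟩ : ∃ q, p l = q + 1 := ⟨p l - 1, by omega⟩
  -- a full turn from `l` must be followed by `l`, not by `σ l`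
  have key : cycProd σ a l (p l) * a (σ l) = 0 := by
    rw [hq, pow_succ', Equiv.Perm.mul_apply] at hl
    rw [hq, cycProd_succ, mul_assoc, hs.mul_eq_zero, mul_zero]
    · rw [hl, hs.edge_loop]
    · rw [hl]; exact hs.loop_ne
    · rintro ⟨-, h⟩; exact hs.loop_ne h
  have hanti : cycProd σ a (σ l) (p l) = - cycProd σ a l (p l) := by
    rw [eq_neg_iff_add_eq_zero, add_comm, hs.anti]
  by_cases h1 : h = l
  · subst h1
    have : q ≠ 0 := by omega
    obtain ⟨q, rfl⟩ := Nat.exists_eq_succ_of_ne_zero this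
    rw [cycProd_succ', hanti, hq, cycProd_succ', mul_neg, ← mul_assoc, hs.sq,
      cycProd_succ', ← mul_assoc, key, zero_mul, neg_zero]
  by_cases h2 : h = σ l
  · subst h2
    have : (σ ^ p l) (σ l) = σ l := by
      rw [← Equiv.Perm.mul_apply, ← pow_succ, pow_succ', Equiv.Perm.mul_apply, hl]
    rw [hs.p_apply, cycProd_succ, hanti, this, neg_mul, key, neg_zero]
  · exact hs.long h h1 h2

theorem word_eq_zero (h : H) {k : ℕ} (hk : p h < k) : W h k = 0 := by
  obtain ⟨m, rfl⟩ := Nat.exists_eq_add_of_le hk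
  rw [cycWord, Nat.succ_eq_add_one, cycProd_add, hs.cycProd_long, zero_mul, mul_zero]

theorem word_turn_loop : W (σ l) (p l) = - W l (p l) := by
  have := hs.two_le
  rw [hs.word_pos _ _ (by omega), hs.word_pos _ _ (by omega), eq_neg_iff_add_eq_zero, add_comm,
    hs.anti]

theorem loop_mul_loop : a l * a l = W l (p l) := by
  have := hs.two_le
  rw [hs.sq, hs.word_pos _ _ (by omega)]

/-- A full turn starting with `l` which is preceded by a further letter is zero. -/
theorem word_mul_loop_sq {h : H} {k : ℕ} (hk : 0 < k) (hl : (σ ^ k) h = l) :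
    W h k * (a l * a l) = 0 := by
  rw [hs.loop_mul_loop, hs.word_mul_word' hl, hs.word_eq_zero]
  have := hs.pow_inj_p hl
  omega

/-- The square of `a l` is a full turn starting with `l`, which can be continued with `l` only, not
with `σ l`. -/
theorem loop_sq_mul_word {k : ℕ} (hk : 0 < k) : a l * a l * W (σ l) k = 0 := by
  rw [mul_assoc, ← hs.word_one l, hs.word_mul_word' (by simp), hs.word_one]
  by_cases h1 : 1 + k ≤ p l
  · obtain ⟨k, rfl⟩ := Nat.exists_eq_succ_of_ne_zero hk.ne'
    rw [← hs.word_mul_word' (h := l) (k := 1) rfl, ← mul_assoc, hs.word_one, hs.loop_mul_loop]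
    apply hs.word_mul_word_eq_zero
    · omega
    · omega
    · simpa [hs.pow_p] using hs.loop_ne
    · simpa using hs.loop_ne
  · rw [hs.word_eq_zero l (by omega), mul_zero]

/-- The words of length at most one full turn span the algebra. -/
theorem span_words : Submodule.span K {x | ∃ h k, k ≤ p h ∧ x = W h k} = ⊤ := by
  set M := Submodule.span K {x | ∃ h k, k ≤ p h ∧ x = W h k} with hM
  have mem (h : H) (k : ℕ) : W h k ∈ M := by
    by_cases hk : k ≤ p h
    · exact Submodule.subset_span ⟨h, k, hk, rfl⟩
    · rw [hs.word_eq_zero h (by omega)]; exact M.zero_mem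
  -- the span is a right ideal which contains all idempotents, hence also `1`
  have stable (x : A) : ∀ s ∈ M, s * x ∈ M := by
    have hx : x ∈ Algebra.adjoin K (Set.range e ∪ Set.range a) := by
      rw [hs.adjoin_eq_top]; trivial
    induction hx using Algebra.adjoin_induction with
    | mem x hx =>
      intro s hs'
      induction hs' using Submodule.span_induction with
      | zero => simp
      | add x y _ _ h1 h2 => rw [add_mul]; exact M.add_mem h1 h2
      | smul c x _ h1 => rw [smul_mul_assoc]; exact M.smul_mem _ h1
      | mem s hs' =>
        obtain ⟨h, k, -, rfl⟩ := hs'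
        rcases hx with ⟨i, rfl⟩ | ⟨g, rfl⟩
        · by_cases hi : edge ((σ ^ k) h) = i
          · rw [← hi, hs.word_mul_e]; exact mem _ _
          · rw [hs.word_mul_e_of_ne hi]; exact M.zero_mem
        · rw [← hs.word_one g]
          by_cases hg : g = (σ ^ k) h
          · rw [hg, hs.word_mul_word]; exact mem _ _
          by_cases hi : edge ((σ ^ k) h) = edge g
          · rcases k with - | k
            · simp only [pow_zero, Equiv.Perm.one_apply] at hi
              rw [cycWord_zero, hi, hs.e_mul_word]; exact mem _ _
            · rw [pow_succ', Equiv.Perm.mul_apply] at hi hg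
              rw [hs.word_one, cycWord_succ, mul_assoc]
              by_cases hl : (σ ^ k) h = l ∧ g = l
              · rw [hl.1, hl.2, hs.loop_mul_loop, hs.word_mul_word' hl.1]
                exact mem _ _
              · rw [hs.mul_eq_zero _ _ hi hg hl, mul_zero]; exact M.zero_mem
          · rw [hs.word_mul_word_of_ne _ hi]; exact M.zero_mem
    | algebraMap c =>
      intro s hs'
      rw [← Algebra.commutes, ← Algebra.smul_def]
      exact M.smul_mem _ hs'
    | add x y _ _ h1 h2 => intro s hs'; rw [mul_add]; exact M.add_mem (h1 s hs') (h2 s hs')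
    | mul x y _ _ h1 h2 => intro s hs'; rw [← mul_assoc]; exact h2 _ (h1 s hs')
  rw [eq_top_iff]
  intro x _
  rw [← one_mul x, ← hs.sum_e, Finset.sum_mul]
  refine M.sum_mem fun i _ => stable x _ ?_
  obtain ⟨h, rfl⟩ := hs.edge_surj i
  rw [← cycWord_zero σ edge e a]
  exact mem _ _

/-- The corner `e_i A e_j` is spanned by the words from `i` to `j`. -/
theorem mem_span_corner {i j : I} {x : A} (hi : e i * x = x) (hj : x * e j = x) :
    x ∈ Submodule.span K
      {y | ∃ h k, k ≤ p h ∧ edge h = i ∧ edge ((σ ^ k) h) = j ∧ y = W h k} := by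
  have hx : x ∈ Submodule.span K {x | ∃ h k, k ≤ p h ∧ x = W h k} := by
    rw [hs.span_words]; trivial
  have : e i * x * e j = x := by rw [hi, hj]
  rw [← this]
  clear this hi hj
  induction hx using Submodule.span_induction with
  | zero => simp
  | add x y _ _ h1 h2 => rw [mul_add, add_mul]; exact Submodule.add_mem _ h1 h2
  | smul c x _ h1 => rw [mul_smul_comm, smul_mul_assoc]; exact Submodule.smul_mem _ _ h1
  | mem x hx =>
    obtain ⟨h, k, hk, rfl⟩ := hx
    by_cases hi : edge h = i
    · by_cases hj : edge ((σ ^ k) h) = j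
      · refine Submodule.subset_span ⟨h, k, hk, hi, hj, ?_⟩
        rw [← hi, ← hj, hs.e_mul_word, hs.word_mul_e]
      · rw [mul_assoc, hs.word_mul_e_of_ne hj, mul_zero]; exact Submodule.zero_mem _
    · rw [hs.e_mul_word_of_ne k hi, zero_mul]; exact Submodule.zero_mem _

end IsCyclicSystem

end CyclicWords

/-! ### `Ω(T)` as a cyclic system -/

namespace PathAlgebra

variable (K : Type*) [Field K] {I J : Type*} (s t : J → I)

theorem vertex_mul_vertex_of_ne {i j : I} (h : i ≠ j) : vertex K s t i * vertex K s t j = 0 := by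
  rw [vertex, vertex, ← map_mul, ← map_zero (mk K s t)]
  exact RingQuot.mkAlgHom_rel K (PathRel.orth i j h)

theorem vertex_mul_arrow (a : J) : vertex K s t (s a) * arrow K s t a = arrow K s t a := by
  rw [vertex, arrow, ← map_mul]
  exact RingQuot.mkAlgHom_rel K (PathRel.source a)

theorem sum_vertex [Fintype I] : ∑ i, vertex K s t i = 1 := by
  have h := RingQuot.mkAlgHom_rel K (PathRel.one (K := K) (s := s) (t := t))
  rw [finsum_eq_sum_of_fintype, map_sum, map_one] at h
  exact h

theorem adjoin_eq_top :
    Algebra.adjoin K (Set.range (vertex K s t) ∪ Set.range (arrow K s t)) = ⊤ := by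
  have h : Set.range (vertex K s t) ∪ Set.range (arrow K s t) =
      mk K s t '' Set.range (FreeAlgebra.ι K) := by
    ext x
    constructor
    · rintro (⟨i, rfl⟩ | ⟨i, rfl⟩)
      · exact ⟨_, ⟨_, rfl⟩, rfl⟩
      · exact ⟨_, ⟨_, rfl⟩, rfl⟩
    · rintro ⟨_, ⟨i | i, rfl⟩, rfl⟩
      · exact Or.inl ⟨i, rfl⟩
      · exact Or.inr ⟨i, rfl⟩
  rw [h, ← AlgHom.map_adjoin, FreeAlgebra.adjoin_range_ι, Algebra.map_top, AlgHom.range_eq_top]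
  exact RingQuot.mkAlgHom_surjective K _

/-- The universal property of the path algebra. -/
theorem exists_lift [Fintype I] {B : Type*} [Ring B] [Algebra K B] (f : I → B) (g : J → B)
    (idem : ∀ i, f i * f i = f i) (orth : ∀ i j, i ≠ j → f i * f j = 0) (one : ∑ i, f i = 1)
    (source : ∀ a, f (s a) * g a = g a) (target : ∀ a, g a * f (t a) = g a) :
    ∃ F : PathAlgebra K s t →ₐ[K] B,
      (∀ i, F (vertex K s t i) = f i) ∧ ∀ a, F (arrow K s t a) = g a := by
  refine ⟨RingQuot.liftAlgHom K ⟨FreeAlgebra.lift K (Sum.elim f g), ?_⟩, ?_, ?_⟩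
  · rintro _ _ (i | ⟨i, j, hij⟩ | a | a | _)
    · simpa using idem i
    · simpa using orth i j hij
    · simpa using source a
    · simpa using target a
    · simpa [finsum_eq_sum_of_fintype] using one
  · intro i
    exact (RingQuot.liftAlgHom_mkAlgHom_apply _ _ _ _).trans (by simp)
  · intro i
    exact (RingQuot.liftAlgHom_mkAlgHom_apply _ _ _ _).trans (by simp)

end PathAlgebra

namespace LoopBrauerGraph

universe u v

variable {V : Type v} [Finite V] (T : LoopBrauerGraph V)

/-- The length of the cycle of a half-edge, the valency of its vertex. -/
noncomputable def val (h : T.HalfEdge) : ℕ := Function.minimalPeriod T.next h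

theorem val_pos (h : T.HalfEdge) : 0 < T.val h :=
  Function.minimalPeriod_pos_of_mem_periodicPts
    (Function.Injective.mem_periodicPts T.next.injective h)

theorem pow_next_eq_iff {h : T.HalfEdge} {k m : ℕ} :
    (T.next ^ k) h = (T.next ^ m) h ↔ k ≡ m [MOD T.val h] := by
  have h0 := T.val_pos h
  rw [← Equiv.Perm.iterate_eq_pow, ← Equiv.Perm.iterate_eq_pow, val,
    ← Function.iterate_mod_minimalPeriod_eq (n := k),
    ← Function.iterate_mod_minimalPeriod_eq (n := m),
    Function.iterate_eq_iterate_iff_of_lt_minimalPeriod (Nat.mod_lt _ h0) (Nat.mod_lt _ h0)]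
  rfl

theorem pow_val (h : T.HalfEdge) : (T.next ^ T.val h) h = h := by
  have := (T.pow_next_eq_iff (h := h) (k := T.val h) (m := 0)).2 (by simp [Nat.ModEq])
  simpa using this

theorem val_next (h : T.HalfEdge) : T.val (T.next h) = T.val h :=
  Function.minimalPeriod_apply (Function.Injective.mem_periodicPts T.next.injective h)

theorem val_pow (h : T.HalfEdge) (k : ℕ) : T.val ((T.next ^ k) h) = T.val h := by
  induction k with
  | zero => simp
  | succ k ih => rw [pow_succ', Equiv.Perm.mul_apply, val_next, ih]

theorem steps_eq {h : T.HalfEdge} {k : ℕ} (hk : 0 < k) (hk' : k ≤ T.val h) :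
    T.steps h ((T.next ^ k) h) = k := by
  have hc : T.next.SameCycle h ((T.next ^ k) h) := ⟨k, by simp⟩
  have h2 : T.steps h ((T.next ^ k) h) ≤ k := Nat.sInf_le ⟨hk, rfl⟩
  obtain ⟨h0, h1⟩ := T.steps_spec hc
  replace h1 := T.pow_next_eq_iff.1 h1
  by_contra hne
  rw [Nat.modEq_iff_dvd' h2] at h1
  have := Nat.le_of_dvd (by omega) h1
  omega

theorem steps_self (h : T.HalfEdge) : T.steps h h = T.val h := by
  conv_lhs => rw [← T.pow_val h, T.pow_val h]
  have := T.steps_eq (T.val_pos h) le_rfl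
  rwa [pow_val] at this

theorem exists_pow {h h' : T.HalfEdge} (H : T.next.SameCycle h h') (hne : h ≠ h') :
    ∃ k, 0 < k ∧ k < T.val h ∧ (T.next ^ k) h = h' := by
  obtain ⟨m, hm, -, rfl⟩ := H.exists_pow_eq''
  refine ⟨m % T.val h, ?_, Nat.mod_lt _ (T.val_pos h), T.pow_next_eq_iff.2 (Nat.mod_modEq _ _)⟩
  rw [Nat.pos_iff_ne_zero]
  intro h0
  apply hne
  have := T.pow_next_eq_iff.2 (Nat.mod_modEq m (T.val h))
  rw [h0] at this
  simpa using this

theorem edge_surjective : Function.Surjective T.edge := by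
  rintro (_ | ⟨⟨a, b⟩, hz⟩)
  · exact ⟨Sum.inr true, rfl⟩
  · exact ⟨Sum.inl ⟨(a, b), hz⟩, rfl⟩

theorem edge_opp (h : T.HalfEdge) : T.edge (T.opp h) = T.edge h := by
  rcases h with d | b <;> simp [opp, edge]

theorem edge_eq_iff {h k : T.HalfEdge} : T.edge h = T.edge k ↔ h = k ∨ h = T.opp k := by
  constructor
  · rcases h with d | b <;> rcases k with d' | b'
    · intro h
      simp only [edge, Option.some.injEq, Subtype.mk.injEq, SimpleGraph.dart_edge_eq_iff] at h
      simpa [opp] using h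
    · simp [edge]
    · simp [edge]
    · intro _
      cases b <;> cases b' <;> simp [opp]
  · rintro (rfl | rfl)
    · rfl
    · exact T.edge_opp k

theorem arc_eq_cycProd (K : Type u) [Field K] (h h' : T.HalfEdge) :
    T.arc K h h' = cycProd T.next (T.arrow K) h (T.steps h h') := rfl

variable (K : Type u) [Field K]

/-- The arrow of the half-edge `h` as an element of `Ω(T)`. -/
noncomputable def letter (h : T.HalfEdge) : T.Omega K := T.toOmega K (T.arrow K h)

noncomputable instance : Fintype T.Edge := Fintype.ofFinite _

theorem toOmega_arc (h h' : T.HalfEdge) :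
    T.toOmega K (T.arc K h h') = cycProd T.next (T.letter K) h (T.steps h h') := by
  rw [arc_eq_cycProd]
  exact map_cycProd T.next (T.arrow K) (T.toOmega K : T.PathAlg K →* T.Omega K) h _

theorem two_le_val_loop : 2 ≤ T.val (Sum.inr false) := by
  by_contra hlt
  have h1 : T.val (Sum.inr false) = 1 := by have := T.val_pos (Sum.inr false); omega
  have h2 := T.pow_val (Sum.inr false)
  rw [h1, pow_one, T.next_loop] at h2
  simp at h2

/-- `Ω(T)` obeys the laws of a cyclic system: the letters are the half-edges, permuted by the cyclic
orderings at the vertices, and the exceptional letter `α₁` is the first half of the loop. -/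
theorem isCyclicSystem : IsCyclicSystem K T.next T.edge (T.e K) (T.letter K) T.val
    (Sum.inr false) where
  e_mul_self i := by rw [e, ← map_mul, PathAlgebra.vertex_mul_self]
  e_orth i j h := by rw [e, e, ← map_mul, PathAlgebra.vertex_mul_vertex_of_ne _ _ _ h, map_zero]
  sum_e := by simp only [e]; rw [← map_sum, PathAlgebra.sum_vertex, map_one]
  edge_surj := T.edge_surjective
  e_mul_a h := by
    rw [e, letter, ← map_mul, arrow]
    exact congrArg _ (PathAlgebra.vertex_mul_arrow K T.edge (fun h => T.edge (T.next h)) h)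
  a_mul_e h := by
    rw [e, letter, ← map_mul, arrow]
    exact congrArg _ (PathAlgebra.arrow_mul_vertex K T.edge (fun h => T.edge (T.next h)) h)
  adjoin_eq_top := by
    have h : Set.range (T.e K) ∪ Set.range (T.letter K) = T.toOmega K ''
        (Set.range (PathAlgebra.vertex K T.edge (fun h => T.edge (T.next h))) ∪
          Set.range (PathAlgebra.arrow K T.edge (fun h => T.edge (T.next h)))) := by
      rw [Set.image_union, ← Set.range_comp, ← Set.range_comp]; rfl
    rw [h, ← AlgHom.map_adjoin, PathAlgebra.adjoin_eq_top, Algebra.map_top, AlgHom.range_eq_top]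
    exact RingQuot.mkAlgHom_surjective K _
  p_apply := T.val_next
  pow_p := T.pow_val
  two_le := T.two_le_val_loop
  loop_ne := by rw [T.next_loop]; simp
  edge_loop := by rw [T.next_loop]; rfl
  mul_eq_zero h k hi hne hl := by
    rcases T.edge_eq_iff.1 hi with h1 | h1
    · exact absurd h1.symm hne
    -- the letter `h` ends at the other half of the edge of `k`
    have h2 : h = T.next⁻¹ (T.opp k) := by rw [← h1]; simp
    rw [letter, letter, ← map_mul, ← map_zero (T.toOmega K), h2]
    rcases k with d | b
    · exact T.toOmega_rel K (Rel.zero d)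
    · cases b
      · refine absurd ⟨?_, rfl⟩ hl
        rw [h2, Equiv.Perm.inv_eq_iff_eq, T.next_loop]; rfl
      · exact T.toOmega_rel K Rel.loop_zero
  sq := by
    rw [← steps_self, ← toOmega_arc, letter, ← map_mul]
    exact T.toOmega_rel K Rel.loop_sq
  anti := by
    have h := T.toOmega_rel K (Rel.loop_anti (T := T) (K := K))
    rwa [map_add, map_zero, toOmega_arc, toOmega_arc, steps_self, steps_self, ← T.next_loop,
      val_next] at h
  long h h1 h2 := by
    -- the full turn of `h` is also that of the opposite half-edge, which does not continue with `h`
    rw [T.next_loop] at h2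
    rcases h with d | b
    · have ht := T.toOmega_rel K (Rel.turn (K := K) d)
      rw [toOmega_arc, toOmega_arc, steps_self, steps_self] at ht
      rw [cycProd_succ, pow_val, ht]
      obtain ⟨q, hq⟩ : ∃ q, T.val (Sum.inl d.symm) = q + 1 :=
        ⟨T.val (Sum.inl d.symm) - 1, by have := T.val_pos (Sum.inl d.symm); omega⟩
      have h3 := T.pow_val (Sum.inl d.symm)
      rw [hq, pow_succ', Equiv.Perm.mul_apply] at h3
      have h4 : (T.next ^ q) (Sum.inl d.symm) = T.next⁻¹ (Sum.inl d.symm) := by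
        rw [eq_comm, Equiv.Perm.inv_eq_iff_eq, h3]
      rw [hq, cycProd_succ, mul_assoc, h4, letter, letter, ← map_mul,
        T.toOmega_rel K (Rel.zero d), map_zero, mul_zero]
    · cases b
      · exact absurd rfl h1
      · exact absurd rfl h2

end LoopBrauerGraph

/-! ### The regular representation of `Ω(T)` -/

namespace LoopBrauerGraph

universe u v

variable {V : Type v} [Finite V] (T : LoopBrauerGraph V)

/-- Labels for a basis of `Ω(T)`: idempotents, proper words and socle elements.  The labels
`word h k` with `k = 0` or `T.val h ≤ k` are superfluous; all letters act on them as zero. -/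
inductive RegBasis : Type v
  | vertex (z : T.Edge)
  | word (h : T.HalfEdge) (k : ℕ)
  | soc (z : T.Edge)

namespace RegBasis

/-- The edge at which a basis element starts. -/
def src : T.RegBasis → T.Edge
  | vertex z => z
  | word h _ => T.edge h
  | soc z => z

end RegBasis

variable (K : Type u) [Field K]

open Classical in
/-- The sign of a full turn in terms of the socle element of the edge; it is `-1` for
`β₁ ⋯ βᵣ α₁` only. -/
noncomputable def turnSign (h : T.HalfEdge) : K := if h = Sum.inr true then -1 else 1

open Classical in
/-- The vector of the word of length `k ≥ 1` starting with `h`. -/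
noncomputable def wordVec (h : T.HalfEdge) (k : ℕ) : T.RegBasis →₀ K :=
  if k < T.val h then Finsupp.single (.word h k) 1
  else if k = T.val h then Finsupp.single (.soc (T.edge h)) (T.turnSign K h) else 0

open Classical in
/-- Left multiplication by an idempotent in the regular representation. -/
noncomputable def vertexOp (i : T.Edge) : Module.End K (T.RegBasis →₀ K) :=
  Finsupp.linearCombination K fun b => if b.src = i then Finsupp.single b (1 : K) else 0

open Classical in
/-- Left multiplication by a letter on the basis of the regular representation.  A letter extends
the words which start with its successor; besides, `α₁` maps itself to the socle element of the
loop, as `α₁²` is a full turn. -/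
noncomputable def letterOpFun (g : T.HalfEdge) : T.RegBasis → T.RegBasis →₀ K
  | .vertex z => if z = T.edge (T.next g) then T.wordVec K g 1 else 0
  | .word h k =>
    if h = T.next g ∧ 0 < k ∧ k < T.val h then T.wordVec K g (k + 1)
    else if g = Sum.inr false ∧ h = Sum.inr false ∧ k = 1 then Finsupp.single (.soc none) 1 else 0
  | .soc _ => 0

/-- Left multiplication by a letter in the regular representation. -/
noncomputable def letterOp (g : T.HalfEdge) : Module.End K (T.RegBasis →₀ K) :=
  Finsupp.linearCombination K (T.letterOpFun K g)

theorem letterOp_single (g : T.HalfEdge) (b : T.RegBasis) (c : K) :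
    T.letterOp K g (Finsupp.single b c) = c • T.letterOpFun K g b := by
  simp [letterOp]

open Classical in
theorem vertexOp_single (i : T.Edge) (b : T.RegBasis) (c : K) :
    T.vertexOp K i (Finsupp.single b c) = if b.src = i then Finsupp.single b c else 0 := by
  simp [vertexOp]

open Classical in
theorem vertexOp_wordVec (i : T.Edge) (h : T.HalfEdge) (k : ℕ) :
    T.vertexOp K i (T.wordVec K h k) = if T.edge h = i then T.wordVec K h k else 0 := by
  unfold wordVec
  split_ifs <;> simp_all [vertexOp_single, RegBasis.src]

theorem letterOp_wordVec (g : T.HalfEdge) {k : ℕ} (hk : 0 < k) :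
    T.letterOp K g (T.wordVec K (T.next g) k) = T.wordVec K g (k + 1) := by
  rw [wordVec]
  split_ifs with h1 h2
  · rw [letterOp_single, letterOpFun, if_pos ⟨rfl, hk, h1⟩, one_smul]
  · rw [letterOp_single, letterOpFun, smul_zero, wordVec, if_neg, if_neg] <;>
      rw [h2, val_next] <;> omega
  · rw [val_next] at h1 h2
    rw [map_zero, wordVec, if_neg, if_neg] <;> omega

theorem letterOp_wordVec_of_ne {g h : T.HalfEdge} {k : ℕ} (hk : h ≠ T.next g)
    (hl : ¬ (g = Sum.inr false ∧ h = Sum.inr false ∧ k = 1)) :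
    T.letterOp K g (T.wordVec K h k) = 0 := by
  rw [wordVec]
  split_ifs with h1 h2
  · rw [letterOp_single, letterOpFun, if_neg (fun h => hk h.1), if_neg hl, smul_zero]
  · rw [letterOp_single, letterOpFun, smul_zero]
  · rw [map_zero]

theorem cycProd_letterOp_wordVec (g : T.HalfEdge) (m : ℕ) {k : ℕ} (hk : 0 < k) :
    cycProd T.next (T.letterOp K) g m (T.wordVec K ((T.next ^ m) g) k) =
      T.wordVec K g (m + k) := by
  induction m generalizing g with
  | zero => simp
  | succ m ih =>
    rw [cycProd_succ', Module.End.mul_apply, pow_succ, Equiv.Perm.mul_apply, ih,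
      T.letterOp_wordVec K g (by omega), add_right_comm]

open Classical in
theorem cycProd_letterOp_vertex (g : T.HalfEdge) {m : ℕ} (hm : 0 < m) (z : T.Edge) (c : K) :
    cycProd T.next (T.letterOp K) g m (Finsupp.single (.vertex z) c) =
      if z = T.edge ((T.next ^ m) g) then c • T.wordVec K g m else 0 := by
  obtain ⟨m, rfl⟩ := Nat.exists_eq_succ_of_ne_zero hm.ne'
  rw [Nat.succ_eq_add_one, cycProd_succ, Module.End.mul_apply, letterOp_single, letterOpFun,
    pow_succ', Equiv.Perm.mul_apply]
  split_ifs
  · rw [map_smul, cycProd_letterOp_wordVec _ _ _ _ one_pos]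
  · simp

theorem cycProd_letterOp_soc (g : T.HalfEdge) {m : ℕ} (hm : 0 < m) (z : T.Edge) (c : K) :
    cycProd T.next (T.letterOp K) g m (Finsupp.single (.soc z) c) = 0 := by
  obtain ⟨m, rfl⟩ := Nat.exists_eq_succ_of_ne_zero hm.ne'
  rw [Nat.succ_eq_add_one, cycProd_succ, Module.End.mul_apply, letterOp_single, letterOpFun,
    smul_zero, map_zero]

/-- A full turn annihilates all proper words. -/
theorem turn_word (g h : T.HalfEdge) (k : ℕ) (c : K) :
    cycProd T.next (T.letterOp K) g (T.val g) (Finsupp.single (.word h k) c) = 0 := by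
  obtain ⟨q, hq⟩ : ∃ q, T.val g = q + 1 := ⟨T.val g - 1, by have := T.val_pos g; omega⟩
  rw [hq, cycProd_succ, Module.End.mul_apply, letterOp_single, letterOpFun]
  split_ifs with h1 h2
  · rw [map_smul, T.cycProd_letterOp_wordVec K _ _ (by omega), wordVec, if_neg, if_neg, smul_zero]
      <;> omega
  · have h3 := T.val_pow g q
    have h4 := T.two_le_val_loop
    rw [h2.1] at h3
    rw [map_smul, T.cycProd_letterOp_soc K _ (by omega), smul_zero]
  · simp

/-- The full turns around the two ends of a tree edge act in the same way: both map the idempotent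
to the socle element and everything else to zero. -/
theorem turn_inl (d : T.graph.Dart) :
    cycProd T.next (T.letterOp K) (Sum.inl d) (T.val (Sum.inl d)) =
      cycProd T.next (T.letterOp K) (Sum.inl d.symm) (T.val (Sum.inl d.symm)) := by
  refine Finsupp.lhom_ext fun b c => ?_
  rcases b with z | ⟨h, k⟩ | z
  · rw [cycProd_letterOp_vertex _ _ _ (T.val_pos _), cycProd_letterOp_vertex _ _ _ (T.val_pos _),
      pow_val, pow_val]
    have he : T.edge (Sum.inl d.symm) = T.edge (Sum.inl d) := T.edge_opp (Sum.inl d)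
    rw [wordVec, wordVec, he]
    simp [turnSign]
  · rw [turn_word, turn_word]
  · rw [cycProd_letterOp_soc _ _ _ (T.val_pos _), cycProd_letterOp_soc _ _ _ (T.val_pos _)]

/-- The relation `α₁² = α₁β₁⋯βᵣ` for the operators. -/
theorem loop_sq_op :
    T.letterOp K (Sum.inr false) * T.letterOp K (Sum.inr false) =
      cycProd T.next (T.letterOp K) (Sum.inr false) (T.val (Sum.inr false)) := by
  have h2 := T.two_le_val_loop
  refine Finsupp.lhom_ext fun b c => ?_
  rw [Module.End.mul_apply, letterOp_single]
  rcases b with z | ⟨h, k⟩ | z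
  · rw [cycProd_letterOp_vertex _ _ _ (T.val_pos _), letterOpFun, pow_val, T.next_loop]
    change (T.letterOp K _ (c • if z = none then _ else _)) = if z = none then _ else _
    split_ifs with hz
    · rw [map_smul, wordVec, if_pos (by omega), letterOp_single, letterOpFun, if_neg, if_pos,
        wordVec, if_neg, if_pos rfl]
      · simp [edge, turnSign]
      · omega
      · simp
      · simp [T.next_loop]
    · simp
  · rw [turn_word, letterOpFun]
    split_ifs with h1 h2
    · rw [map_smul, letterOp_wordVec_of_ne, smul_zero]
      · simp [T.next_loop]
      · omega
    · rw [map_smul, letterOp_single, letterOpFun]; simp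
    · simp
  · rw [cycProd_letterOp_soc _ _ _ (T.val_pos _), letterOpFun]; simp

/-- The relation `α₁β₁⋯βᵣ + β₁⋯βᵣα₁ = 0` for the operators. -/
theorem loop_anti_op :
    cycProd T.next (T.letterOp K) (Sum.inr false) (T.val (Sum.inr false)) +
      cycProd T.next (T.letterOp K) (Sum.inr true) (T.val (Sum.inr true)) = 0 := by
  refine Finsupp.lhom_ext fun b c => ?_
  rw [LinearMap.add_apply]
  rcases b with z | ⟨h, k⟩ | z
  · rw [cycProd_letterOp_vertex _ _ _ (T.val_pos _), cycProd_letterOp_vertex _ _ _ (T.val_pos _),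
      pow_val, pow_val]
    change (if z = none then _ else _) + (if z = none then _ else _) = _
    split_ifs
    · simp [wordVec, edge, turnSign]
    · simp
  · rw [turn_word, turn_word]; simp
  · rw [cycProd_letterOp_soc _ _ _ (T.val_pos _), cycProd_letterOp_soc _ _ _ (T.val_pos _)]; simp

/-- A letter acts as zero on everything which starts with the other half of its end. -/
theorem letterOp_mul_of_ne {g h : T.HalfEdge} (hne : h ≠ T.next g)
    (hl : ¬ (g = Sum.inr false ∧ h = Sum.inr false)) :
    T.letterOp K g * T.letterOp K h = 0 := by
  refine Finsupp.lhom_ext fun b c => ?_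
  rw [Module.End.mul_apply, letterOp_single, map_smul]
  have (k : ℕ) : T.letterOp K g (T.wordVec K h k) = 0 :=
    T.letterOp_wordVec_of_ne K hne fun h => hl ⟨h.1, h.2.1⟩
  rcases b with z | ⟨h, k⟩ | z
  · rw [letterOpFun]; split_ifs <;> simp [this]
  · rw [letterOpFun]
    split_ifs
    · simp [this]
    · simp [letterOp_single, letterOpFun]
    · simp
  · simp [letterOpFun]

/-- The regular representation of `Ω(T)`: the operators satisfy the relations of `Ω(T)`. -/
theorem exists_regRep : ∃ F : T.Omega K →ₐ[K] Module.End K (T.RegBasis →₀ K),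
    (∀ i, F (T.e K i) = T.vertexOp K i) ∧ ∀ h, F (T.letter K h) = T.letterOp K h := by
  classical
  obtain ⟨F, hF, hF'⟩ := PathAlgebra.exists_lift K T.edge (fun h => T.edge (T.next h))
    (T.vertexOp K) (T.letterOp K)
    (fun i => by
      refine Finsupp.lhom_ext fun b c => ?_
      rw [Module.End.mul_apply, vertexOp_single]
      split_ifs with h
      · rw [vertexOp_single, if_pos h]
      · simp)
    (fun i j hij => by
      refine Finsupp.lhom_ext fun b c => ?_
      rw [Module.End.mul_apply, vertexOp_single]
      split_ifs with h
      · rw [vertexOp_single, if_neg (by rw [h]; exact hij.symm)]; rfl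
      · simp)
    (by
      refine Finsupp.lhom_ext fun b c => ?_
      simp [LinearMap.sum_apply, vertexOp_single])
    (fun g => by
      refine Finsupp.lhom_ext fun b c => ?_
      rw [Module.End.mul_apply, letterOp_single, map_smul]
      congr 1
      rcases b with z | ⟨h, k⟩ | z
      · rw [letterOpFun]; split_ifs <;> simp [vertexOp_wordVec]
      · rw [letterOpFun]
        split_ifs with h1 h2
        · simp [vertexOp_wordVec]
        · simp [vertexOp_single, RegBasis.src, h2.1, edge]
        · simp
      · simp [letterOpFun])
    (fun g => by
      refine Finsupp.lhom_ext fun b c => ?_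
      rw [Module.End.mul_apply, vertexOp_single]
      split_ifs with h
      · rfl
      · rw [map_zero, letterOp_single]
        rcases b with z | ⟨h', k⟩ | z
        · rw [letterOpFun, if_neg (by exact h), smul_zero]
        · rw [letterOpFun, if_neg, if_neg, smul_zero]
          · rintro ⟨rfl, rfl, -⟩
            exact h (by rw [T.next_loop]; rfl)
          · rintro ⟨rfl, -⟩
            exact h rfl
        · simp [letterOpFun])
  have harc (h h' : T.HalfEdge) :
      F (T.arc K h h') = cycProd T.next (T.letterOp K) h (T.steps h h') := by
    rw [arc_eq_cycProd]
    refine (map_cycProd T.next (T.arrow K) (F : _ →* Module.End K (T.RegBasis →₀ K)) h _).trans ?_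
    congr 1
    funext x
    exact hF' x
  refine ⟨RingQuot.liftAlgHom K ⟨F, ?_⟩, ?_, ?_⟩
  · rintro _ _ (d | _ | d | _ | _)
    · simp only [map_mul, map_zero, arrow, hF']
      exact T.letterOp_mul_of_ne K (by simpa using d.symm_ne.symm) (by simp)
    · simp only [map_mul, map_zero, arrow, hF']
      exact T.letterOp_mul_of_ne K (by simp) (by simp)
    · rw [harc, harc, steps_self, steps_self, turn_inl]
    · rw [harc, steps_self, map_mul, ← loop_sq_op]
      simp only [arrow, hF']
    · rw [map_add, map_zero, harc, harc, steps_self, steps_self, loop_anti_op]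
  · intro i
    exact (RingQuot.liftAlgHom_mkAlgHom_apply _ _ _ _).trans (hF i)
  · intro i
    exact (RingQuot.liftAlgHom_mkAlgHom_apply _ _ _ _).trans (hF' i)

/-- The word of `k` consecutive arrows around a vertex of `T`, starting at the half-edge `h`. -/
noncomputable abbrev word (h : T.HalfEdge) (k : ℕ) : T.Omega K :=
  cycWord T.next T.edge (T.e K) (T.letter K) h k

/-- There is a linear form on `Ω(T)` which takes the value `± 1` on full turns and vanishes on
idempotents and on all proper words. -/
theorem exists_socleForm : ∃ φ : T.Omega K →ₗ[K] K, ∀ h k,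
    (k = T.val h → φ (T.word K h k) = T.turnSign K h) ∧ (k ≠ T.val h → φ (T.word K h k) = 0) := by
  classical
  obtain ⟨F, hF, hF'⟩ := T.exists_regRep K
  -- the sum of the socle coordinates of `x` applied to the idempotents
  let φ : T.Omega K →ₗ[K] K := ∑ z : T.Edge,
    (Finsupp.lapply (.soc z)).comp
      ((LinearMap.applyₗ (R := K) (Finsupp.single (.vertex z) (1 : K))).comp F.toLinearMap)
  have hφ (x : T.Omega K) : φ x = ∑ z, F x (Finsupp.single (.vertex z) 1) (.soc z) := by
    simp [φ]
  refine ⟨φ, fun h k => ?_⟩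
  rw [hφ]
  rcases Nat.eq_zero_or_pos k with rfl | hk
  · refine ⟨fun h0 => absurd h0 (T.val_pos h).ne, fun _ => ?_⟩
    rw [word, cycWord_zero, hF]
    refine Finset.sum_eq_zero fun z _ => ?_
    rw [vertexOp_single]
    split_ifs <;> simp
  · have hw : F (T.word K h k) = cycProd T.next (T.letterOp K) h k := by
      rw [word, (T.isCyclicSystem K).word_pos h k hk]
      refine (map_cycProd T.next (T.letter K) (F : _ →* Module.End K (T.RegBasis →₀ K)) h _).trans ?_
      congr 1
      funext x
      exact hF' x
    simp only [hw, T.cycProd_letterOp_vertex K h hk, one_smul]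
    refine ⟨fun h0 => ?_, fun h0 => ?_⟩
    · subst h0
      rw [pow_val, Finset.sum_eq_single (T.edge h)]
      · simp [wordVec]
      · intro z _ hz; simp [hz]
      · simp
    · refine Finset.sum_eq_zero fun z _ => ?_
      split_ifs
      · rw [wordVec]
        split_ifs <;> simp
      · simp

end LoopBrauerGraph

/-! ### The corners of `Ω(T)` -/

namespace LoopBrauerGraph

universe u v

variable {V : Type v} [Finite V] (T : LoopBrauerGraph V)

/-- The vertex of a half-edge. -/
def vtx : T.HalfEdge → V := Sum.elim (fun d => d.fst) (fun _ => T.S)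

theorem vtx_pow (h : T.HalfEdge) (k : ℕ) : T.vtx ((T.next ^ k) h) = T.vtx h :=
  ((T.sameCycle_iff _ _).1 ⟨k, by simp⟩).symm

theorem exists_pow_of_vtx {h h' : T.HalfEdge} (H : T.vtx h = T.vtx h') (hne : h ≠ h') :
    ∃ k, 0 < k ∧ k < T.val h ∧ (T.next ^ k) h = h' :=
  T.exists_pow ((T.sameCycle_iff _ _).2 H) hne

theorem eq_of_pow_eq {h : T.HalfEdge} {k m : ℕ} (hk : 0 < k) (hk' : k < T.val h)
    (hm : m ≤ T.val h) (H : (T.next ^ m) h = (T.next ^ k) h) : m = k := by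
  have h1 := T.pow_next_eq_iff.1 H
  rcases hm.lt_or_eq with hm | rfl
  · exact h1.eq_of_lt_of_lt hm hk'
  · have h2 : 0 ≡ k [MOD T.val h] := (by simp [Nat.ModEq] : 0 ≡ T.val h [MOD T.val h]).trans h1
    exact absurd (h2.eq_of_lt_of_lt (T.val_pos h) hk') hk.ne

theorem eq_zero_or_val {h : T.HalfEdge} {m : ℕ} (hm : m ≤ T.val h) (H : (T.next ^ m) h = h) :
    m = 0 ∨ m = T.val h := by
  have h1 := T.pow_next_eq_iff.1 (H.trans (by simp : h = (T.next ^ 0) h))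
  rcases hm.lt_or_eq with hm | rfl
  · exact Or.inl (h1.eq_of_lt_of_lt hm (T.val_pos h))
  · exact Or.inr rfl

/-- The number of arrows of the exceptional cycle. -/
noncomputable def excLength : ℕ := T.val (Sum.inr true) - 1

theorem val_loop : T.val (Sum.inr true) = T.val (Sum.inr false) := by
  rw [← T.next_loop, val_next]

theorem val_inr (b : Bool) : T.val (Sum.inr b) = T.excLength + 1 := by
  have h := T.val_loop
  have := T.val_pos (Sum.inr true)
  cases b <;> rw [excLength] <;> omega

theorem excLength_pos : 0 < T.excLength := by
  have := T.two_le_val_loop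
  rw [val_inr] at this
  omega

theorem pow_excLength : (T.next ^ T.excLength) (Sum.inr true) = Sum.inr false := by
  have h := T.pow_val (Sum.inr true)
  rw [val_inr, pow_succ', Equiv.Perm.mul_apply, ← T.next_loop] at h
  simpa [T.next_loop] using T.next.injective h

/-- The half-edges of tree edges at `S`, numbered along the exceptional cycle. -/
theorem exists_pow_S {d : T.graph.Dart} (hd : d.fst = T.S) :
    ∃ k, 0 < k ∧ k < T.excLength ∧ (T.next ^ k) (Sum.inr true) = Sum.inl d := by
  obtain ⟨k, h1, h2, h3⟩ := T.exists_pow_of_vtx (h := Sum.inr true) (h' := Sum.inl d)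
    hd.symm (by simp)
  refine ⟨k, h1, ?_, h3⟩
  rw [val_inr] at h2
  rcases Nat.lt_succ_iff_lt_or_eq.1 h2 with h | rfl
  · exact h
  · rw [pow_excLength] at h3; simp at h3

theorem edge_eq_edge_inl {h : T.HalfEdge} {d : T.graph.Dart} (H : T.edge h = T.edge (Sum.inl d)) :
    h = Sum.inl d ∨ h = Sum.inl d.symm := T.edge_eq_iff.1 H

theorem edge_eq_none {h : T.HalfEdge} (H : T.edge h = none) :
    h = Sum.inr false ∨ h = Sum.inr true := by
  rcases h with d | b
  · simp [edge] at H
  · cases b <;> simp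

variable (K : Type u) [Field K]

theorem word_zero (h : T.HalfEdge) : T.word K h 0 = T.e K (T.edge h) := cycWord_zero ..

theorem word_mul_word {h h' : T.HalfEdge} {k : ℕ} (hk : (T.next ^ k) h = h') (m : ℕ) :
    T.word K h k * T.word K h' m = T.word K h (k + m) :=
  (T.isCyclicSystem K).word_mul_word' hk m

theorem word_eq_zero {h : T.HalfEdge} {k : ℕ} (hk : T.val h < k) : T.word K h k = 0 :=
  (T.isCyclicSystem K).word_eq_zero h hk

theorem word_mul_word_eq_zero {h h' : T.HalfEdge} {k m : ℕ} (hk : 0 < k) (hm : 0 < m)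
    (hne : h' ≠ (T.next ^ k) h) (hl : h' ≠ Sum.inr false) : T.word K h k * T.word K h' m = 0 :=
  (T.isCyclicSystem K).word_mul_word_eq_zero hk hm hne hl

theorem word_mul_word_of_ne {h h' : T.HalfEdge} {k : ℕ} (m : ℕ)
    (hi : T.edge ((T.next ^ k) h) ≠ T.edge h') : T.word K h k * T.word K h' m = 0 :=
  (T.isCyclicSystem K).word_mul_word_of_ne m hi

theorem e_mul_word (h : T.HalfEdge) (k : ℕ) : T.e K (T.edge h) * T.word K h k = T.word K h k :=
  (T.isCyclicSystem K).e_mul_word h k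

theorem word_mul_e {h h' : T.HalfEdge} {k : ℕ} (hk : (T.next ^ k) h = h') :
    T.word K h k * T.e K (T.edge h') = T.word K h k := by
  rw [← hk]; exact (T.isCyclicSystem K).word_mul_e h k

theorem e_mul_e (z : T.Edge) : T.e K z * T.e K z = T.e K z := (T.isCyclicSystem K).e_mul_self z

theorem turn_ne_zero (h : T.HalfEdge) : T.word K h (T.val h) ≠ 0 := by
  obtain ⟨φ, hφ⟩ := T.exists_socleForm K
  intro h0
  have := (hφ h (T.val h)).1 rfl
  rw [h0, map_zero, turnSign] at this
  split_ifs at this <;> simp at this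

/-- Every word of at most one full turn is nonzero, since it is a beginning of a full turn. -/
theorem word_ne_zero {h : T.HalfEdge} {k : ℕ} (hk : k ≤ T.val h) : T.word K h k ≠ 0 := by
  intro h0
  apply T.turn_ne_zero K h
  rw [show T.val h = k + (T.val h - k) by omega, ← T.word_mul_word K rfl, h0, zero_mul]

/-- The full turns around the two ends of a tree edge agree. -/
theorem turn_symm (d : T.graph.Dart) :
    T.word K (Sum.inl d.symm) (T.val (Sum.inl d.symm)) =
      T.word K (Sum.inl d) (T.val (Sum.inl d)) := by
  have ht := T.toOmega_rel K (Rel.turn (K := K) d)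
  rw [toOmega_arc, toOmega_arc, steps_self, steps_self] at ht
  rw [word, word, (T.isCyclicSystem K).word_pos _ _ (T.val_pos _),
    (T.isCyclicSystem K).word_pos _ _ (T.val_pos _), ht]

/-- The full turns around the exceptional cycle starting with the two halves of the loop are
opposite to each other. -/
theorem turn_loop : T.word K (Sum.inr true) (T.excLength + 1) =
    - T.word K (Sum.inr false) (T.excLength + 1) := by
  have := (T.isCyclicSystem K).word_turn_loop
  rwa [T.next_loop, val_inr] at this

/-- The full turn of a tree edge annihilates all words of positive length. -/
theorem turn_mul_word (d : T.graph.Dart) (h : T.HalfEdge) {m : ℕ} (hm : 0 < m) :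
    T.word K (Sum.inl d) (T.val (Sum.inl d)) * T.word K h m = 0 := by
  by_cases h1 : h = Sum.inl d
  · subst h1
    rw [T.word_mul_word K (T.pow_val _), T.word_eq_zero K (by omega)]
  by_cases h2 : h = Sum.inr false
  · subst h2
    exact T.word_mul_word_of_ne K m (by rw [pow_val]; simp [edge])
  · exact T.word_mul_word_eq_zero K (T.val_pos _) hm (by rwa [pow_val]) h2

/-- The full turn of a tree edge is annihilated by all words of positive length. -/
theorem word_mul_turn (d : T.graph.Dart) (h : T.HalfEdge) {m : ℕ} (hm : 0 < m) :
    T.word K h m * T.word K (Sum.inl d) (T.val (Sum.inl d)) = 0 := by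
  by_cases h1 : (T.next ^ m) h = Sum.inl d
  · have := T.val_pow h m
    rw [T.word_mul_word K h1, T.word_eq_zero K]
    rw [← h1]
    omega
  · exact T.word_mul_word_eq_zero K hm (T.val_pos _) (Ne.symm h1) (by simp)

/-- A span contains the corner `e_z Ω(T) e_z'` if it contains the words from `z` to `z'`. -/
theorem mem_span_corner {z z' : T.Edge} {x : T.Omega K} (hz : T.e K z * x = x)
    (hz' : x * T.e K z' = x) {s : Set (T.Omega K)}
    (hs : ∀ h k, k ≤ T.val h → T.edge h = z → T.edge ((T.next ^ k) h) = z' →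
      T.word K h k ∈ Submodule.span K s) : x ∈ Submodule.span K s := by
  refine Submodule.span_le.2 ?_ ((T.isCyclicSystem K).mem_span_corner hz hz')
  rintro _ ⟨h, k, h1, h2, h3, rfl⟩
  exact hs h k h1 h2 h3

/-- Between two different tree edges with a common vertex there is, up to scalars, only the path
around this vertex. -/
theorem corner_adjacent {d d' : T.graph.Dart} {k : ℕ} (hk : 0 < k) (hk' : k < T.val (Sum.inl d))
    (hd : (T.next ^ k) (Sum.inl d) = Sum.inl d') {x : T.Omega K}
    (hx : T.e K (T.edge (Sum.inl d)) * x = x) (hx' : x * T.e K (T.edge (Sum.inl d')) = x) :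
    ∃ c : K, x = c • T.word K (Sum.inl d) k := by
  have hv : d'.fst = d.fst := by
    have := T.vtx_pow (Sum.inl d) k; rwa [hd] at this
  have hne : d ≠ d' := by
    rintro rfl
    rcases T.eq_zero_or_val hk'.le hd with h | h <;> omega
  suffices h : x ∈ Submodule.span K {T.word K (Sum.inl d) k} by
    obtain ⟨c, hc⟩ := Submodule.mem_span_singleton.1 h
    exact ⟨c, hc.symm⟩
  refine T.mem_span_corner K hx hx' fun h m hm h1 h2 => Submodule.subset_span ?_
  rcases T.edge_eq_edge_inl h1 with rfl | rfl
  · rcases T.edge_eq_edge_inl h2 with h3 | h3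
    · rw [Set.mem_singleton_iff, T.eq_of_pow_eq hk hk' hm (h3.trans hd.symm)]
    · have h4 := T.vtx_pow (Sum.inl d) m
      rw [h3] at h4
      exact absurd (hv.trans h4.symm) d'.fst_ne_snd
  · have h4 := T.vtx_pow (Sum.inl d.symm) m
    rcases T.edge_eq_edge_inl h2 with h3 | h3
    · rw [h3] at h4
      exact absurd (hv.symm.trans h4) d.fst_ne_snd
    · rw [h3] at h4
      exact absurd (SimpleGraph.Dart.ext _ _ (Prod.ext hv.symm h4.symm)) hne

/-- There are no paths between edges without common vertex. -/
theorem corner_disjoint {d d' : T.graph.Dart} (h1 : d.fst ≠ d'.fst) (h2 : d.fst ≠ d'.snd)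
    (h3 : d.snd ≠ d'.fst) (h4 : d.snd ≠ d'.snd) {x : T.Omega K}
    (hx : T.e K (T.edge (Sum.inl d)) * x = x) (hx' : x * T.e K (T.edge (Sum.inl d')) = x) :
    x = 0 := by
  suffices h : x ∈ Submodule.span K (∅ : Set (T.Omega K)) by simpa using h
  refine T.mem_span_corner K hx hx' fun h m hm h5 h6 => ?_
  exfalso
  have h7 := T.vtx_pow h m
  rcases T.edge_eq_edge_inl h5 with rfl | rfl <;> rcases T.edge_eq_edge_inl h6 with h8 | h8 <;>
    rw [h8] at h7
  · exact h1 h7.symm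
  · exact h2 h7.symm
  · exact h3 h7.symm
  · exact h4 h7.symm

/-- The endomorphisms of a tree edge are spanned by the idempotent and the full turn. -/
theorem corner_self {d : T.graph.Dart} {x : T.Omega K}
    (hx : T.e K (T.edge (Sum.inl d)) * x = x) (hx' : x * T.e K (T.edge (Sum.inl d)) = x) :
    ∃ a b : K, x = a • T.e K (T.edge (Sum.inl d)) +
      b • T.word K (Sum.inl d) (T.val (Sum.inl d)) := by
  suffices h : x ∈ Submodule.span K {T.e K (T.edge (Sum.inl d)),
      T.word K (Sum.inl d) (T.val (Sum.inl d))} by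
    obtain ⟨a, b, hc⟩ := Submodule.mem_span_pair.1 h
    exact ⟨a, b, hc.symm⟩
  refine T.mem_span_corner K hx hx' fun h m hm h1 h2 => Submodule.subset_span ?_
  have h4 := T.vtx_pow h m
  rcases T.edge_eq_edge_inl h1 with rfl | rfl
  · rcases T.edge_eq_edge_inl h2 with h3 | h3
    · rcases T.eq_zero_or_val hm h3 with rfl | rfl
      · left; rw [word_zero]
      · right; rfl
    · rw [h3] at h4
      exact absurd h4.symm d.fst_ne_snd
  · rcases T.edge_eq_edge_inl h2 with h3 | h3
    · rw [h3] at h4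
      exact absurd h4 d.fst_ne_snd
    · rcases T.eq_zero_or_val hm h3 with rfl | rfl
      · left; rw [word_zero, ← h1]
      · right; exact T.turn_symm K d

/-- The endomorphisms of the loop are spanned by the idempotent, `α₁`, `β₁⋯βᵣ` and the full turn. -/
theorem corner_loop {x : T.Omega K} (hx : T.e K none * x = x) (hx' : x * T.e K none = x) :
    x ∈ Submodule.span K {T.e K none, T.word K (Sum.inr false) 1,
      T.word K (Sum.inr true) T.excLength,
      T.word K (Sum.inr false) (T.excLength + 1)} := by
  have hr := T.excLength_pos
  refine T.mem_span_corner K hx hx' fun h m hm h1 h2 => ?_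
  rcases T.edge_eq_none h1 with rfl | rfl
  · refine Submodule.subset_span ?_
    rcases T.edge_eq_none h2 with h3 | h3
    · rcases T.eq_zero_or_val hm h3 with rfl | rfl
      · left; rw [word_zero]; rfl
      · right; right; right; rw [val_inr]; rfl
    · have : m = 1 := T.eq_of_pow_eq one_pos (by rw [val_inr]; omega) hm
        (by rw [h3, pow_one, T.next_loop])
      subst this
      right; left; rfl
  · rcases T.edge_eq_none h2 with h3 | h3
    · have : m = T.excLength := T.eq_of_pow_eq hr (by rw [val_inr]; omega) hm
        (by rw [h3, pow_excLength])
      subst this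
      refine Submodule.subset_span ?_
      right; right; left; rfl
    · rcases T.eq_zero_or_val hm h3 with rfl | rfl
      · refine Submodule.subset_span ?_
        left; rw [word_zero]; rfl
      · rw [val_inr, turn_loop]
        refine Submodule.neg_mem _ (Submodule.subset_span ?_)
        right; right; right; rfl

/-- From the loop to a tree edge at `S` there are, up to scalars, two paths: along the exceptional
cycle, and the same path preceded by `α₁`. -/
theorem corner_loop_left {d : T.graph.Dart} {k : ℕ} (hk : 0 < k) (hk' : k < T.excLength)
    (hd : (T.next ^ k) (Sum.inr true) = Sum.inl d) {x : T.Omega K}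
    (hx : T.e K none * x = x) (hx' : x * T.e K (T.edge (Sum.inl d)) = x) :
    x ∈ Submodule.span K {T.word K (Sum.inr true) k, T.word K (Sum.inr false) (k + 1)} := by
  have hv : d.fst = T.S := by
    have := T.vtx_pow (Sum.inr true) k; rwa [hd] at this
  refine T.mem_span_corner K hx hx' fun h m hm h1 h2 => Submodule.subset_span ?_
  have h4 := T.vtx_pow h m
  rcases T.edge_eq_none h1 with rfl | rfl <;> rcases T.edge_eq_edge_inl h2 with h3 | h3
  · right
    rw [Set.mem_singleton_iff, T.eq_of_pow_eq (k := k + 1) (by omega) (by rw [val_inr]; omega) hm]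
    rw [h3, pow_succ, Equiv.Perm.mul_apply, T.next_loop, hd]
  · rw [h3] at h4
    exact absurd (hv.trans h4.symm) d.fst_ne_snd
  · left
    rw [T.eq_of_pow_eq hk (by rw [val_inr]; omega) hm (h3.trans hd.symm)]
  · rw [h3] at h4
    exact absurd (hv.trans h4.symm) d.fst_ne_snd

theorem val_of_pow {h h' : T.HalfEdge} {k : ℕ} (hk : (T.next ^ k) h = h') : T.val h' = T.val h := by
  rw [← hk, val_pow]

/-- From a tree edge at `S` to the loop there are, up to scalars, two paths: along the exceptional
cycle, and the same path followed by `α₁`. -/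
theorem corner_loop_right {d : T.graph.Dart} {k : ℕ} (hk : 0 < k) (hk' : k < T.excLength)
    (hd : (T.next ^ k) (Sum.inr true) = Sum.inl d) {x : T.Omega K}
    (hx : T.e K (T.edge (Sum.inl d)) * x = x) (hx' : x * T.e K none = x) :
    x ∈ Submodule.span K {T.word K (Sum.inl d) (T.excLength - k),
      T.word K (Sum.inl d) (T.excLength - k + 1)} := by
  have hv : d.fst = T.S := by
    have := T.vtx_pow (Sum.inr true) k; rwa [hd] at this
  have hval := T.val_of_pow hd
  rw [val_inr] at hval
  have h0 : (T.next ^ (T.excLength - k)) (Sum.inl d) = Sum.inr false := by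
    rw [← hd, ← Equiv.Perm.mul_apply, ← pow_add, Nat.sub_add_cancel hk'.le, pow_excLength]
  refine T.mem_span_corner K hx hx' fun h m hm h1 h2 => Submodule.subset_span ?_
  have h4 := T.vtx_pow h m
  rcases T.edge_eq_edge_inl h1 with rfl | rfl
  · rcases T.edge_eq_none h2 with h3 | h3
    · left
      rw [T.eq_of_pow_eq (k := T.excLength - k) (by omega) (by omega) hm (h3.trans h0.symm)]
    · right
      rw [Set.mem_singleton_iff,
        T.eq_of_pow_eq (k := T.excLength - k + 1) (by omega) (by omega) hm]
      rw [h3, pow_succ', Equiv.Perm.mul_apply, h0, T.next_loop]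
  · rcases T.edge_eq_none h2 with h3 | h3 <;> rw [h3] at h4 <;>
      exact absurd (hv.trans h4) d.fst_ne_snd

end LoopBrauerGraph

/-! ### Morphisms between the complexes `Q(z)` -/

namespace LoopBrauerGraph

universe u v

variable {V : Type v} [Finite V] (T : LoopBrauerGraph V) (K : Type u) [Field K]

theorem rightMul_comp_rightMul (x y w p q : T.Omega K) :
    T.rightMul K x y p ≫ T.rightMul K y w q = T.rightMul K x w (p * y * q) := by
  ext a
  change (a : T.Omega K) * p * y * q * w = (a : T.Omega K) * (p * y * q) * w
  simp only [mul_assoc]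

theorem rightMul_add (x y p q : T.Omega K) :
    T.rightMul K x y (p + q) = T.rightMul K x y p + T.rightMul K x y q := by
  ext a
  change (a : T.Omega K) * (p + q) * y = (a : T.Omega K) * p * y + (a : T.Omega K) * q * y
  rw [mul_add, add_mul]

theorem rightMul_eq_zero_iff {x y p : T.Omega K} : T.rightMul K x y p = 0 ↔ x * p * y = 0 := by
  constructor
  · intro h
    exact congrArg (fun g : T.P K x ⟶ T.P K y =>
      ((g.hom ⟨x, Ideal.subset_span rfl⟩ : Ideal.span {y}) : T.Omega K)) h
  · intro h
    ext a
    obtain ⟨c, hc⟩ := Ideal.mem_span_singleton'.1 a.2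
    change (a : T.Omega K) * p * y = 0
    rw [← hc, mul_assoc c, mul_assoc, h, mul_zero]

theorem rightMul_smul (x y p : T.Omega K) (c : K) :
    letI := Linear.homModule (R := K) (T.P K x) (T.P K y)
    T.rightMul K x y (c • p) = c • T.rightMul K x y p := by
  ext a
  change (a : T.Omega K) * (c • p) * y = algebraMap K (T.Omega K) c * ((a : T.Omega K) * p * y)
  rw [← Algebra.smul_def, mul_smul_comm, smul_mul_assoc]

theorem rightMul_congr {x y p q : T.Omega K} (h : T.rightMul K x y p = T.rightMul K x y q) :
    x * p * y = x * q * y :=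
  congrArg (fun g : T.P K x ⟶ T.P K y =>
    ((g.hom ⟨x, Ideal.subset_span rfl⟩ : Ideal.span {y}) : T.Omega K)) h

theorem rightMul_self {x : T.Omega K} (hx : x * x = x) : T.rightMul K x x x = 𝟙 _ := by
  ext a
  obtain ⟨c, hc⟩ := Ideal.mem_span_singleton'.1 a.2
  change (a : T.Omega K) * x * x = a
  rw [← hc, mul_assoc, mul_assoc, hx, hx]

/-- Every homomorphism `Ω(T) x → Ω(T) y` between modules generated by idempotents is right
multiplication by an element of `x Ω(T) y`. -/
theorem exists_eq_rightMul {x y : T.Omega K} (hx : x * x = x) (hy : y * y = y)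
    (f : T.P K x ⟶ T.P K y) : ∃ p, x * p * y = p ∧ f = T.rightMul K x y p := by
  let x' : Ideal.span {x} := ⟨x, Ideal.subset_span rfl⟩
  have hmem (b : Ideal.span {y}) : (b : T.Omega K) * y = b := by
    obtain ⟨c, hc⟩ := Ideal.mem_span_singleton'.1 b.2
    rw [← hc, mul_assoc, hy]
  have hmem' (b : Ideal.span {x}) : (b : T.Omega K) * x = b := by
    obtain ⟨c, hc⟩ := Ideal.mem_span_singleton'.1 b.2
    rw [← hc, mul_assoc, hx]
  have hf (a : Ideal.span {x}) :
      ((f.hom a : Ideal.span {y}) : T.Omega K) = a * (f.hom x' : Ideal.span {y}) := by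
    have : a = (a : T.Omega K) • x' := Subtype.ext (hmem' a).symm
    conv_lhs => rw [this, map_smul]
    rfl
  refine ⟨(f.hom x' : Ideal.span {y}), ?_, ?_⟩
  · rw [mul_assoc, hmem]
    exact (hf x').symm
  · ext a
    refine (hf a).trans ?_
    change _ = (a : T.Omega K) * _ * y
    rw [mul_assoc, hmem]

variable (z z' z'' : T.Edge)

theorem idem_mul_idem (j : ℤ) : T.idem K z j * T.idem K z j = T.idem K z j := by
  rw [idem]
  rcases T.routeAt z j with _ | h
  · simp
  · exact T.e_mul_e K _

theorem sameCycle_of_routeAt {j : ℤ} {h h' : T.HalfEdge} (hj : T.routeAt z j = some h)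
    (hj' : T.routeAt z (j + 1) = some h') : T.next.SameCycle (T.opp h) h' := by
  rcases j with j | j
  · obtain ⟨d, d', rfl, rfl, H⟩ := T.route_consecutive z j h h' hj hj'
    exact H
  · simp [routeAt] at hj

theorem idem_mul_diffElt (j : ℤ) : T.idem K z j * T.diffElt K z j = T.diffElt K z j := by
  rw [idem, diffElt]
  rcases h1 : T.routeAt z j with _ | h
  · simp
  rcases h2 : T.routeAt z (j + 1) with _ | h'
  · simp
  obtain ⟨x, hx⟩ := T.arc_eq_first_mul K (T.sameCycle_of_routeAt z h1 h2)
  have h3 := (T.isCyclicSystem K).e_mul_a (T.opp h)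
  rw [edge_opp, letter] at h3
  simp only [Option.map_some, Option.getD_some]
  rw [hx, map_mul, ← mul_assoc, h3]

theorem diffElt_mul_idem (j : ℤ) : T.diffElt K z j * T.idem K z (j + 1) = T.diffElt K z j := by
  rw [idem, diffElt]
  rcases h1 : T.routeAt z j with _ | h
  · simp
  rcases h2 : T.routeAt z (j + 1) with _ | h'
  · simp
  simp only [Option.map_some, Option.getD_some]
  exact T.arc_mul_e K (T.sameCycle_of_routeAt z h1 h2)

/-- The families of elements which describe the chain maps `Q(z) → Q(z')`: right multiplication by
`f j` is the component in degree `j`. -/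
def chainMaps : Submodule K (ℤ → T.Omega K) where
  carrier := {f | ∀ j, T.idem K z j * f j * T.idem K z' j = f j ∧
    f j * T.diffElt K z' j = T.diffElt K z j * f (j + 1)}
  add_mem' {f g} hf hg j := by
    simp only [Pi.add_apply, mul_add, add_mul, (hf j).1, (hg j).1, (hf j).2, (hg j).2, and_self]
  zero_mem' j := by simp
  smul_mem' c f hf j := by
    simp only [Pi.smul_apply, mul_smul_comm, smul_mul_assoc, (hf j).1, (hf j).2, and_self]

variable {T K z z' z''}

theorem chainMaps_idem_mul {f : ℤ → T.Omega K} (hf : f ∈ T.chainMaps K z z') (j : ℤ) :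
    T.idem K z j * f j = f j := by
  rw [← (hf j).1, ← mul_assoc, ← mul_assoc, idem_mul_idem]

theorem chainMaps_mul_idem {f : ℤ → T.Omega K} (hf : f ∈ T.chainMaps K z z') (j : ℤ) :
    f j * T.idem K z' j = f j := by
  rw [← (hf j).1, mul_assoc, idem_mul_idem]

theorem chainMaps_comm {f : ℤ → T.Omega K} (hf : f ∈ T.chainMaps K z z') (j : ℤ) :
    f j * T.diffElt K z' j = T.diffElt K z j * f (j + 1) := (hf j).2

theorem mul_mem_chainMaps {f g : ℤ → T.Omega K} (hf : f ∈ T.chainMaps K z z')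
    (hg : g ∈ T.chainMaps K z' z'') : f * g ∈ T.chainMaps K z z'' := by
  intro j
  rw [Pi.mul_apply, Pi.mul_apply]
  constructor
  · rw [← mul_assoc, chainMaps_idem_mul hf, mul_assoc, chainMaps_mul_idem hg]
  · rw [mul_assoc, chainMaps_comm hg, ← mul_assoc, chainMaps_comm hf, mul_assoc]

theorem idem_mem_chainMaps : T.idem K z ∈ T.chainMaps K z z := by
  intro j
  constructor
  · rw [idem_mul_idem, idem_mul_idem]
  · rw [idem_mul_diffElt, diffElt_mul_idem]

variable (T K z z' z'')

/-- The families which describe null-homotopic maps `Q(z) → Q(z')`. -/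
def IsNull (f : ℤ → T.Omega K) : Prop :=
  ∃ h : ℤ → T.Omega K, (∀ j, T.idem K z j * h j * T.idem K z' (j - 1) = h j) ∧
    ∀ j, f j = T.diffElt K z j * h (j + 1) + h j * T.diffElt K z' (j - 1)

theorem Q_d (j : ℤ) : (T.Q K z).d j (j + 1) =
    T.rightMul K (T.idem K z j) (T.idem K z (j + 1)) (T.diffElt K z j) :=
  CochainComplex.of_d (fun j => T.P K (T.idem K z j)) (fun j => T.rightMul K (T.idem K z j)
    (T.idem K z (j + 1)) (T.diffElt K z j)) j

/-- The chain map described by a family of elements of `Ω(T)`. -/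
noncomputable def chainHom : T.chainMaps K z z' →ₗ[K] (T.Q K z ⟶ T.Q K z') where
  toFun f := CochainComplex.ofHom
    (fun j => T.rightMul K (T.idem K z j) (T.idem K z' j) (f.1 j)) fun j => by
      rw [Q_d, Q_d]
      refine (T.rightMul_comp_rightMul K _ _ _ _ _).trans
        (Eq.trans ?_ (T.rightMul_comp_rightMul K _ _ _ _ _).symm)
      rw [chainMaps_mul_idem f.2, diffElt_mul_idem, chainMaps_comm f.2]
  map_add' f g := by
    ext j : 1
    exact T.rightMul_add K _ _ _ _
  map_smul' c f := by
    ext j : 1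
    exact T.rightMul_smul K _ _ _ _

variable {T K z z' z''}

theorem chainHom_f (f : T.chainMaps K z z') (j : ℤ) : (T.chainHom K z z' f).f j =
    T.rightMul K (T.idem K z j) (T.idem K z' j) (f.1 j) := rfl

theorem chainHom_surjective : Function.Surjective (T.chainHom K z z') := by
  intro g
  choose p hp hg using fun j => T.exists_eq_rightMul K (T.idem_mul_idem K z j)
    (T.idem_mul_idem K z' j) (g.f j)
  refine ⟨⟨p, fun j => ⟨hp j, ?_⟩⟩, ?_⟩
  · have h := g.comm j (j + 1)
    rw [Q_d, Q_d, hg, hg] at h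
    replace h := ((T.rightMul_comp_rightMul K _ _ _ _ _).symm.trans h).trans
      (T.rightMul_comp_rightMul K _ _ _ _ _)
    have h1 := T.rightMul_congr K h
    simp only [← mul_assoc, idem_mul_diffElt, diffElt_mul_idem] at h1
    rw [hp] at h1
    simp only [mul_assoc, diffElt_mul_idem] at h1
    simp only [← mul_assoc] at h1
    have h2 := hp (j + 1)
    have h3 : p (j + 1) * T.idem K z' (j + 1) = p (j + 1) := by
      rw [← h2, mul_assoc, idem_mul_idem]
    rw [h1, mul_assoc, h3]
  · ext j : 1
    exact (hg j).symm

theorem chainHom_comp (f : T.chainMaps K z z') (g : T.chainMaps K z' z'') :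
    T.chainHom K z z' f ≫ T.chainHom K z' z'' g =
      T.chainHom K z z'' ⟨f.1 * g.1, mul_mem_chainMaps f.2 g.2⟩ := by
  ext j : 1
  rw [HomologicalComplex.comp_f, chainHom_f, chainHom_f, chainHom_f]
  refine (T.rightMul_comp_rightMul K _ _ _ _ _).trans ?_
  rw [chainMaps_mul_idem f.2]
  rfl

theorem chainHom_idem : T.chainHom K z z ⟨T.idem K z, idem_mem_chainMaps⟩ = 𝟙 _ := by
  ext j : 1
  exact T.rightMul_self K (T.idem_mul_idem K z j)

theorem Q_d_of_eq {i j : ℤ} (h : i + 1 = j) : (T.Q K z).d i j =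
    T.rightMul K (T.idem K z i) (T.idem K z j) (T.diffElt K z i) := by
  subst h; exact T.Q_d K z i

theorem dNext_add_prevD (H : ∀ i j, (T.Q K z).X i ⟶ (T.Q K z').X j) (h : ℤ → T.Omega K)
    (hH : ∀ i j, j + 1 = i → H i j = T.rightMul K (T.idem K z i) (T.idem K z' j) (h i)) (j : ℤ) :
    dNext j H + prevD j H = T.rightMul K (T.idem K z j) (T.idem K z' j)
      (T.diffElt K z j * h (j + 1) + h j * T.diffElt K z' (j - 1)) := by
  rw [dNext_eq H (i' := j + 1) (by simp), prevD_eq H (j' := j - 1) (by simp),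
    hH (j + 1) j rfl, hH j (j - 1) (by omega), Q_d, Q_d_of_eq (show j - 1 + 1 = j by omega)]
  refine Eq.trans ?_ (T.rightMul_add K _ _ _ _).symm
  refine congrArg₂ (· + ·) ((T.rightMul_comp_rightMul K _ _ _ _ _).trans ?_)
    ((T.rightMul_comp_rightMul K _ _ _ _ _).trans ?_)
  · rw [diffElt_mul_idem]
  · rw [mul_assoc, idem_mul_diffElt]

/-- A chain map is null-homotopic if and only if its family of components is null. -/
theorem homotopy_iff (f : T.chainMaps K z z') :
    Nonempty (Homotopy (T.chainHom K z z' f) 0) ↔ T.IsNull K z z' f.1 := by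
  constructor
  · rintro ⟨H⟩
    choose p hp hH using fun j => T.exists_eq_rightMul K (T.idem_mul_idem K z j)
      (T.idem_mul_idem K z' (j - 1)) (H.hom j (j - 1))
    refine ⟨p, hp, fun j => ?_⟩
    have h := H.comm j
    rw [dNext_add_prevD _ p fun i j hij => by
      obtain rfl : j = i - 1 := by omega
      exact hH i] at h
    have h2 := T.rightMul_congr K (h.trans (add_zero _))
    have h3 := T.diffElt_mul_idem K z' (j - 1)
    have h4 : p (j + 1) * T.idem K z' j = p (j + 1) := by
      have := hp (j + 1)
      rw [add_sub_cancel_right] at this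
      rw [← this, mul_assoc, idem_mul_idem]
    have h5 : T.idem K z j * p j = p j := by
      rw [← hp j, ← mul_assoc, ← mul_assoc, idem_mul_idem]
    rw [sub_add_cancel] at h3
    rw [(f.2 j).1, mul_add, add_mul, ← mul_assoc, idem_mul_diffElt, mul_assoc, h4, mul_assoc,
      mul_assoc, h3, ← mul_assoc, h5] at h2
    exact h2
  · rintro ⟨h, h1, h2⟩
    refine ⟨⟨fun i j => if j + 1 = i then T.rightMul K (T.idem K z i) (T.idem K z' j) (h i) else 0,
      fun i j hij => if_neg hij, fun j => ?_⟩⟩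
    rw [dNext_add_prevD _ h fun i j hij => if_pos hij]
    refine Eq.trans ?_ (add_zero _).symm
    rw [← h2]
    rfl

variable (T K z z') in
/-- The morphism in the homotopy category described by a family of elements of `Ω(T)`. -/
noncomputable def toHom :
    T.chainMaps K z z' →ₗ[K] (T.toHomotopy K (T.Q K z) ⟶ T.toHomotopy K (T.Q K z')) :=
  ((HomotopyCategory.quotient _ _).mapLinearMap K).comp (T.chainHom K z z')

theorem toHom_surjective : Function.Surjective (T.toHom K z z') := by
  intro f
  obtain ⟨g, rfl⟩ := (HomotopyCategory.quotient _ _).map_surjective f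
  obtain ⟨h, rfl⟩ := chainHom_surjective g
  exact ⟨h, rfl⟩

theorem toHom_eq_zero_iff (f : T.chainMaps K z z') :
    T.toHom K z z' f = 0 ↔ T.IsNull K z z' f.1 := by
  rw [← homotopy_iff]
  exact HomotopyCategory.quotient_map_eq_zero_iff _

theorem toHom_comp (f : T.chainMaps K z z') (g : T.chainMaps K z' z'') :
    T.toHom K z z' f ≫ T.toHom K z' z'' g =
      T.toHom K z z'' ⟨f.1 * g.1, mul_mem_chainMaps f.2 g.2⟩ := by
  change (HomotopyCategory.quotient _ _).map _ ≫ (HomotopyCategory.quotient _ _).map _ = _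
  rw [← Functor.map_comp, chainHom_comp]
  rfl

theorem toHom_idem : T.toHom K z z ⟨T.idem K z, idem_mem_chainMaps⟩ = 𝟙 _ := by
  change (HomotopyCategory.quotient _ _).map _ = _
  rw [chainHom_idem, CategoryTheory.Functor.map_id]

end LoopBrauerGraph

/-! ### Routes in the tree -/

/-- If two paths in a forest with the same start meet, then they meet after the same number of steps
and agree until there. -/
theorem SimpleGraph.IsAcyclic.getVert_eq_of_isPath {V : Type*} {G : SimpleGraph V}
    (hG : G.IsAcyclic) {u v w : V} {p : G.Walk u v} {q : G.Walk u w} (hp : p.IsPath)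
    (hq : q.IsPath) {i j : ℕ} (hi : i ≤ p.length) (hj : j ≤ q.length)
    (h : p.getVert i = q.getVert j) : i = j ∧ ∀ l ≤ i, p.getVert l = q.getVert l := by
  have h1 : p.take i = (q.take j).copy rfl h.symm :=
    congrArg Subtype.val ((hG.subsingleton_path _ _).elim ⟨p.take i, hp.take i⟩
      ⟨(q.take j).copy rfl h.symm, by simpa using hq.take j⟩)
  have h2 := congrArg SimpleGraph.Walk.length h1
  rw [SimpleGraph.Walk.length_copy, SimpleGraph.Walk.take_length, SimpleGraph.Walk.take_length,
    min_eq_left hi, min_eq_left hj] at h2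
  subst h2
  refine ⟨rfl, fun l hl => ?_⟩
  have h3 := congrArg (fun w => w.getVert l) h1
  simpa [SimpleGraph.Walk.take_getVert, hl] using h3

namespace LoopBrauerGraph

universe u v

variable {V : Type v} [Finite V] (T : LoopBrauerGraph V)

/-- The `j`-th edge on the route to `z` is a tree edge, with half-edge `d` at the end closer to
`S`. -/
def OnRoute (z : T.Edge) (j : ℕ) (d : T.graph.Dart) : Prop :=
  T.routeAt z (j : ℤ) = some (Sum.inl d)

/-- The path in the tree from `S` through the edge `z`. -/
theorem exists_routeWalk (z : T.graph.edgeSet) : ∃ (v : V) (p : T.graph.Walk T.S v), p.IsPath ∧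
    p.edges.getLast? = some (z : Sym2 V) ∧ T.route (some z) = p.darts.map Sum.inl :=
  ⟨_, (T.exists_path z).choose_spec.choose, (T.exists_path z).choose_spec.choose_spec.1,
    (T.exists_path z).choose_spec.choose_spec.2, rfl⟩

variable {T}

theorem routeAt_natCast (z : T.Edge) (j : ℕ) : T.routeAt z (j : ℤ) = (T.route z)[j]? := rfl

theorem routeAt_none_succ (j : ℕ) : T.routeAt none ((j + 1 : ℕ) : ℤ) = none := by
  rw [routeAt_natCast]; simp [route]

theorem onRoute_iff_getVert {z : T.graph.edgeSet} {v : V} {p : T.graph.Walk T.S v}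
    (hp : T.route (some z) = p.darts.map Sum.inl) {j : ℕ} {d : T.graph.Dart} :
    T.OnRoute (some z) j d ↔
      j < p.length ∧ d.fst = p.getVert j ∧ d.snd = p.getVert (j + 1) := by
  rw [OnRoute, routeAt_natCast, hp, List.getElem?_map, Option.map_eq_some_iff]
  constructor
  · rintro ⟨d', h1, h2⟩
    obtain rfl := Sum.inl.inj h2
    obtain ⟨h3, rfl⟩ := List.getElem?_eq_some_iff.1 h1
    rw [SimpleGraph.Walk.darts_getElem_eq_getVert]
    exact ⟨by simpa using h3, rfl, rfl⟩
  · rintro ⟨h1, h2, h3⟩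
    have h4 : j < p.darts.length := by simpa using h1
    refine ⟨d, ?_, rfl⟩
    rw [List.getElem?_eq_getElem h4, SimpleGraph.Walk.darts_getElem_eq_getVert]
    exact congrArg some (SimpleGraph.Dart.ext _ _ (Prod.ext h2.symm h3.symm))

theorem not_onRoute_none {j : ℕ} {d : T.graph.Dart} : ¬ T.OnRoute none j d := by
  rw [OnRoute, routeAt_natCast]
  rcases j with _ | j <;> simp [route]

theorem routeAt_some {z : T.graph.edgeSet} {j : ℕ} {h : T.HalfEdge}
    (hj : T.routeAt (some z) (j : ℤ) = some h) : ∃ d, h = Sum.inl d ∧ T.OnRoute (some z) j d := by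
  obtain ⟨v, p, -, -, hp⟩ := T.exists_routeWalk z
  have h1 := hj
  rw [routeAt_natCast, hp, List.getElem?_map, Option.map_eq_some_iff] at h1
  obtain ⟨d, -, rfl⟩ := h1
  exact ⟨d, rfl, hj⟩

theorem exists_onRoute_zero (z : T.graph.edgeSet) : ∃ d, T.OnRoute (some z) 0 d ∧ d.fst = T.S := by
  obtain ⟨v, p, -, h, hp⟩ := T.exists_routeWalk z
  have hl : 0 < p.length := by
    rw [← SimpleGraph.Walk.length_edges, List.length_pos_iff]
    rintro h0
    simp [h0] at h
  refine ⟨⟨(p.getVert 0, p.getVert 1), p.adj_getVert_succ hl⟩, ?_, by simp⟩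
  rw [onRoute_iff_getVert hp]
  exact ⟨hl, rfl, rfl⟩

theorem OnRoute.fst_eq_S {z : T.Edge} {d : T.graph.Dart} (h : T.OnRoute z 0 d) : d.fst = T.S := by
  rcases z with _ | z
  · exact absurd h not_onRoute_none
  · obtain ⟨d', h', h2⟩ := exists_onRoute_zero z
    obtain rfl : d = d' := by simpa using h.symm.trans h'
    exact h2

theorem OnRoute.ne_none {z : T.Edge} {j : ℕ} {d : T.graph.Dart} (h : T.OnRoute z j d) :
    z ≠ none := by
  rintro rfl; exact not_onRoute_none h

/-- Consecutive edges of a route meet at the end of the first one farther from `S`. -/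
theorem OnRoute.pred {z : T.Edge} {j : ℕ} {d : T.graph.Dart} (h : T.OnRoute z (j + 1) d) :
    ∃ d', T.OnRoute z j d' ∧ d.fst = d'.snd ∧ d ≠ d'.symm := by
  rcases z with _ | z
  · exact absurd h not_onRoute_none
  obtain ⟨v, p, h1, -, hp⟩ := T.exists_routeWalk z
  obtain ⟨h2, h3, h4⟩ := (onRoute_iff_getVert hp).1 h
  refine ⟨⟨(p.getVert j, p.getVert (j + 1)), p.adj_getVert_succ (by omega)⟩, ?_, h3, ?_⟩
  · rw [onRoute_iff_getVert hp]; exact ⟨by omega, rfl, rfl⟩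
  · rintro rfl
    have h5 : p.getVert j = p.getVert (j + 2) := h4
    have := h1.getVert_injOn (by simp; omega) (by simp; omega) h5
    omega

theorem OnRoute.unique {z : T.Edge} {j : ℕ} {d d' : T.graph.Dart} (h : T.OnRoute z j d)
    (h' : T.OnRoute z j d') : d = d' := by simpa using h.symm.trans h'

theorem OnRoute.of_le {z : T.Edge} {i j : ℕ} {d : T.graph.Dart} (h : T.OnRoute z j d)
    (hij : i ≤ j) : ∃ d', T.OnRoute z i d' := by
  induction j generalizing d with
  | zero => obtain rfl : i = 0 := by omega
            exact ⟨d, h⟩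
  | succ j ih =>
    rcases Nat.lt_or_ge i (j + 1) with h1 | h1
    · obtain ⟨d', h', -⟩ := h.pred
      exact ih h' (by omega)
    · obtain rfl : i = j + 1 := by omega
      exact ⟨d, h⟩

theorem OnRoute.routeAt_eq_of_getVert {z z' : T.graph.edgeSet} {v v' : V} {p : T.graph.Walk T.S v}
    {p' : T.graph.Walk T.S v'} (hp : T.route (some z) = p.darts.map Sum.inl)
    (hp' : T.route (some z') = p'.darts.map Sum.inl) {l : ℕ} (hl : l < p.length)
    (hl' : l < p'.length) (h : p.getVert l = p'.getVert l)
    (h' : p.getVert (l + 1) = p'.getVert (l + 1)) :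
    T.routeAt (some z) (l : ℤ) = T.routeAt (some z') (l : ℤ) := by
  have h1 : T.OnRoute (some z) l ⟨(p.getVert l, p.getVert (l + 1)), p.adj_getVert_succ hl⟩ := by
    rw [onRoute_iff_getVert hp]; exact ⟨hl, rfl, rfl⟩
  have h2 : T.OnRoute (some z') l ⟨(p.getVert l, p.getVert (l + 1)), p.adj_getVert_succ hl⟩ := by
    rw [onRoute_iff_getVert hp']; exact ⟨hl', h, h'⟩
  exact Eq.trans h1 (Eq.symm h2)

/-- Routes which reach the same vertex agree until there. -/
theorem OnRoute.eq_of_fst {z z' : T.Edge} {i i' : ℕ} {d d' : T.graph.Dart} (h : T.OnRoute z i d)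
    (h' : T.OnRoute z' i' d') (hd : d.fst = d'.fst) :
    i = i' ∧ ∀ l : ℕ, l < i → T.routeAt z l = T.routeAt z' l := by
  obtain ⟨z, rfl⟩ := Option.ne_none_iff_exists'.1 h.ne_none
  obtain ⟨z', rfl⟩ := Option.ne_none_iff_exists'.1 h'.ne_none
  obtain ⟨v, p, h1, -, hp⟩ := T.exists_routeWalk z
  obtain ⟨v', p', h1', -, hp'⟩ := T.exists_routeWalk z'
  obtain ⟨h2, h3, h4⟩ := (onRoute_iff_getVert hp).1 h
  obtain ⟨h2', h3', h4'⟩ := (onRoute_iff_getVert hp').1 h'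
  obtain ⟨rfl, h5⟩ := T.isTree.isAcyclic.getVert_eq_of_isPath h1 h1' h2.le h2'.le
    (h3.symm.trans (hd.trans h3'))
  exact ⟨rfl, fun l hl => OnRoute.routeAt_eq_of_getVert hp hp' (by omega) (by omega)
    (h5 l (by omega)) (h5 (l + 1) (by omega))⟩

/-- In the tree, an edge is determined by its end farther from `S`. -/
theorem OnRoute.eq_of_snd {z z' : T.Edge} {i i' : ℕ} {d d' : T.graph.Dart} (h : T.OnRoute z i d)
    (h' : T.OnRoute z' i' d') (hd : d.snd = d'.snd) : i = i' ∧ d = d' := by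
  obtain ⟨z, rfl⟩ := Option.ne_none_iff_exists'.1 h.ne_none
  obtain ⟨z', rfl⟩ := Option.ne_none_iff_exists'.1 h'.ne_none
  obtain ⟨v, p, h1, -, hp⟩ := T.exists_routeWalk z
  obtain ⟨v', p', h1', -, hp'⟩ := T.exists_routeWalk z'
  obtain ⟨h2, h3, h4⟩ := (onRoute_iff_getVert hp).1 h
  obtain ⟨h2', h3', h4'⟩ := (onRoute_iff_getVert hp').1 h'
  obtain ⟨h5, h6⟩ := T.isTree.isAcyclic.getVert_eq_of_isPath h1 h1' (Nat.succ_le_of_lt h2)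
    (Nat.succ_le_of_lt h2') (h4.symm.trans (hd.trans h4'))
  obtain rfl : i = i' := by omega
  exact ⟨rfl, SimpleGraph.Dart.ext _ _
    (Prod.ext (h3.trans ((h6 i (by omega)).trans h3'.symm)) hd)⟩

theorem OnRoute.eq_succ_of_fst_snd {z z' : T.Edge} {i i' : ℕ} {d d' : T.graph.Dart}
    (h : T.OnRoute z i d) (h' : T.OnRoute z' i' d') (hd : d.fst = d'.snd) : i = i' + 1 := by
  obtain ⟨z, rfl⟩ := Option.ne_none_iff_exists'.1 h.ne_none
  obtain ⟨z', rfl⟩ := Option.ne_none_iff_exists'.1 h'.ne_none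
  obtain ⟨v, p, h1, -, hp⟩ := T.exists_routeWalk z
  obtain ⟨v', p', h1', -, hp'⟩ := T.exists_routeWalk z'
  obtain ⟨h2, h3, h4⟩ := (onRoute_iff_getVert hp).1 h
  obtain ⟨h2', h3', h4'⟩ := (onRoute_iff_getVert hp').1 h'
  exact (T.isTree.isAcyclic.getVert_eq_of_isPath h1 h1' h2.le
    (Nat.succ_le_of_lt h2') (h3.symm.trans (hd.trans h4'))).1

/-- The routes to two different tree edges differ somewhere. -/
theorem exists_first_difference {z z' : T.Edge} (hz : z ≠ none) (hz' : z' ≠ none) (h : z ≠ z') :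
    ∃ k : ℕ, T.routeAt z k ≠ T.routeAt z' k ∧ ∀ l : ℕ, l < k → T.routeAt z l = T.routeAt z' l := by
  classical
  have hex : ∃ k : ℕ, T.routeAt z k ≠ T.routeAt z' k := by
    by_contra! hall
    obtain ⟨z, rfl⟩ := Option.ne_none_iff_exists'.1 hz
    obtain ⟨z', rfl⟩ := Option.ne_none_iff_exists'.1 hz'
    obtain ⟨v, p, -, h1, hp⟩ := T.exists_routeWalk z
    obtain ⟨v', p', -, h1', hp'⟩ := T.exists_routeWalk z'
    have hr : T.route (some z) = T.route (some z') := List.ext_getElem? hall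
    rw [hp, hp'] at hr
    have hd : p.darts = p'.darts := List.map_injective_iff.2 Sum.inl_injective hr
    rw [SimpleGraph.Walk.edges, hd] at h1
    rw [SimpleGraph.Walk.edges, h1] at h1'
    exact h (congrArg some (Subtype.ext (Option.some.inj h1')))
  exact ⟨Nat.find hex, Nat.find_spec hex, fun l hl => not_not.1 (Nat.find_min hex hl)⟩

end LoopBrauerGraph

/-! ### The differentials as words -/

namespace LoopBrauerGraph

universe u v

variable {V : Type v} [Finite V] {T : LoopBrauerGraph V} {K : Type u} [Field K] {z z' : T.Edge}

theorem OnRoute.idem {j : ℕ} {d : T.graph.Dart} (h : T.OnRoute z j d) :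
    T.idem K z j = T.e K (T.edge (Sum.inl d)) := by
  rw [LoopBrauerGraph.idem, h]; rfl

theorem idem_eq_zero {j : ℤ} (h : T.routeAt z j = none) : T.idem K z j = 0 := by
  rw [LoopBrauerGraph.idem, h]; rfl

theorem idem_none_zero : T.idem K none 0 = T.e K none := rfl

theorem diffElt_eq_zero_right {j : ℤ} (h : T.routeAt z (j + 1) = none) :
    T.diffElt K z j = 0 := by
  rw [← diffElt_mul_idem, idem_eq_zero h, mul_zero]

theorem diffElt_eq_zero_left {j : ℤ} (h : T.routeAt z j = none) : T.diffElt K z j = 0 := by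
  rw [← idem_mul_diffElt, idem_eq_zero h, zero_mul]

theorem diffElt_neg {j : ℤ} (h : j < 0) : T.diffElt K z j = 0 := by
  obtain ⟨n, rfl⟩ := Int.eq_negSucc_of_lt_zero h
  exact diffElt_eq_zero_left rfl

theorem diffElt_none (j : ℤ) : T.diffElt K none j = 0 := by
  rcases lt_or_ge j 0 with h | h
  · exact diffElt_neg h
  · lift j to ℕ using h
    exact diffElt_eq_zero_right (routeAt_none_succ j)

theorem idem_neg {j : ℤ} (h : j < 0) : T.idem K z j = 0 := by
  obtain ⟨n, rfl⟩ := Int.eq_negSucc_of_lt_zero h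
  exact idem_eq_zero rfl

theorem onRoute_of_ne_none {j : ℕ} (hz : z ≠ none) (h : T.routeAt z (j : ℤ) ≠ none) :
    ∃ d, T.OnRoute z j d := by
  obtain ⟨z, rfl⟩ := Option.ne_none_iff_exists'.1 hz
  obtain ⟨x, hx⟩ := Option.ne_none_iff_exists'.1 h
  obtain ⟨d, -, hd⟩ := routeAt_some hx
  exact ⟨d, hd⟩

theorem exists_onRoute (hz : z ≠ none) : ∃ d, T.OnRoute z 0 d := by
  obtain ⟨z, rfl⟩ := Option.ne_none_iff_exists'.1 hz
  obtain ⟨d, hd, -⟩ := exists_onRoute_zero z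
  exact ⟨d, hd⟩

/-- The position of the next edge of a route in the cyclic ordering at the common vertex. -/
theorem OnRoute.exists_pow {j : ℕ} {d d' : T.graph.Dart} (h : T.OnRoute z j d)
    (h' : T.OnRoute z (j + 1) d') :
    ∃ k, 0 < k ∧ k < T.val (Sum.inl d.symm) ∧ (T.next ^ k) (Sum.inl d.symm) = Sum.inl d' := by
  obtain ⟨c, hc, h1, h2⟩ := h'.pred
  obtain rfl := hc.unique h
  exact T.exists_pow_of_vtx (h := Sum.inl c.symm) (h' := Sum.inl d') h1.symm
    (fun h => h2 (Sum.inl.inj h).symm)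

theorem OnRoute.diffElt {j : ℕ} {d d' : T.graph.Dart} (h : T.OnRoute z j d)
    (h' : T.OnRoute z (j + 1) d') {k : ℕ} (hk : 0 < k) (hk' : k < T.val (Sum.inl d.symm))
    (hd : (T.next ^ k) (Sum.inl d.symm) = Sum.inl d') :
    T.diffElt K z j = T.word K (Sum.inl d.symm) k := by
  rw [OnRoute, Nat.cast_succ] at h'
  rw [LoopBrauerGraph.diffElt, h, h']
  change T.toOmega K (T.arc K (Sum.inl d.symm) (Sum.inl d')) = _
  rw [toOmega_arc, ← hd, T.steps_eq hk hk'.le, word, (T.isCyclicSystem K).word_pos _ _ hk]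

variable (K) in
/-- The differential out of a tree edge starts with the half of this edge farther from `S`. -/
theorem diffElt_eq_zero_or {j : ℕ} {d : T.graph.Dart} (h : T.OnRoute z j d) :
    T.diffElt K z j = 0 ∨
      ∃ k, 0 < k ∧ T.diffElt K z j = T.word K (Sum.inl d.symm) k := by
  by_cases h1 : T.routeAt z ((j + 1 : ℕ) : ℤ) = none
  · exact Or.inl (diffElt_eq_zero_right h1)
  · obtain ⟨d', hd'⟩ := onRoute_of_ne_none h.ne_none h1
    obtain ⟨k, h2, h3, h4⟩ := h.exists_pow hd'
    exact Or.inr ⟨k, h2, h.diffElt hd' h2 h3 h4⟩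

/-- A word which ends with the arrow before an edge of the route is annihilated by the
differential. -/
theorem word_mul_diffElt {j : ℕ} {d : T.graph.Dart} (h : T.OnRoute z j d) {g : T.HalfEdge} {k : ℕ}
    (hk : 0 < k) (hg : (T.next ^ k) g = Sum.inl d) : T.word K g k * T.diffElt K z j = 0 := by
  rcases diffElt_eq_zero_or K h with h1 | ⟨m, hm, h1⟩
  · rw [h1, mul_zero]
  · rw [h1, T.word_mul_word_eq_zero K hk hm _ (by simp)]
    rw [hg]
    simpa using d.symm_ne

theorem diffElt_mul_diffElt (j : ℤ) : T.diffElt K z j * T.diffElt K z (j + 1) = 0 := by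
  rcases lt_or_ge j 0 with h | h
  · rw [diffElt_neg h, zero_mul]
  lift j to ℕ using h
  by_cases hz : z = none
  · rw [hz, diffElt_none, zero_mul]
  by_cases h1 : T.routeAt z ((j + 1 : ℕ) : ℤ) = none
  · rw [diffElt_eq_zero_right h1, zero_mul]
  obtain ⟨d', hd'⟩ := onRoute_of_ne_none hz h1
  obtain ⟨d, hd, -⟩ := hd'.pred
  obtain ⟨k, h2, h3, h4⟩ := hd.exists_pow hd'
  rw [hd.diffElt hd' h2 h3 h4]
  exact word_mul_diffElt hd' h2 h4

variable (K) in
/-- The full turn of a tree edge, which spans the socle of its projective module. -/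
noncomputable abbrev turn (d : T.graph.Dart) : T.Omega K :=
  T.word K (Sum.inl d) (T.val (Sum.inl d))

theorem turn_mul_diffElt (d : T.graph.Dart) {j : ℕ} {d' : T.graph.Dart} (h : T.OnRoute z j d') :
    turn K d * T.diffElt K z j = 0 := by
  rcases diffElt_eq_zero_or K h with h1 | ⟨m, hm, h1⟩
  · rw [h1, mul_zero]
  · rw [h1, T.turn_mul_word K d _ hm]

theorem diffElt_mul_turn (d : T.graph.Dart) {j : ℕ} {d' : T.graph.Dart} (h : T.OnRoute z j d') :
    T.diffElt K z j * turn K d = 0 := by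
  rcases diffElt_eq_zero_or K h with h1 | ⟨m, hm, h1⟩
  · rw [h1, zero_mul]
  · rw [h1, T.word_mul_turn K d _ hm]

theorem e_mul_turn (d : T.graph.Dart) : T.e K (T.edge (Sum.inl d)) * turn K d = turn K d :=
  T.e_mul_word K _ _

theorem turn_mul_e (d : T.graph.Dart) : turn K d * T.e K (T.edge (Sum.inl d)) = turn K d :=
  T.word_mul_e K (T.pow_val _)

theorem edge_symm (d : T.graph.Dart) : T.edge (Sum.inl d.symm) = T.edge (Sum.inl d) :=
  T.edge_opp (Sum.inl d)

section Branch

variable {k : ℕ} {c d d' : T.graph.Dart} {i i' : ℕ}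

/-- Walking from `σ^i c` further to `σ^i' c`. -/
theorem pow_sub_of_le {g : T.HalfEdge} {h h' : T.HalfEdge} (hd : (T.next ^ i) g = h)
    (hd' : (T.next ^ i') g = h') (hi : i ≤ i') : (T.next ^ (i' - i)) h = h' := by
  rw [← hd, ← Equiv.Perm.mul_apply, ← pow_add, Nat.sub_add_cancel hi, hd']

/-- Walking from `σ^i c` once past `c` to `σ^i' c`. -/
theorem pow_wrap {g : T.HalfEdge} {h h' : T.HalfEdge} (hd : (T.next ^ i) g = h)
    (hd' : (T.next ^ i') g = h') (hi : i ≤ T.val g) :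
    (T.next ^ (T.val g - i + i')) h = h' := by
  rw [← hd, ← Equiv.Perm.mul_apply, ← pow_add, show T.val g - i + i' + i = i' + T.val g by omega,
    pow_add, Equiv.Perm.mul_apply, pow_val, hd']

/-- Exactness at the places where two routes still agree or have just separated: what is
annihilated by the differential of the first route factors through that of the second. -/
theorem exists_factor (hc : T.OnRoute z k c) (hc' : T.OnRoute z' k c)
    (hd : T.OnRoute z (k + 1) d) (hd' : T.OnRoute z' (k + 1) d') {x : T.Omega K}
    (hx : T.e K (T.edge (Sum.inl d)) * x = x) (hx' : x * T.e K (T.edge (Sum.inl d')) = x)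
    (h0 : T.diffElt K z k * x = 0) :
    ∃ y, T.e K (T.edge (Sum.inl d)) * y = y ∧ y * T.e K (T.edge (Sum.inl c)) = y ∧
      x = y * T.diffElt K z' k := by
  obtain ⟨i, hi, hi', hdi⟩ := hc.exists_pow hd
  obtain ⟨m, hm, hm', hdm⟩ := hc'.exists_pow hd'
  rw [hc.diffElt hd hi hi' hdi] at h0
  rw [hc'.diffElt hd' hm hm' hdm]
  have hval := T.val_of_pow hdi
  have hback : (T.next ^ (T.val (Sum.inl c.symm) - i)) (Sum.inl d) = Sum.inl c.symm :=
    pow_wrap (i' := 0) hdi rfl hi'.le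
  have hy : T.word K (Sum.inl d) (T.val (Sum.inl c.symm) - i) * T.e K (T.edge (Sum.inl c)) =
      T.word K (Sum.inl d) (T.val (Sum.inl c.symm) - i) := by
    rw [← edge_symm c]; exact T.word_mul_e K hback
  suffices h : ∃ b : K, x = b • (T.word K (Sum.inl d) (T.val (Sum.inl c.symm) - i) *
      T.word K (Sum.inl c.symm) m) by
    obtain ⟨b, hb⟩ := h
    refine ⟨b • T.word K (Sum.inl d) (T.val (Sum.inl c.symm) - i), ?_, ?_, ?_⟩
    · rw [mul_smul_comm, T.e_mul_word]
    · rw [smul_mul_assoc, hy]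
    · rw [hb, smul_mul_assoc]
  rw [T.word_mul_word K hback]
  -- Counted from `c`, if the second route continues with a later edge, then `x` is a multiple of a
  -- word which prolongs the differential without completing a turn, hence `x = 0`; if it continues
  -- with the same edge, then `x` is a multiple of the full turn; if with an earlier one, then `x`
  -- runs past `c`.
  rcases lt_trichotomy i m with h1 | h1 | h1
  · obtain ⟨b, rfl⟩ := T.corner_adjacent K (k := m - i) (by omega) (by omega)
      (pow_sub_of_le hdi hdm h1.le) hx hx'
    rw [mul_smul_comm, T.word_mul_word K hdi, Nat.add_sub_cancel' h1.le] at h0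
    rw [(smul_eq_zero.1 h0).resolve_right (T.word_ne_zero K hm'.le)]
    exact ⟨0, by simp⟩
  · subst h1
    obtain rfl : d = d' := Sum.inl.inj (hdi.symm.trans hdm)
    obtain ⟨a, b, rfl⟩ := T.corner_self K hx hx'
    rw [mul_add, mul_smul_comm, mul_smul_comm, T.word_mul_e K hdi, T.word_mul_turn K d _ hi,
      smul_zero, add_zero] at h0
    rw [(smul_eq_zero.1 h0).resolve_right (T.word_ne_zero K hm'.le)]
    refine ⟨b, ?_⟩
    rw [zero_smul, zero_add, Nat.sub_add_cancel hi'.le, hval]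
  · exact T.corner_adjacent K (by omega) (by omega) (pow_wrap hdi hdm hi'.le) hx hx'

end Branch

end LoopBrauerGraph

/-! ### Null-homotopic maps -/

namespace LoopBrauerGraph

universe u v

variable {V : Type v} [Finite V] {T : LoopBrauerGraph V} {K : Type u} [Field K]
  {z z' z'' : T.Edge}

variable (T K z z') in
/-- The families of components of null-homotopic chain maps. -/
def nullMaps : Submodule K (ℤ → T.Omega K) where
  carrier := {f | T.IsNull K z z' f}
  add_mem' := by
    rintro f g ⟨h, h1, h2⟩ ⟨h', h1', h2'⟩
    refine ⟨h + h', fun j => ?_, fun j => ?_⟩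
    · rw [Pi.add_apply, mul_add, add_mul, h1, h1']
    · rw [Pi.add_apply, h2, h2', Pi.add_apply, Pi.add_apply, mul_add, add_mul]
      abel
  zero_mem' := ⟨0, fun j => by simp, fun j => by simp⟩
  smul_mem' := by
    rintro c f ⟨h, h1, h2⟩
    refine ⟨c • h, fun j => ?_, fun j => ?_⟩
    · rw [Pi.smul_apply, mul_smul_comm, smul_mul_assoc, h1]
    · rw [Pi.smul_apply, h2, Pi.smul_apply, Pi.smul_apply, mul_smul_comm, smul_mul_assoc, smul_add]

theorem nullMaps_le_chainMaps : T.nullMaps K z z' ≤ T.chainMaps K z z' := by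
  rintro f ⟨h, h1, h2⟩ j
  have h3 (j : ℤ) : T.idem K z j * h j = h j := by
    rw [← h1, ← mul_assoc, ← mul_assoc, idem_mul_idem]
  have h4 : h (j + 1) * T.idem K z' j = h (j + 1) := by
    have := h1 (j + 1)
    rw [add_sub_cancel_right] at this
    rw [← this, mul_assoc, idem_mul_idem]
  have h5 := T.diffElt_mul_idem K z' (j - 1)
  have h6 := T.diffElt_mul_diffElt (K := K) (z := z') (j - 1)
  rw [sub_add_cancel] at h5 h6
  constructor
  · rw [h2, mul_add, add_mul, ← mul_assoc, idem_mul_diffElt, mul_assoc, h4, ← mul_assoc, h3,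
      mul_assoc, h5]
  · rw [h2, h2, add_mul, mul_add, mul_assoc (h j), h6, ← mul_assoc (T.diffElt K z j),
      diffElt_mul_diffElt, add_sub_cancel_right]
    simp [mul_assoc]

theorem mul_null {f g : ℤ → T.Omega K} (hf : f ∈ T.chainMaps K z z')
    (hg : g ∈ T.nullMaps K z' z'') : f * g ∈ T.nullMaps K z z'' := by
  have h := (toHom_eq_zero_iff ⟨g, nullMaps_le_chainMaps hg⟩).2 hg
  have h2 := toHom_comp ⟨f, hf⟩ ⟨g, nullMaps_le_chainMaps hg⟩
  rw [h, comp_zero] at h2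
  exact (toHom_eq_zero_iff _).1 h2.symm

theorem null_mul {f g : ℤ → T.Omega K} (hf : f ∈ T.nullMaps K z z')
    (hg : g ∈ T.chainMaps K z' z'') : f * g ∈ T.nullMaps K z z'' := by
  have h := (toHom_eq_zero_iff ⟨f, nullMaps_le_chainMaps hf⟩).2 hf
  have h2 := toHom_comp ⟨f, nullMaps_le_chainMaps hf⟩ ⟨g, hg⟩
  rw [h, zero_comp] at h2
  exact (toHom_eq_zero_iff _).1 h2.symm

/-- The boundary of a homotopy which is concentrated in one degree. -/
theorem single_mem_nullMaps (k : ℤ) {y : T.Omega K}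
    (hy : T.idem K z (k + 1) * y * T.idem K z' k = y) :
    (Pi.single k (T.diffElt K z k * y) + Pi.single (k + 1) (y * T.diffElt K z' k) :
      ℤ → T.Omega K) ∈ T.nullMaps K z z' := by
  refine ⟨Pi.single (k + 1) y, fun j => ?_, fun j => ?_⟩
  · by_cases h : j = k + 1
    · subst h
      rw [Pi.single_eq_same, add_sub_cancel_right, hy]
    · rw [Pi.single_eq_of_ne h]; simp
  · rw [Pi.add_apply]
    congr 1
    · by_cases h : j = k
      · subst h
        rw [Pi.single_eq_same, Pi.single_eq_same]
      · rw [Pi.single_eq_of_ne h, Pi.single_eq_of_ne (by omega), mul_zero]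
    · by_cases h : j = k + 1
      · subst h
        rw [Pi.single_eq_same, Pi.single_eq_same, add_sub_cancel_right]
      · rw [Pi.single_eq_of_ne h, Pi.single_eq_of_ne h, zero_mul]

theorem chainMaps_eq_zero_left {f : ℤ → T.Omega K} (hf : f ∈ T.chainMaps K z z') {j : ℤ}
    (h : T.routeAt z j = none) : f j = 0 := by
  rw [← chainMaps_idem_mul hf, idem_eq_zero h, zero_mul]

theorem chainMaps_eq_zero_right {f : ℤ → T.Omega K} (hf : f ∈ T.chainMaps K z z') {j : ℤ}
    (h : T.routeAt z' j = none) : f j = 0 := by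
  rw [← chainMaps_mul_idem hf, idem_eq_zero h, mul_zero]

/-- The components of a chain map vanish from the place on where the routes have separated. -/
theorem chainMaps_eq_zero {f : ℤ → T.Omega K} (hf : f ∈ T.chainMaps K z z') {j : ℕ}
    {d d' : T.graph.Dart} (hd : T.OnRoute z j d) (hd' : T.OnRoute z' j d')
    (hne : d.fst ≠ d'.fst) : f j = 0 := by
  refine T.corner_disjoint K hne ?_ ?_ ?_
    (by rw [← hd.idem]; exact chainMaps_idem_mul hf j)
    (by rw [← hd'.idem]; exact chainMaps_mul_idem hf j)
  · intro h; have := hd.eq_succ_of_fst_snd hd' h; omega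
  · intro h; have := hd'.eq_succ_of_fst_snd hd h.symm; omega
  · intro h; obtain ⟨-, rfl⟩ := hd.eq_of_snd hd' h; exact hne rfl

/-- A chain map between complexes which start with different edges is concentrated in degree
`0`. -/
theorem eq_single_of_ne {f : ℤ → T.Omega K} (hf : f ∈ T.chainMaps K z z')
    (h : z = none ∨ z' = none ∨ T.routeAt z 0 ≠ T.routeAt z' 0) : f = Pi.single 0 (f 0) := by
  funext j
  rcases lt_trichotomy j 0 with hj | rfl | hj
  · obtain ⟨n, rfl⟩ := Int.eq_negSucc_of_lt_zero hj
    rw [Pi.single_eq_of_ne (by omega)]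
    exact chainMaps_eq_zero_left hf rfl
  · rw [Pi.single_eq_same]
  · rw [Pi.single_eq_of_ne (by omega)]
    lift j to ℕ using hj.le
    obtain ⟨j, rfl⟩ := Nat.exists_eq_succ_of_ne_zero (by omega : j ≠ 0)
    by_cases h1 : T.routeAt z ((j + 1 : ℕ) : ℤ) = none
    · exact chainMaps_eq_zero_left hf h1
    by_cases h1' : T.routeAt z' ((j + 1 : ℕ) : ℤ) = none
    · exact chainMaps_eq_zero_right hf h1'
    have hz : z ≠ none := by rintro rfl; exact h1 (routeAt_none_succ j)
    have hz' : z' ≠ none := by rintro rfl; exact h1' (routeAt_none_succ j)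
    obtain ⟨d, hd⟩ := onRoute_of_ne_none hz h1
    obtain ⟨d', hd'⟩ := onRoute_of_ne_none hz' h1'
    refine chainMaps_eq_zero hf hd hd' fun h2 => ?_
    have h3 := (hd.eq_of_fst hd' h2).2 0 (by omega)
    simp only [hz, hz', false_or] at h
    exact h h3

/-- If the component of a chain map in degree `0` is annihilated by the differential of the target,
then so are all its components: by exactness, each one factors through the preceding
differential. -/
theorem mul_diffElt_eq_zero {f : ℤ → T.Omega K} (hf : f ∈ T.chainMaps K z z')
    (h0 : f 0 * T.diffElt K z' 0 = 0) (hz : z ≠ none) (hz' : z' ≠ none) (j : ℕ) :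
    f j * T.diffElt K z' j = 0 := by
  induction j with
  | zero => exact h0
  | succ j ih =>
    by_cases h1 : T.routeAt z ((j + 1 : ℕ) : ℤ) = none
    · rw [chainMaps_eq_zero_left hf h1, zero_mul]
    by_cases h1' : T.routeAt z' ((j + 1 : ℕ) : ℤ) = none
    · rw [chainMaps_eq_zero_right hf h1', zero_mul]
    obtain ⟨d, hd⟩ := onRoute_of_ne_none hz h1
    obtain ⟨d', hd'⟩ := onRoute_of_ne_none hz' h1'
    by_cases h2 : d.fst = d'.fst
    · obtain ⟨c, hc, -⟩ := hd.pred
      have hc' : T.OnRoute z' j c := ((hd.eq_of_fst hd' h2).2 j (by omega)).symm.trans hc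
      rw [chainMaps_comm hf] at ih
      obtain ⟨y, -, -, hy⟩ := exists_factor hc hc' hd hd'
        (by rw [← hd.idem]; exact chainMaps_idem_mul hf _)
        (by rw [← hd'.idem]; exact chainMaps_mul_idem hf _) ih
      rw [Nat.cast_succ, hy, mul_assoc, diffElt_mul_diffElt, mul_zero]
    · rw [chainMaps_eq_zero hf hd hd' h2, zero_mul]

/-- A chain map which is a multiple of the full turn in degree `0` is homotopic to one which is
concentrated in degree `0` and again a multiple of the full turn there.  The components are removed
one after the other, from the top. -/
theorem exists_turn_of_zero {d₀ : T.graph.Dart} (hd₀ : T.OnRoute z 0 d₀)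
    (hd₀' : T.OnRoute z' 0 d₀) {f : ℤ → T.Omega K} (hf : f ∈ T.chainMaps K z z')
    (h0 : ∃ b : K, f 0 = b • turn K d₀) :
    ∃ b : K, f - Pi.single 0 (b • turn K d₀) ∈ T.nullMaps K z z' := by
  have key (n : ℕ) : ∀ f ∈ T.chainMaps K z z', (∃ b : K, f 0 = b • turn K d₀) →
      (∀ j : ℕ, n < j → f j = 0) →
      ∃ b : K, f - Pi.single 0 (b • turn K d₀) ∈ T.nullMaps K z z' := by
    induction n with
    | zero =>
      rintro f hf ⟨b, hb⟩ hn
      refine ⟨b, ?_⟩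
      suffices h : f = Pi.single 0 (b • turn K d₀) by
        rw [← h, sub_self]; exact Submodule.zero_mem _
      funext j
      rcases lt_trichotomy j 0 with hj | rfl | hj
      · obtain ⟨n, rfl⟩ := Int.eq_negSucc_of_lt_zero hj
        rw [Pi.single_eq_of_ne (by omega)]
        exact chainMaps_eq_zero_left hf rfl
      · rw [Pi.single_eq_same, hb]
      · rw [Pi.single_eq_of_ne (by omega)]
        lift j to ℕ using hj.le
        exact hn j (by omega)
    | succ n ih =>
      rintro f hf ⟨b, hb⟩ hn
      -- the top component factors through the differential of `Q(z')`
      obtain ⟨y, hy, hy'⟩ : ∃ y, T.idem K z ((n : ℤ) + 1) * y * T.idem K z' n = y ∧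
          f ((n : ℤ) + 1) = y * T.diffElt K z' n := by
        by_cases h1 : f ((n : ℤ) + 1) = 0
        · exact ⟨0, by simp, by simp [h1]⟩
        obtain ⟨d, hd⟩ := onRoute_of_ne_none (j := n + 1) hd₀.ne_none
          fun h => h1 (chainMaps_eq_zero_left hf h)
        obtain ⟨d', hd'⟩ := onRoute_of_ne_none (j := n + 1) hd₀'.ne_none
          fun h => h1 (chainMaps_eq_zero_right hf h)
        have h2 : d.fst = d'.fst := by
          by_contra h; exact h1 (chainMaps_eq_zero hf hd hd' h)
        obtain ⟨c, hc, -⟩ := hd.pred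
        have hc' : T.OnRoute z' n c := ((hd.eq_of_fst hd' h2).2 n (by omega)).symm.trans hc
        have h4 : turn K d₀ * T.diffElt K z' 0 = 0 := turn_mul_diffElt d₀ hd₀'
        have h3 := mul_diffElt_eq_zero hf (by rw [hb, smul_mul_assoc, h4, smul_zero])
          hd₀.ne_none hd₀'.ne_none n
        rw [chainMaps_comm hf] at h3
        obtain ⟨y, h4, h5, h6⟩ := exists_factor hc hc' hd hd'
          (by rw [← hd.idem]; exact chainMaps_idem_mul hf _)
          (by rw [← hd'.idem]; exact chainMaps_mul_idem hf _) h3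
        refine ⟨y, ?_, h6⟩
        have h7 := hd.idem (K := K)
        rw [Nat.cast_succ] at h7
        rw [h7, h4, hc'.idem, h5]
      have hnull := single_mem_nullMaps (n : ℤ) hy
      set g : ℤ → T.Omega K := Pi.single (n : ℤ) (T.diffElt K z n * y) +
        Pi.single ((n : ℤ) + 1) (y * T.diffElt K z' n) with hg
      obtain ⟨b', hb'⟩ := ih (f - g)
        (Submodule.sub_mem _ hf (nullMaps_le_chainMaps hnull))
        (by
          rcases Nat.eq_zero_or_pos n with rfl | hpos
          · have h1 : g 0 = T.diffElt K z 0 * y := by simp [hg]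
            have h2 : T.e K (T.edge (Sum.inl d₀)) * (T.diffElt K z 0 * y) = T.diffElt K z 0 * y := by
              rw [← mul_assoc, ← hd₀.idem]
              exact congrArg (· * y) (T.idem_mul_diffElt K z 0)
            have h3 : (T.diffElt K z 0 * y) * T.e K (T.edge (Sum.inl d₀)) = T.diffElt K z 0 * y := by
              rw [← hd₀'.idem, ← hy]
              simp only [mul_assoc, Nat.cast_zero, idem_mul_idem]
            obtain ⟨a, c, h4⟩ := T.corner_self K h2 h3
            have h5 : turn K d₀ * (T.diffElt K z 0 * y) = 0 := by
              rw [← mul_assoc, show turn K d₀ * T.diffElt K z 0 = 0 from turn_mul_diffElt d₀ hd₀,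
                zero_mul]
            rw [h4, mul_add, mul_smul_comm, mul_smul_comm, turn_mul_e,
              T.turn_mul_word K d₀ _ (T.val_pos _), smul_zero, add_zero] at h5
            rw [(smul_eq_zero.1 h5).resolve_right (T.turn_ne_zero K _), zero_smul, zero_add] at h4
            exact ⟨b - c, by rw [Pi.sub_apply, hb, h1, h4, sub_smul]⟩
          · refine ⟨b, ?_⟩
            rw [Pi.sub_apply, hb, hg, Pi.add_apply, Pi.single_eq_of_ne (by omega),
              Pi.single_eq_of_ne (by omega), add_zero, sub_zero])
        (by
          intro j hj
          rw [Pi.sub_apply, hg, Pi.add_apply, Pi.single_eq_of_ne (by omega), zero_add]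
          rcases eq_or_ne j (n + 1) with rfl | hne
          · rw [Nat.cast_succ, hy', Pi.single_eq_same, sub_self]
          · rw [hn j (by omega), Pi.single_eq_of_ne (by omega), sub_self])
      refine ⟨b', ?_⟩
      have := Submodule.add_mem _ hb' hnull
      rwa [sub_right_comm, sub_add_cancel] at this
  obtain ⟨n, hn⟩ : ∃ n : ℕ, ∀ j : ℕ, n < j → f j = 0 :=
    ⟨(T.route z).length, fun j hj => chainMaps_eq_zero_left hf
      (by rw [routeAt_natCast]; exact List.getElem?_eq_none hj.le)⟩
  exact key n f hf h0 hn

end LoopBrauerGraph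

/-! ### Comparison of two edges in the same branch -/

namespace LoopBrauerGraph

universe u v

variable {V : Type v} [Finite V] {T : LoopBrauerGraph V} {K : Type u} [Field K]
  {z z' z'' : T.Edge}

variable (T z z') in
/-- Two routes with a common start separate after the edge with half-edge `c`, and the first one
continues with an edge which comes earlier in the cyclic ordering, counted from `c`; or the second
route ends with this edge. -/
def Separates (k : ℕ) (c d : T.graph.Dart) (i : ℕ) : Prop :=
  T.OnRoute z k c ∧ (∀ l : ℕ, l ≤ k → T.routeAt z l = T.routeAt z' l) ∧ T.OnRoute z (k + 1) d ∧
    0 < i ∧ i < T.val (Sum.inl c.symm) ∧ (T.next ^ i) (Sum.inl c.symm) = Sum.inl d ∧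
    (T.routeAt z' ((k + 1 : ℕ) : ℤ) = none ∨ ∃ d' i', T.OnRoute z' (k + 1) d' ∧ i < i' ∧
      i' < T.val (Sum.inl c.symm) ∧ (T.next ^ i') (Sum.inl c.symm) = Sum.inl d')

/-- Two routes to different tree edges with a common start separate in one way or the other. -/
theorem exists_separates (hz : z ≠ none) (hz' : z' ≠ none) (h : z ≠ z')
    (h0 : T.routeAt z 0 = T.routeAt z' 0) :
    (∃ k c d i, T.Separates z z' k c d i) ∨ ∃ k c d i, T.Separates z' z k c d i := by
  obtain ⟨k, hk, hlt⟩ := exists_first_difference hz hz' h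
  rcases k with _ | k
  · exact absurd h0 hk
  have hle (l : ℕ) (hl : l ≤ k) : T.routeAt z l = T.routeAt z' l := hlt l (by omega)
  by_cases h1 : T.routeAt z ((k + 1 : ℕ) : ℤ) = none
  · obtain ⟨d, hd⟩ := onRoute_of_ne_none hz' fun h => hk (h1.trans h.symm)
    obtain ⟨c, hc, -⟩ := hd.pred
    obtain ⟨i, hi, hi', hi''⟩ := hc.exists_pow hd
    exact Or.inr ⟨k, c, d, i, hc, fun l hl => (hle l hl).symm, hd, hi, hi', hi'', Or.inl h1⟩
  obtain ⟨d, hd⟩ := onRoute_of_ne_none hz h1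
  obtain ⟨c, hc, -⟩ := hd.pred
  obtain ⟨i, hi, hi', hi''⟩ := hc.exists_pow hd
  by_cases h2 : T.routeAt z' ((k + 1 : ℕ) : ℤ) = none
  · exact Or.inl ⟨k, c, d, i, hc, hle, hd, hi, hi', hi'', Or.inl h2⟩
  obtain ⟨d', hd'⟩ := onRoute_of_ne_none hz' h2
  have hc' : T.OnRoute z' k c := (hle k le_rfl).symm.trans hc
  obtain ⟨m, hm, hm', hm''⟩ := hc'.exists_pow hd'
  rcases lt_trichotomy i m with h3 | h3 | h3
  · exact Or.inl ⟨k, c, d, i, hc, hle, hd, hi, hi', hi'', Or.inr ⟨d', m, hd', h3, hm', hm''⟩⟩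
  · subst h3
    exact absurd (hd.trans (congrArg some (hi''.symm.trans hm'')) |>.trans hd'.symm) hk
  · exact Or.inr ⟨k, c, d', m, hc', fun l hl => (hle l hl).symm, hd', hm, hm', hm'',
      Or.inr ⟨d, i, hd, h3, hi', hi''⟩⟩

namespace Separates

variable {k : ℕ} {c d : T.graph.Dart} {i : ℕ} (hs : T.Separates z z' k c d i)

include hs

theorem onRoute_right : T.OnRoute z' k c := (hs.2.1 k le_rfl).symm.trans hs.1

theorem diffElt_left : T.diffElt K z k = T.word K (Sum.inl c.symm) i :=
  hs.1.diffElt hs.2.2.1 hs.2.2.2.1 hs.2.2.2.2.1 hs.2.2.2.2.2.1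

/-- The differential of the first complex divides that of the second one. -/
theorem exists_connecting : ∃ x : T.Omega K,
    T.idem K z ((k : ℤ) + 1) * x * T.idem K z' ((k : ℤ) + 1) = x ∧
      T.diffElt K z k * x = T.diffElt K z' k ∧ x * T.diffElt K z' ((k : ℤ) + 1) = 0 := by
  obtain ⟨hc, -, hd, hi, hi', hdi, h | ⟨d', i', hd', hlt, hi'', hdi'⟩⟩ := id hs
  · exact ⟨0, by simp, by rw [mul_zero, diffElt_eq_zero_right h], by simp⟩
  · have hp := pow_sub_of_le hdi hdi' hlt.le
    refine ⟨T.word K (Sum.inl d) (i' - i), ?_, ?_, ?_⟩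
    · have h1 := hd.idem (K := K)
      have h2 := hd'.idem (K := K)
      rw [Nat.cast_succ] at h1 h2
      rw [h1, h2, T.e_mul_word, T.word_mul_e K hp]
    · rw [hs.diffElt_left, T.word_mul_word K hdi, Nat.add_sub_cancel' hlt.le,
        hs.onRoute_right.diffElt hd' (by omega) hi'' hdi']
    · rw [← Nat.cast_succ]
      exact word_mul_diffElt hd' (by omega) hp

/-- The full turn at the last common edge is the boundary of a homotopy. -/
theorem exists_homotopy : ∃ y : T.Omega K,
    T.idem K z ((k : ℤ) + 1) * y * T.idem K z' k = y ∧
      T.diffElt K z k * y = turn K c ∧ y * T.diffElt K z' k = 0 := by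
  obtain ⟨hc, -, hd, hi, hi', hdi, h⟩ := id hs
  have hp : (T.next ^ (T.val (Sum.inl c.symm) - i)) (Sum.inl d) = Sum.inl c.symm :=
    pow_wrap (i' := 0) hdi rfl hi'.le
  refine ⟨T.word K (Sum.inl d) (T.val (Sum.inl c.symm) - i), ?_, ?_, ?_⟩
  · have h1 := hd.idem (K := K)
    rw [Nat.cast_succ] at h1
    rw [h1, hs.onRoute_right.idem, T.e_mul_word, ← edge_symm, T.word_mul_e K hp]
  · rw [hs.diffElt_left, T.word_mul_word K hdi, Nat.add_sub_cancel' hi'.le, T.turn_symm]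
  · rcases h with h | ⟨d', i', hd', hlt, hi'', hdi'⟩
    · rw [diffElt_eq_zero_right h, mul_zero]
    · rw [hs.onRoute_right.diffElt hd' (by omega) hi'' hdi', T.word_mul_word K hp,
        T.word_eq_zero]
      have := T.val_of_pow hdi
      omega

theorem idem_eq {l : ℕ} (hl : l ≤ k) : T.idem K z l = T.idem K z' l := by
  rw [LoopBrauerGraph.idem, LoopBrauerGraph.idem, hs.2.1 l hl]

theorem diffElt_eq {l : ℕ} (hl : l < k) : T.diffElt K z l = T.diffElt K z' l := by
  rw [LoopBrauerGraph.diffElt, LoopBrauerGraph.diffElt, hs.2.1 l hl.le, ← Nat.cast_succ,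
    hs.2.1 (l + 1) hl]

/-- The chain map which is the identity as long as the routes agree. -/
theorem exists_chainMap : ∃ f ∈ T.chainMaps K z z', f 0 = T.idem K z 0 := by
  obtain ⟨x, hx, hx', hx''⟩ := hs.exists_connecting (K := K)
  refine ⟨fun j => if j ≤ k then T.idem K z j else if j = (k : ℤ) + 1 then x else 0,
    fun j => ?_, if_pos (by omega)⟩
  beta_reduce
  rcases lt_or_ge j 0 with hj | hj
  · rw [if_pos (by omega), idem_neg hj, diffElt_neg hj, diffElt_neg hj]; simp
  lift j to ℕ using hj
  rcases lt_trichotomy j k with h | rfl | h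
  · rw [if_pos (by omega), if_pos (by omega), ← hs.idem_eq h.le, ← hs.diffElt_eq h, idem_mul_idem,
      idem_mul_idem, idem_mul_diffElt, diffElt_mul_idem]
    exact ⟨rfl, rfl⟩
  · rw [if_pos le_rfl, if_neg (by omega), if_pos rfl, ← hs.idem_eq le_rfl, hx', idem_mul_idem,
      idem_mul_idem]
    refine ⟨rfl, ?_⟩
    rw [hs.idem_eq le_rfl, idem_mul_diffElt]
  · rw [if_neg (by omega : ¬ ((j : ℤ) ≤ k)), if_neg (by omega : ¬ ((j : ℤ) + 1 ≤ k)),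
      if_neg (by omega : ¬ ((j : ℤ) + 1 = k + 1))]
    by_cases h1 : (j : ℤ) = k + 1
    · rw [if_pos h1, h1, hx, hx'', mul_zero]; exact ⟨rfl, rfl⟩
    · rw [if_neg h1]; simp

/-- The full turn in degree `0` is null-homotopic as a map between the two complexes.  Along the
common part of the routes it is moved, up to sign, to the last common edge. -/
theorem turn_mem_nullMaps {d₀ : T.graph.Dart} (hd₀ : T.OnRoute z 0 d₀) :
    (Pi.single 0 (turn K d₀) : ℤ → T.Omega K) ∈ T.nullMaps K z z' := by
  have key (m : ℕ) : ∀ l : ℕ, l + m = k → ∀ c', T.OnRoute z l c' →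
      (Pi.single (l : ℤ) (turn K c') : ℤ → T.Omega K) ∈ T.nullMaps K z z' := by
    induction m with
    | zero =>
      rintro l rfl c' hc'
      obtain rfl := hc'.unique hs.1
      obtain ⟨y, h1, h2, h3⟩ := hs.exists_homotopy (K := K)
      have := single_mem_nullMaps _ h1
      rwa [h2, h3, Pi.single_zero, add_zero] at this
    | succ m ih =>
      intro l hl c' hc'
      obtain ⟨b, hb⟩ := hs.1.of_le (i := l + 1) (by omega)
      obtain ⟨i, hi, hi', hbi⟩ := hc'.exists_pow hb
      have hp : (T.next ^ (T.val (Sum.inl c'.symm) - i)) (Sum.inl b) = Sum.inl c'.symm :=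
        pow_wrap (i' := 0) hbi rfl hi'.le
      have hval := T.val_of_pow hbi
      have hidem := hb.idem (K := K)
      rw [Nat.cast_succ] at hidem
      have h1 := single_mem_nullMaps (z := z) (z' := z') (l : ℤ)
        (y := T.word K (Sum.inl b) (T.val (Sum.inl c'.symm) - i)) (by
          rw [← hs.idem_eq (by omega), hidem, hc'.idem, T.e_mul_word, ← edge_symm,
            T.word_mul_e K hp])
      rw [← hs.diffElt_eq (by omega), hc'.diffElt hb hi hi' hbi, T.word_mul_word K hbi,
        T.word_mul_word K hp, Nat.add_sub_cancel' hi'.le, Nat.sub_add_cancel hi'.le,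
        T.turn_symm, ← hval] at h1
      have h2 := ih (l + 1) (by omega) b hb
      rw [Nat.cast_succ] at h2
      simpa using Submodule.sub_mem _ h1 h2
  exact key k 0 (by omega) d₀ hd₀

/-- There is no chain map in the opposite direction with an identity component in degree `0`: its
coefficient would be the same at all common edges, but at the last one the differential of the
first complex is nonzero, while the differential of the second one, followed by any homomorphism
into the first, vanishes. -/
theorem coeff_eq_zero {d₀ : T.graph.Dart} (hd₀ : T.OnRoute z 0 d₀) {f : ℤ → T.Omega K}
    (hf : f ∈ T.chainMaps K z' z) {a b : K}
    (h0 : f 0 = a • T.e K (T.edge (Sum.inl d₀)) + b • turn K d₀) : a = 0 := by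
  have key (l : ℕ) (hl : l ≤ k) : ∀ c', T.OnRoute z l c' →
      ∃ b : K, f l = a • T.e K (T.edge (Sum.inl c')) + b • turn K c' := by
    induction l with
    | zero =>
      intro c' hc'
      obtain rfl := hc'.unique hd₀
      exact ⟨b, h0⟩
    | succ l ih =>
      intro d' hd'
      obtain ⟨c', hc', -⟩ := hd'.pred
      obtain ⟨b, hb⟩ := ih (by omega) c' hc'
      obtain ⟨i, hi, hi', hdi⟩ := hc'.exists_pow hd'
      have hidem := hd'.idem (K := K)
      obtain ⟨a', b', h1⟩ := T.corner_self K (d := d') (x := f ((l + 1 : ℕ) : ℤ))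
        (by rw [← hidem, hs.idem_eq hl]; exact chainMaps_idem_mul hf _)
        (by rw [← hidem]; exact chainMaps_mul_idem hf _)
      have h2 := chainMaps_comm hf (l : ℤ)
      have hD := hc'.diffElt hd' hi hi' hdi (K := K)
      have h3 := turn_mul_diffElt (K := K) c' hc'
      have h4 := diffElt_mul_turn (K := K) d' hc'
      rw [← hs.diffElt_eq (by omega), ← Nat.cast_succ, h1, hb, add_mul, mul_add, smul_mul_assoc,
        smul_mul_assoc, mul_smul_comm, mul_smul_comm, h3, h4, smul_zero, smul_zero, add_zero,
        add_zero, hD, ← edge_symm c', T.e_mul_word, T.word_mul_e K hdi, ← sub_eq_zero,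
        ← sub_smul] at h2
      have h5 := (smul_eq_zero.1 h2).resolve_right (T.word_ne_zero K hi'.le)
      rw [sub_eq_zero] at h5
      exact ⟨b', by rw [h1, h5]⟩
  obtain ⟨b, hb⟩ := key k le_rfl c hs.1
  have h2 := chainMaps_comm hf (k : ℤ)
  have h3 := turn_mul_diffElt (K := K) c hs.1
  have hne : T.diffElt K z k ≠ 0 := by
    rw [hs.diffElt_left]; exact T.word_ne_zero K hs.2.2.2.2.1.le
  have h4 : T.diffElt K z' k * f ((k : ℤ) + 1) = 0 := by
    obtain ⟨hc, -, hd, hi, hi', hdi, h | ⟨d', i', hd', hlt, hi'', hdi'⟩⟩ := id hs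
    · rw [diffElt_eq_zero_right h, zero_mul]
    · have hp := pow_wrap hdi' hdi hi''.le
      have hv := T.val_of_pow hdi'
      have h5 := hd.idem (K := K)
      have h6 := hd'.idem (K := K)
      rw [Nat.cast_succ] at h5 h6
      obtain ⟨e, he⟩ := T.corner_adjacent K (by omega) (by omega) hp
        (x := f ((k : ℤ) + 1)) (by rw [← h6]; exact chainMaps_idem_mul hf _)
        (by rw [← h5]; exact chainMaps_mul_idem hf _)
      rw [he, hs.onRoute_right.diffElt hd' (by omega) hi'' hdi', mul_smul_comm,
        T.word_mul_word K hdi', T.word_eq_zero K (by omega), smul_zero]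
  rw [hb, h4, add_mul, smul_mul_assoc, smul_mul_assoc, h3, smul_zero, add_zero, ← hs.1.idem,
    idem_mul_diffElt] at h2
  exact (smul_eq_zero.1 h2).resolve_right hne

end Separates

end LoopBrauerGraph

/-! ### The order of the edges -/

namespace LoopBrauerGraph

universe u v

variable {V : Type v} [Finite V] {T : LoopBrauerGraph V} {K : Type u} [Field K]
  {z z' z'' : T.Edge}

/-- The full turn in degree `0` is not null-homotopic as an endomorphism of `Q(z)`.  For a
null-homotopic map the alternating sum of the values of the socle form on the components
vanishes. -/
theorem turn_not_null {d₀ : T.graph.Dart} (hd₀ : T.OnRoute z 0 d₀) {c : K}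
    (h : (Pi.single 0 (c • turn K d₀) : ℤ → T.Omega K) ∈ T.nullMaps K z z) : c = 0 := by
  obtain ⟨φ, hφ⟩ := T.exists_socleForm K
  obtain ⟨h, h1, h2⟩ := h
  have hturn (d : T.graph.Dart) : φ (turn K d) = 1 := by
    rw [(hφ _ _).1 rfl, turnSign, if_neg (by simp)]
  -- both products are the same multiple of a full turn, at the two ends of the differential
  have comm (j : ℕ) : φ (h ((j : ℤ) + 1) * T.diffElt K z j) =
      φ (T.diffElt K z j * h ((j : ℤ) + 1)) := by
    by_cases hj : T.routeAt z ((j + 1 : ℕ) : ℤ) = none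
    · have : T.diffElt K z j = 0 := diffElt_eq_zero_right hj
      rw [this, mul_zero, zero_mul]
    obtain ⟨d, hd⟩ := onRoute_of_ne_none hd₀.ne_none hj
    obtain ⟨c', hc', -⟩ := hd.pred
    obtain ⟨i, hi, hi', hdi⟩ := hc'.exists_pow hd
    have hp : (T.next ^ (T.val (Sum.inl c'.symm) - i)) (Sum.inl d) = Sum.inl c'.symm :=
      pow_wrap (i' := 0) hdi rfl hi'.le
    have hval := T.val_of_pow hdi
    have h3 := h1 ((j : ℤ) + 1)
    have h4 := hd.idem (K := K)
    rw [Nat.cast_succ] at h4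
    rw [add_sub_cancel_right, h4, hc'.idem] at h3
    obtain ⟨b, hb⟩ := T.corner_adjacent K (by omega) (by omega) hp (x := h ((j : ℤ) + 1))
      (by rw [← h3, ← mul_assoc, ← mul_assoc, T.e_mul_e])
      (by rw [← h3, edge_symm, mul_assoc, T.e_mul_e])
    rw [hb, hc'.diffElt hd hi hi' hdi, mul_smul_comm, smul_mul_assoc, T.word_mul_word K hp,
      T.word_mul_word K hdi, Nat.sub_add_cancel hi'.le, Nat.add_sub_cancel' hi'.le, ← hval,
      map_smul, map_smul, hturn, hval, hturn]
  have step (j : ℕ) : φ (T.diffElt K z ((j : ℤ) + 1) * h ((j : ℤ) + 1 + 1)) =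
      - φ (T.diffElt K z j * h ((j : ℤ) + 1)) := by
    have h3 := congrArg φ (h2 ((j : ℤ) + 1))
    rw [Pi.single_eq_of_ne (by omega), map_zero, map_add, add_sub_cancel_right, comm] at h3
    rw [eq_neg_iff_add_eq_zero, h3]
  have zero (j : ℕ) : φ (T.diffElt K z j * h ((j : ℤ) + 1)) = 0 →
      φ (T.diffElt K z 0 * h 1) = 0 := by
    induction j with
    | zero => exact fun h => h
    | succ j ih =>
      intro h3
      rw [Nat.cast_succ, step, neg_eq_zero] at h3
      exact ih h3
  have h3 := congrArg φ (h2 0)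
  rw [Pi.single_eq_same, map_smul, hturn, diffElt_neg (by omega : (0 : ℤ) - 1 < 0), mul_zero,
    add_zero, zero_add, zero (T.route z).length, smul_eq_mul, mul_one] at h3
  · exact h3
  · rw [diffElt_eq_zero_left, zero_mul, map_zero]
    rw [routeAt_natCast]
    exact List.getElem?_eq_none le_rfl

theorem single_mem_chainMaps {x : T.Omega K} (hx : T.idem K z 0 * x = x)
    (hx' : x * T.idem K z' 0 = x) (h : x * T.diffElt K z' 0 = 0) :
    (Pi.single 0 x : ℤ → T.Omega K) ∈ T.chainMaps K z z' := by
  intro j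
  by_cases h0 : j = 0
  · subst h0
    rw [Pi.single_eq_same, Pi.single_eq_of_ne (by omega), h, hx, hx', mul_zero]
    exact ⟨rfl, rfl⟩
  · rw [Pi.single_eq_of_ne h0]
    by_cases h1 : j + 1 = 0
    · rw [diffElt_neg (by omega : j < 0), diffElt_neg (by omega : j < 0)]; simp
    · rw [Pi.single_eq_of_ne h1]; simp

theorem single_mul_eq (x : T.Omega K) (f : ℤ → T.Omega K) :
    (Pi.single 0 x * f : ℤ → T.Omega K) = Pi.single 0 (x * f 0) := by
  funext j
  by_cases h : j = 0
  · subst h; simp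
  · simp [Pi.single_eq_of_ne h]

theorem mul_single_eq (x : T.Omega K) (f : ℤ → T.Omega K) :
    (f * Pi.single 0 x : ℤ → T.Omega K) = Pi.single 0 (f 0 * x) := by
  funext j
  by_cases h : j = 0
  · subst h; simp
  · simp [Pi.single_eq_of_ne h]

theorem exists_pos (z : T.Edge) : ∃ k, 0 < k ∧ k ≤ T.excLength ∧ (z = none → k = T.excLength) ∧
    ∀ d, T.OnRoute z 0 d → k < T.excLength ∧ (T.next ^ k) (Sum.inr true) = Sum.inl d := by
  by_cases hz : z = none
  · exact ⟨T.excLength, T.excLength_pos, le_rfl, fun _ => rfl, fun d hd => absurd hz hd.ne_none⟩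
  · obtain ⟨d, hd⟩ := exists_onRoute hz
    obtain ⟨k, h1, h2, h3⟩ := T.exists_pow_S hd.fst_eq_S
    refine ⟨k, h1, h2.le, fun h => absurd h hz, fun d' hd' => ?_⟩
    obtain rfl := hd.unique hd'
    exact ⟨h2, h3⟩

/-- The position on the exceptional cycle of the first edge on the route to `z`; the loop has
the position `r`. -/
noncomputable def pos (z : T.Edge) : ℕ := (exists_pos z).choose

theorem pos_pos (z : T.Edge) : 0 < pos z := (exists_pos z).choose_spec.1

theorem pos_le (z : T.Edge) : pos z ≤ T.excLength := (exists_pos z).choose_spec.2.1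

theorem pos_none : pos (none : T.Edge) = T.excLength := (exists_pos _).choose_spec.2.2.1 rfl

theorem OnRoute.pos_lt {d : T.graph.Dart} (h : T.OnRoute z 0 d) : pos z < T.excLength :=
  ((exists_pos z).choose_spec.2.2.2 d h).1

theorem OnRoute.pow_pos {d : T.graph.Dart} (h : T.OnRoute z 0 d) :
    (T.next ^ pos z) (Sum.inr true) = Sum.inl d :=
  ((exists_pos z).choose_spec.2.2.2 d h).2

theorem pos_lt (hz : z ≠ none) : pos z < T.excLength := by
  obtain ⟨d, hd⟩ := exists_onRoute hz
  exact hd.pos_lt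

/-- The half-edge at position `pos z`. -/
noncomputable def start (z : T.Edge) : T.HalfEdge := (T.next ^ pos z) (Sum.inr true)

theorem OnRoute.start {d : T.graph.Dart} (h : T.OnRoute z 0 d) : start z = Sum.inl d := h.pow_pos

theorem start_none : start (none : T.Edge) = Sum.inr false := by
  rw [start, pos_none, pow_excLength]

theorem val_start (z : T.Edge) : T.val (start z) = T.excLength + 1 := by
  rw [start, val_pow, val_inr]

theorem e_start (z : T.Edge) : T.e K (T.edge (start z)) = T.idem K z 0 := by
  by_cases hz : z = none
  · subst hz; rw [start_none]; rfl
  · obtain ⟨d, hd⟩ := exists_onRoute hz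
    rw [hd.start]; exact hd.idem.symm

theorem routeAt_eq_of_pos (hz : z ≠ none) (hz' : z' ≠ none) (h : pos z = pos z') :
    T.routeAt z 0 = T.routeAt z' 0 := by
  obtain ⟨d, hd⟩ := exists_onRoute hz
  obtain ⟨d', hd'⟩ := exists_onRoute hz'
  have h1 := hd.pow_pos
  rw [h, hd'.pow_pos] at h1
  obtain rfl := Sum.inl.inj h1
  exact Eq.trans hd (Eq.symm hd')

theorem routeAt_ne_of_pos (h : pos z ≠ pos z') :
    z = none ∨ z' = none ∨ T.routeAt z 0 ≠ T.routeAt z' 0 := by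
  by_cases hz : z = none
  · exact Or.inl hz
  by_cases hz' : z' = none
  · exact Or.inr (Or.inl hz')
  refine Or.inr (Or.inr fun h1 => h ?_)
  obtain ⟨d, hd⟩ := exists_onRoute hz
  have hd' : T.OnRoute z' 0 d := h1.symm.trans hd
  exact T.eq_of_pow_eq (pos_pos z') (by rw [val_inr]; have := pos_le z'; omega)
    (by rw [val_inr]; have := pos_le z; omega) (hd.pow_pos.trans hd'.pow_pos.symm)

theorem pow_sub_start (h : pos z ≤ pos z') : (T.next ^ (pos z' - pos z)) (start z) = start z' :=
  pow_sub_of_le rfl rfl h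

theorem pow_start_none (z : T.Edge) :
    (T.next ^ (T.excLength - pos z)) (start z) = Sum.inr false := by
  have h : pos z ≤ pos (none : T.Edge) := by rw [pos_none]; exact pos_le z
  have := pow_sub_start h
  rwa [start_none, pos_none] at this

theorem pow_start_loop (z : T.Edge) :
    (T.next ^ (T.excLength - pos z + 1)) (start z) = Sum.inr true := by
  rw [pow_succ', Equiv.Perm.mul_apply, pow_start_none, T.next_loop]

theorem pow_start_through (z z' : T.Edge) :
    (T.next ^ (T.excLength - pos z + 1 + pos z')) (start z) = start z' := by
  rw [add_comm, pow_add, Equiv.Perm.mul_apply, pow_start_loop, start]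

variable (K) in
/-- The path `β ⋯ β` along the exceptional cycle between the first edges of two routes. -/
noncomputable def between (z z' : T.Edge) : T.Omega K := T.word K (start z) (pos z' - pos z)

variable (K) in
/-- The path `β ⋯ βᵣ` along the exceptional cycle from the first edge of a route to the loop. -/
noncomputable def toLoop (z : T.Edge) : T.Omega K := T.word K (start z) (T.excLength - pos z)

variable (K) in
/-- The path `β₁ ⋯ β` along the exceptional cycle from the loop to the first edge of a route. -/
noncomputable def fromLoop (z : T.Edge) : T.Omega K := T.word K (Sum.inr true) (pos z)

variable (T K) in
/-- The arrow `α₁`. -/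
noncomputable def loopElt : T.Omega K := T.word K (Sum.inr false) 1

variable (K) in
/-- The path `β ⋯ βᵣ α₁ β₁ ⋯ β` through the loop between the first edges of two routes. -/
noncomputable def through (z z' : T.Edge) : T.Omega K :=
  T.word K (start z) (T.excLength - pos z + 1 + pos z')

theorem toLoop_mul_loopElt (z : T.Edge) :
    toLoop K z * T.loopElt K = T.word K (start z) (T.excLength - pos z + 1) :=
  T.word_mul_word K (pow_start_none z) 1

theorem toLoop_mul_loopElt_mul_fromLoop (z z' : T.Edge) :
    toLoop K z * T.loopElt K * fromLoop K z' = through K z z' := by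
  rw [toLoop_mul_loopElt]; exact T.word_mul_word K (pow_start_loop z) _

theorem loopElt_mul_fromLoop (z : T.Edge) :
    T.loopElt K * fromLoop K z = T.word K (Sum.inr false) (pos z + 1) := by
  rw [add_comm]; exact T.word_mul_word K (by rw [pow_one, T.next_loop]) _

theorem OnRoute.through_self {d : T.graph.Dart} (h : T.OnRoute z 0 d) :
    through K z z = turn K d := by
  have h1 := pos_le z
  have h2 := val_start z
  rw [h.start] at h2
  rw [through, h.start, turn, h2]
  congr 1
  omega

theorem between_mul_through (h : pos z ≤ pos z') :
    between K z z' * through K z' z = through K z z := by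
  have h1 := pos_le z
  have h2 := pos_le z'
  rw [between, through, through, T.word_mul_word K (pow_sub_start h)]
  congr 1
  omega

theorem through_mul_between (h : pos z' ≤ pos z) :
    through K z z' * between K z' z = through K z z := by
  rw [between, through, through, T.word_mul_word K (pow_start_through z z')]
  congr 1
  omega

theorem between_mul_between (h : pos z ≤ pos z') (h' : pos z' ≤ pos z'') :
    between K z z' * between K z' z'' = between K z z'' := by
  rw [between, between, between, T.word_mul_word K (pow_sub_start h)]
  congr 1
  omega

theorem between_eq (h : pos z = pos z') : between K z z' = T.idem K z 0 := by
  rw [between, h, Nat.sub_self, T.word_zero, e_start]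

theorem between_none (z : T.Edge) : between K z none = toLoop K z := by
  rw [between, pos_none, toLoop]

theorem word_start_mul_diffElt {g : T.HalfEdge} {k : ℕ} (hk : 0 < k)
    (hg : (T.next ^ k) g = start z) : T.word K g k * T.diffElt K z 0 = 0 := by
  by_cases hz : z = none
  · rw [hz, diffElt_none, mul_zero]
  · obtain ⟨d, hd⟩ := exists_onRoute hz
    exact word_mul_diffElt hd hk (hg.trans hd.start)

theorem single_between_mem (h : pos z < pos z') :
    (Pi.single 0 (between K z z') : ℤ → T.Omega K) ∈ T.chainMaps K z z' := by
  refine single_mem_chainMaps ?_ ?_ ?_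
  · rw [← e_start]; exact T.e_mul_word K _ _
  · rw [← e_start]; exact T.word_mul_e K (pow_sub_start h.le)
  · exact word_start_mul_diffElt (by omega) (pow_sub_start h.le)

theorem single_through_mem :
    (Pi.single 0 (through K z z') : ℤ → T.Omega K) ∈ T.chainMaps K z z' := by
  refine single_mem_chainMaps ?_ ?_ ?_
  · rw [← e_start]; exact T.e_mul_word K _ _
  · rw [← e_start]; exact T.word_mul_e K (pow_start_through z z')
  · exact word_start_mul_diffElt (by omega) (pow_start_through z z')

theorem single_toLoop_mem :
    (Pi.single 0 (toLoop K z) : ℤ → T.Omega K) ∈ T.chainMaps K z none := by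
  refine single_mem_chainMaps ?_ ?_ ?_
  · rw [← e_start]; exact T.e_mul_word K _ _
  · rw [← e_start, start_none]; exact T.word_mul_e K (pow_start_none z)
  · rw [diffElt_none, mul_zero]

theorem single_fromLoop_mem :
    (Pi.single 0 (fromLoop K z) : ℤ → T.Omega K) ∈ T.chainMaps K none z := by
  refine single_mem_chainMaps ?_ ?_ ?_
  · exact T.e_mul_word K (Sum.inr true) _
  · rw [← e_start]; exact T.word_mul_e K rfl
  · exact word_start_mul_diffElt (pos_pos z) rfl

theorem single_loopElt_mem :
    (Pi.single 0 (T.loopElt K) : ℤ → T.Omega K) ∈ T.chainMaps K none none := by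
  refine single_mem_chainMaps ?_ ?_ ?_
  · exact T.e_mul_word K (Sum.inr false) _
  · exact T.word_mul_e K (h' := Sum.inr true) (by rw [pow_one, T.next_loop])
  · rw [diffElt_none, mul_zero]

variable (K) in
/-- There is a chain map `Q(z) → Q(z')` which starts with the path along the exceptional cycle
from the first edge of one route to that of the other.  This is a linear order, with the loop as
its last element. -/
def Precedes (z z' : T.Edge) : Prop :=
  pos z ≤ pos z' ∧ ∃ f ∈ T.chainMaps K z z', f 0 = between K z z'

theorem precedes_refl (z : T.Edge) : Precedes K z z :=
  ⟨le_rfl, _, idem_mem_chainMaps, (between_eq rfl).symm⟩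

theorem Precedes.trans (h : Precedes K z z') (h' : Precedes K z' z'') : Precedes K z z'' := by
  obtain ⟨h1, f, hf, hf'⟩ := h
  obtain ⟨h2, g, hg, hg'⟩ := h'
  refine ⟨h1.trans h2, _, mul_mem_chainMaps hf hg, ?_⟩
  rw [Pi.mul_apply, hf', hg', between_mul_between h1 h2]

theorem precedes_of_pos_lt (h : pos z < pos z') : Precedes K z z' :=
  ⟨h.le, _, single_between_mem h, Pi.single_eq_same _ _⟩

theorem eq_none_of_pos (h : pos z = T.excLength) : z = none := by
  by_contra hz
  exact (pos_lt hz).ne h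

theorem precedes_none (z : T.Edge) : Precedes K z none := by
  by_cases h : z = none
  · subst h; exact precedes_refl _
  · exact precedes_of_pos_lt (by rw [pos_none]; exact pos_lt h)

theorem Separates.precedes {k : ℕ} {c d : T.graph.Dart} {i : ℕ} (hs : T.Separates z z' k c d i)
    (h : pos z = pos z') : Precedes K z z' := by
  obtain ⟨f, hf, hf'⟩ := hs.exists_chainMap (K := K)
  exact ⟨h.le, f, hf, by rw [hf', between_eq h]⟩

theorem Separates.not_precedes {k : ℕ} {c d : T.graph.Dart} {i : ℕ}
    (hs : T.Separates z z' k c d i) (h : pos z = pos z') : ¬ Precedes K z' z := by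
  rintro ⟨-, f, hf, hf'⟩
  obtain ⟨d₀, hd₀⟩ := hs.1.of_le (Nat.zero_le k)
  have h1 : T.OnRoute z' 0 d₀ := (hs.2.1 0 (Nat.zero_le k)).symm.trans hd₀
  have := hs.coeff_eq_zero hd₀ hf (a := 1) (b := 0) (by
    rw [hf', between_eq h.symm, one_smul, zero_smul, add_zero]; exact h1.idem)
  exact one_ne_zero this

theorem precedes_total (z z' : T.Edge) : Precedes K z z' ∨ Precedes K z' z := by
  rcases lt_trichotomy (pos z) (pos z') with h | h | h
  · exact Or.inl (precedes_of_pos_lt h)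
  · by_cases h1 : z = z'
    · subst h1; exact Or.inl (precedes_refl _)
    by_cases hz : z = none
    · subst hz; exact Or.inr (precedes_none _)
    by_cases hz' : z' = none
    · subst hz'; exact Or.inl (precedes_none _)
    rcases exists_separates hz hz' h1 (routeAt_eq_of_pos hz hz' h) with
      ⟨k, c, d, i, hs⟩ | ⟨k, c, d, i, hs⟩
    · exact Or.inl (hs.precedes h)
    · exact Or.inr (hs.precedes h.symm)
  · exact Or.inr (precedes_of_pos_lt h)

theorem Precedes.antisymm (h : Precedes K z z') (h' : Precedes K z' z) : z = z' := by
  have hp := h.1.antisymm h'.1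
  by_contra h1
  by_cases hz : z = none
  · subst hz; exact h1 (eq_none_of_pos (hp.symm.trans pos_none)).symm
  by_cases hz' : z' = none
  · subst hz'; exact h1 (eq_none_of_pos (hp.trans pos_none))
  rcases exists_separates hz hz' h1 (routeAt_eq_of_pos hz hz' hp) with
    ⟨k, c, d, i, hs⟩ | ⟨k, c, d, i, hs⟩
  · exact hs.not_precedes hp h'
  · exact hs.not_precedes hp.symm h

end LoopBrauerGraph

/-! ### Bases of the morphism spaces -/

namespace LoopBrauerGraph

universe u v

variable {V : Type v} [Finite V] {T : LoopBrauerGraph V} {K : Type u} [Field K]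
  {z z' : T.Edge}

theorem OnRoute.corner_zero {d d' : T.graph.Dart} (hd : T.OnRoute z 0 d) (hd' : T.OnRoute z' 0 d')
    {f : ℤ → T.Omega K} (hf : f ∈ T.chainMaps K z z') :
    T.e K (T.edge (Sum.inl d)) * f 0 = f 0 ∧ f 0 * T.e K (T.edge (Sum.inl d')) = f 0 := by
  rw [← hd.idem, ← hd'.idem]
  exact ⟨chainMaps_idem_mul hf 0, chainMaps_mul_idem hf 0⟩

/-- Between different tree edges in the order, all chain maps are multiples of one. -/
theorem exists_smul_of_precedes (hz : z ≠ none) (hz' : z' ≠ none) (hne : z ≠ z')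
    {g : ℤ → T.Omega K} (hg : g ∈ T.chainMaps K z z') (h : pos z ≤ pos z')
    (hg0 : g 0 = between K z z') {f : ℤ → T.Omega K} (hf : f ∈ T.chainMaps K z z') :
    ∃ c : K, f - c • g ∈ T.nullMaps K z z' := by
  obtain ⟨d, hd⟩ := exists_onRoute hz
  obtain ⟨d', hd'⟩ := exists_onRoute hz'
  obtain ⟨h1, h2⟩ := hd.corner_zero hd' hf
  rcases h.lt_or_eq with h3 | h3
  · have h4 := routeAt_ne_of_pos h3.ne
    have h5 := pow_sub_start h
    have h6 := val_start z
    have h7 := hd'.pos_lt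
    rw [hd.start] at h5 h6
    rw [hd'.start] at h5
    obtain ⟨c, hc⟩ := T.corner_adjacent K (by omega) (by omega) h5 h1 h2
    refine ⟨c, ?_⟩
    rw [eq_single_of_ne hf h4, eq_single_of_ne hg h4, hg0, hc, between, hd.start,
      ← Pi.single_smul, sub_self]
    exact Submodule.zero_mem _
  · have h4 := routeAt_eq_of_pos hz hz' h3
    have hd'' : T.OnRoute z' 0 d := h4.symm.trans hd
    obtain rfl := hd''.unique hd'
    obtain ⟨a, b, hab⟩ := T.corner_self K h1 h2
    have hsep : ∃ k c e i, T.Separates z z' k c e i := by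
      rcases exists_separates hz hz' hne h4 with hs | ⟨k, c, e, i, hs⟩
      · exact hs
      · exact absurd ⟨h, g, hg, hg0⟩ (hs.not_precedes h3.symm)
    obtain ⟨k, c, e, i, hs⟩ := hsep
    obtain ⟨b', hb'⟩ := exists_turn_of_zero hd hd' (f := f - a • g)
      (Submodule.sub_mem _ hf (Submodule.smul_mem _ a hg)) ⟨b, by
        have h5 : T.idem K z 0 = T.e K (T.edge (Sum.inl d)) := hd.idem
        rw [Pi.sub_apply, Pi.smul_apply, hg0, between_eq h3, hab, h5, add_sub_cancel_left]⟩
    refine ⟨a, ?_⟩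
    have := Submodule.add_mem _ hb' (Submodule.smul_mem _ b' (hs.turn_mem_nullMaps hd))
    rwa [← Pi.single_smul, sub_add_cancel] at this

/-- Between tree edges against the order, all chain maps are multiples of the one through the
loop. -/
theorem exists_smul_of_not_precedes (hz : z ≠ none) (hz' : z' ≠ none) (h : ¬ Precedes K z z')
    {f : ℤ → T.Omega K} (hf : f ∈ T.chainMaps K z z') :
    ∃ c : K, f - c • (Pi.single 0 (through K z z') : ℤ → T.Omega K) ∈ T.nullMaps K z z' := by
  obtain ⟨d, hd⟩ := exists_onRoute hz
  obtain ⟨d', hd'⟩ := exists_onRoute hz'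
  obtain ⟨h1, h2⟩ := hd.corner_zero hd' hf
  have h3 : pos z' ≤ pos z := not_lt.1 fun h' => h (precedes_of_pos_lt h')
  rcases h3.lt_or_eq with h3 | h3
  · have h5 := pow_start_through z z'
    have h6 := val_start z
    have h7 := hd.pos_lt
    rw [hd.start] at h5 h6
    rw [hd'.start] at h5
    obtain ⟨c, hc⟩ := T.corner_adjacent K (by omega) (by omega) h5 h1 h2
    refine ⟨c, ?_⟩
    rw [eq_single_of_ne hf (routeAt_ne_of_pos h3.ne'), hc, through, hd.start, ← Pi.single_smul,
      sub_self]
    exact Submodule.zero_mem _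
  · have h4 := routeAt_eq_of_pos hz hz' h3.symm
    have hd'' : T.OnRoute z' 0 d := h4.symm.trans hd
    obtain rfl := hd''.unique hd'
    have hne : z ≠ z' := by rintro rfl; exact h (precedes_refl _)
    obtain ⟨a, b, hab⟩ := T.corner_self K h1 h2
    have hsep : ∃ k c e i, T.Separates z' z k c e i := by
      rcases exists_separates hz hz' hne h4 with ⟨k, c, e, i, hs⟩ | hs
      · exact absurd (hs.precedes h3.symm) h
      · exact hs
    obtain ⟨k, c, e, i, hs⟩ := hsep
    rw [hs.coeff_eq_zero hd' hf hab, zero_smul, zero_add] at hab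
    obtain ⟨b', hb'⟩ := exists_turn_of_zero hd hd' hf ⟨b, hab⟩
    refine ⟨b', ?_⟩
    have h8 : through K z z' = through K z z := by rw [through, through, h3]
    rwa [← hd.through_self, Pi.single_smul, ← h8] at hb'

/-- For a tree edge `z`, the endomorphisms of `Q(z)` are spanned by the identity and the full turn in
degree `0`. -/
theorem exists_smul_add_smul (hz : z ≠ none) {f : ℤ → T.Omega K}
    (hf : f ∈ T.chainMaps K z z) :
    ∃ a b : K, f - (a • T.idem K z + b • (Pi.single 0 (through K z z) : ℤ → T.Omega K)) ∈ T.nullMaps K z z := by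
  obtain ⟨d, hd⟩ := exists_onRoute hz
  obtain ⟨h1, h2⟩ := hd.corner_zero hd hf
  obtain ⟨a, b, hab⟩ := T.corner_self K h1 h2
  obtain ⟨b', hb'⟩ := exists_turn_of_zero hd hd (f := f - a • T.idem K z)
    (Submodule.sub_mem _ hf (Submodule.smul_mem _ a idem_mem_chainMaps)) ⟨b, by
      have h5 : T.idem K z 0 = T.e K (T.edge (Sum.inl d)) := hd.idem
      rw [Pi.sub_apply, Pi.smul_apply, hab, h5, add_sub_cancel_left]⟩
  refine ⟨a, b', ?_⟩
  rwa [← sub_sub, hd.through_self, ← Pi.single_smul]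

/-- The chain maps `Q(1) → Q(z)` for a tree edge `z` are combinations of `β₁⋯β` and `α₁β₁⋯β`. -/
theorem exists_of_fromLoop (hz : z ≠ none) {f : ℤ → T.Omega K}
    (hf : f ∈ T.chainMaps K none z) :
    ∃ a b : K, f = a • (Pi.single 0 (fromLoop K z) : ℤ → T.Omega K) +
      b • (Pi.single 0 (T.loopElt K * fromLoop K z) : ℤ → T.Omega K) := by
  obtain ⟨d, hd⟩ := exists_onRoute hz
  have h1 := T.corner_loop_left K (pos_pos z) hd.pos_lt hd.pow_pos (x := f 0)
    (chainMaps_idem_mul hf 0) (by rw [← hd.idem]; exact chainMaps_mul_idem hf 0)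
  rw [Submodule.mem_span_pair] at h1
  obtain ⟨a, b, hab⟩ := h1
  refine ⟨a, b, ?_⟩
  rw [eq_single_of_ne hf (Or.inl rfl), loopElt_mul_fromLoop, ← Pi.single_smul, ← Pi.single_smul,
    ← Pi.single_add, ← hab, fromLoop]

/-- The chain maps `Q(z) → Q(1)` for a tree edge `z` are combinations of `β⋯βᵣ` and `β⋯βᵣα₁`. -/
theorem exists_of_toLoop (hz : z ≠ none) {f : ℤ → T.Omega K}
    (hf : f ∈ T.chainMaps K z none) :
    ∃ a b : K, f = a • (Pi.single 0 (toLoop K z) : ℤ → T.Omega K) +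
      b • (Pi.single 0 (toLoop K z * T.loopElt K) : ℤ → T.Omega K) := by
  obtain ⟨d, hd⟩ := exists_onRoute hz
  have h1 := T.corner_loop_right K (pos_pos z) hd.pos_lt hd.pow_pos (x := f 0)
    (by rw [← hd.idem]; exact chainMaps_idem_mul hf 0) (chainMaps_mul_idem hf 0)
  rw [Submodule.mem_span_pair] at h1
  obtain ⟨a, b, hab⟩ := h1
  refine ⟨a, b, ?_⟩
  rw [eq_single_of_ne hf (Or.inr (Or.inl rfl)), toLoop_mul_loopElt, ← Pi.single_smul,
    ← Pi.single_smul, ← Pi.single_add, ← hab, toLoop, hd.start]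

/-- The endomorphisms of `Q(1)` are combinations of `1`, `α₁`, `β₁⋯βᵣ` and `α₁β₁⋯βᵣ`. -/
theorem exists_of_loop {f : ℤ → T.Omega K} (hf : f ∈ T.chainMaps K none none) :
    ∃ a b c d : K, f = a • T.idem K none + b • (Pi.single 0 (T.loopElt K) : ℤ → T.Omega K) +
      c • (Pi.single 0 (fromLoop K none) : ℤ → T.Omega K) +
      d • (Pi.single 0 (T.loopElt K * fromLoop K none) : ℤ → T.Omega K) := by
  have h1 := T.corner_loop K (x := f 0) (chainMaps_idem_mul hf 0) (chainMaps_mul_idem hf 0)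
  rw [Submodule.mem_span_insert] at h1
  obtain ⟨a, y, hy, h1⟩ := h1
  rw [Submodule.mem_span_insert] at hy
  obtain ⟨b, y, hy, rfl⟩ := hy
  rw [Submodule.mem_span_pair] at hy
  obtain ⟨c, d, rfl⟩ := hy
  refine ⟨a, b, c, d, ?_⟩
  rw [eq_single_of_ne hf (Or.inl rfl), eq_single_of_ne idem_mem_chainMaps (Or.inl rfl),
    loopElt_mul_fromLoop, ← Pi.single_smul, ← Pi.single_smul, ← Pi.single_smul, ← Pi.single_smul,
    ← Pi.single_add, ← Pi.single_add, ← Pi.single_add, h1, fromLoop, pos_none, idem_none_zero,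
    loopElt, add_assoc, add_assoc]

/-- The dimension of a space of morphisms between complexes, computed from a basis. -/
theorem finrank_hom {n : ℕ} (v : Fin n → ℤ → T.Omega K) (hv : ∀ i, v i ∈ T.chainMaps K z z')
    (span : ∀ f ∈ T.chainMaps K z z', ∃ c : Fin n → K, f - ∑ i, c i • v i ∈ T.nullMaps K z z')
    (indep : ∀ c : Fin n → K, ∑ i, c i • v i ∈ T.nullMaps K z z' → ∀ i, c i = 0) :
    Module.finrank K (T.toHomotopy K (T.Q K z) ⟶ T.toHomotopy K (T.Q K z')) = n := by
  let w : Fin n → T.chainMaps K z z' := fun i => ⟨v i, hv i⟩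
  let L : (Fin n → K) →ₗ[K] (T.toHomotopy K (T.Q K z) ⟶ T.toHomotopy K (T.Q K z')) :=
    (T.toHom K z z').comp (Fintype.linearCombination K w)
  have hw (c : Fin n → K) : ((Fintype.linearCombination K w c : T.chainMaps K z z') :
      ℤ → T.Omega K) = ∑ i, c i • v i := by
    rw [Fintype.linearCombination_apply, AddSubmonoidClass.coe_finsetSum]
    rfl
  have hL : Function.Bijective L := by
    constructor
    · rw [injective_iff_map_eq_zero]
      intro c hc
      have h1 := (toHom_eq_zero_iff _).1 hc
      rw [hw] at h1
      exact funext (indep c h1)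
    · intro g
      obtain ⟨f, rfl⟩ := toHom_surjective g
      obtain ⟨c, hc⟩ := span f.1 f.2
      refine ⟨c, ?_⟩
      rw [eq_comm, ← sub_eq_zero]
      change T.toHom K z z' f - T.toHom K z z' _ = 0
      rw [← map_sub, toHom_eq_zero_iff]
      rw [← hw] at hc
      exact hc
  rw [← (LinearEquiv.ofBijective L hL).finrank_eq, Module.finrank_fin_fun]

theorem nullMaps_none {f : ℤ → T.Omega K} (hf : f ∈ T.nullMaps K none none) : f = 0 := by
  obtain ⟨h, -, h2⟩ := hf
  funext j
  rw [h2, diffElt_none, diffElt_none]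
  simp

/-- A combination of the identity and the full turn which is null-homotopic becomes a multiple of the
full turn after composition with the full turn; so its coefficients vanish. -/
theorem finrank_self (hz : z ≠ none) :
    Module.finrank K (T.toHomotopy K (T.Q K z) ⟶ T.toHomotopy K (T.Q K z)) = 2 := by
  obtain ⟨d, hd⟩ := exists_onRoute hz
  refine finrank_hom ![T.idem K z, Pi.single 0 (through K z z)] ?_ ?_ ?_
  · intro i
    fin_cases i
    · exact idem_mem_chainMaps
    · exact single_through_mem
  · intro f hf
    obtain ⟨a, b, hab⟩ := exists_smul_add_smul hz hf
    exact ⟨![a, b], by simpa [Fin.sum_univ_two] using hab⟩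
  · intro c hc
    rw [Fin.sum_univ_two] at hc
    have h1 : T.word K (Sum.inl d) (T.val (Sum.inl d)) *
        T.word K (Sum.inl d) (T.val (Sum.inl d)) = 0 := T.turn_mul_word K d _ (T.val_pos _)
    have h2 : T.idem K z 0 * turn K d = turn K d := by
      have h : T.idem K z 0 = T.e K (T.edge (Sum.inl d)) := hd.idem
      rw [h, e_mul_turn]
    have h3 := null_mul hc (single_through_mem (K := K) (z := z) (z' := z))
    rw [mul_single_eq, hd.through_self] at h3
    simp only [Matrix.cons_val_zero, Matrix.cons_val_one, Pi.add_apply, Pi.smul_apply,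
      Pi.single_eq_same, add_mul, smul_mul_assoc, h1, h2, smul_zero, add_zero] at h3
    have h4 := turn_not_null hd h3
    rw [h4, zero_smul, zero_add] at hc
    change c 1 • (Pi.single 0 (through K z z) : ℤ → T.Omega K) ∈ _ at hc
    rw [hd.through_self, ← Pi.single_smul] at hc
    have h5 := turn_not_null hd hc
    intro i
    fin_cases i
    · exact h4
    · exact h5

/-- The generating morphism is not null-homotopic, as it composes with one in the opposite direction
to the full turn in degree `0`. -/
theorem finrank_ne (hz : z ≠ none) (hz' : z' ≠ none) (hne : z ≠ z') :
    Module.finrank K (T.toHomotopy K (T.Q K z) ⟶ T.toHomotopy K (T.Q K z')) = 1 := by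
  obtain ⟨d, hd⟩ := exists_onRoute hz
  by_cases h : Precedes K z z'
  · obtain ⟨h1, g, hg, hg0⟩ := h
    refine finrank_hom ![g] (by simpa using hg) ?_ ?_
    · intro f hf
      obtain ⟨a, ha⟩ := exists_smul_of_precedes hz hz' hne hg h1 hg0 hf
      exact ⟨![a], by simpa using ha⟩
    · intro c hc
      rw [Fin.sum_univ_one] at hc
      have h3 := null_mul hc (single_through_mem (K := K) (z := z') (z' := z))
      rw [mul_single_eq] at h3
      simp only [Matrix.cons_val_zero, Pi.smul_apply, hg0, smul_mul_assoc,
        between_mul_through h1, hd.through_self] at h3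
      intro i
      fin_cases i
      exact turn_not_null hd h3
  · refine finrank_hom ![Pi.single 0 (through K z z')] (by simpa using single_through_mem) ?_ ?_
    · intro f hf
      obtain ⟨a, ha⟩ := exists_smul_of_not_precedes hz hz' h hf
      exact ⟨![a], by simpa using ha⟩
    · intro c hc
      obtain ⟨h1, g, hg, hg0⟩ := (precedes_total (K := K) z z').resolve_left h
      rw [Fin.sum_univ_one] at hc
      have h3 := null_mul hc hg
      simp only [Matrix.cons_val_zero, smul_mul_assoc, single_mul_eq, hg0,
        through_mul_between h1, hd.through_self, ← Pi.single_smul] at h3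
      intro i
      fin_cases i
      exact turn_not_null hd h3

theorem toLoop_mul_loopElt_sq (hz : z ≠ none) : toLoop K z * (T.loopElt K * T.loopElt K) = 0 := by
  have h := pos_lt hz
  have h1 := (T.isCyclicSystem K).word_mul_loop_sq (h := start z) (k := T.excLength - pos z)
    (by omega) (pow_start_none z)
  rwa [← (T.isCyclicSystem K).word_one] at h1

theorem loopElt_sq_mul_fromLoop (z : T.Edge) :
    T.loopElt K * T.loopElt K * fromLoop K z = 0 := by
  have h1 := (T.isCyclicSystem K).loop_sq_mul_word (pos_pos z)
  rwa [← (T.isCyclicSystem K).word_one, T.next_loop] at h1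

/-- `α₁² = α₁β₁⋯βᵣ`. -/
theorem loopElt_sq : T.loopElt K * T.loopElt K = T.loopElt K * fromLoop K none := by
  have h1 := (T.isCyclicSystem K).loop_mul_loop
  rw [← (T.isCyclicSystem K).word_one] at h1
  rw [loopElt_mul_fromLoop, pos_none, ← T.val_inr false]
  exact h1

/-- `β₁⋯βᵣα₁ = -α₁β₁⋯βᵣ`. -/
theorem fromLoop_mul_loopElt :
    fromLoop K none * T.loopElt K = - (T.loopElt K * fromLoop K (none : T.Edge)) := by
  rw [loopElt_mul_fromLoop, pos_none, ← T.turn_loop, fromLoop, pos_none, loopElt,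
    T.word_mul_word K T.pow_excLength]

/-- `βᵣ β₁ = 0`. -/
theorem fromLoop_none_mul_fromLoop (z : T.Edge) : fromLoop K none * fromLoop K z = 0 := by
  rw [fromLoop, fromLoop, pos_none]
  exact T.word_mul_word_eq_zero K T.excLength_pos (pos_pos z) (by rw [pow_excLength]; simp)
    (by simp)

/-- The coefficients of a null-homotopic combination are detected by composition with `β⋯βᵣα₁` and
`β⋯βᵣ`, which gives multiples of the full turn as endomorphisms of `Q(z)`. -/
theorem finrank_from_loop (hz : z ≠ none) :
    Module.finrank K (T.toHomotopy K (T.Q K none) ⟶ T.toHomotopy K (T.Q K z)) = 2 := by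
  obtain ⟨d, hd⟩ := exists_onRoute hz
  have hmem : (Pi.single 0 (T.loopElt K * fromLoop K z) : ℤ → T.Omega K) ∈
      T.chainMaps K none z := by
    have := mul_mem_chainMaps single_loopElt_mem (single_fromLoop_mem (K := K) (z := z))
    rwa [single_mul_eq, Pi.single_eq_same] at this
  refine finrank_hom ![Pi.single 0 (fromLoop K z), Pi.single 0 (T.loopElt K * fromLoop K z)]
    ?_ ?_ ?_
  · intro i
    fin_cases i
    · exact single_fromLoop_mem
    · exact hmem
  · intro f hf
    obtain ⟨a, b, hab⟩ := exists_of_fromLoop hz hf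
    refine ⟨![a, b], ?_⟩
    simp only [Fin.sum_univ_two, Matrix.cons_val_zero, Matrix.cons_val_one]
    rw [hab, sub_self]
    exact Submodule.zero_mem _
  · intro c hc
    rw [Fin.sum_univ_two] at hc
    simp only [Matrix.cons_val_zero, Matrix.cons_val_one] at hc
    have h0 : (Pi.single 0 (toLoop K z * T.loopElt K) : ℤ → T.Omega K) ∈
        T.chainMaps K z none := by
      have := mul_mem_chainMaps (single_toLoop_mem (K := K) (z := z)) single_loopElt_mem
      rwa [single_mul_eq, Pi.single_eq_same] at this
    have h1 : toLoop K z * T.loopElt K * (T.loopElt K * fromLoop K z) = 0 := by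
      rw [← mul_assoc, mul_assoc (toLoop K z), toLoop_mul_loopElt_sq hz, zero_mul]
    have h2 := mul_null h0 hc
    rw [single_mul_eq] at h2
    simp only [Pi.add_apply, Pi.smul_apply, Pi.single_eq_same, mul_add, mul_smul_comm, h1,
      toLoop_mul_loopElt_mul_fromLoop, smul_zero, add_zero, hd.through_self] at h2
    have h3 := turn_not_null hd h2
    rw [h3, zero_smul, zero_add] at hc
    have h4 := mul_null (single_toLoop_mem (K := K) (z := z)) hc
    rw [single_mul_eq] at h4
    simp only [Pi.smul_apply, Pi.single_eq_same, mul_smul_comm, ← mul_assoc,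
      toLoop_mul_loopElt_mul_fromLoop, hd.through_self] at h4
    have h5 := turn_not_null hd h4
    intro i
    fin_cases i
    · exact h3
    · exact h5

/-- The coefficients of a null-homotopic combination are detected by composition with `α₁β₁⋯β` and
`β₁⋯β`, which gives multiples of the full turn as endomorphisms of `Q(z)`. -/
theorem finrank_to_loop (hz : z ≠ none) :
    Module.finrank K (T.toHomotopy K (T.Q K z) ⟶ T.toHomotopy K (T.Q K none)) = 2 := by
  obtain ⟨d, hd⟩ := exists_onRoute hz
  have hmem : (Pi.single 0 (toLoop K z * T.loopElt K) : ℤ → T.Omega K) ∈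
      T.chainMaps K z none := by
    have := mul_mem_chainMaps (single_toLoop_mem (K := K) (z := z)) single_loopElt_mem
    rwa [single_mul_eq, Pi.single_eq_same] at this
  refine finrank_hom ![Pi.single 0 (toLoop K z), Pi.single 0 (toLoop K z * T.loopElt K)]
    ?_ ?_ ?_
  · intro i
    fin_cases i
    · exact single_toLoop_mem
    · exact hmem
  · intro f hf
    obtain ⟨a, b, hab⟩ := exists_of_toLoop hz hf
    refine ⟨![a, b], ?_⟩
    simp only [Fin.sum_univ_two, Matrix.cons_val_zero, Matrix.cons_val_one]
    rw [hab, sub_self]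
    exact Submodule.zero_mem _
  · intro c hc
    rw [Fin.sum_univ_two] at hc
    simp only [Matrix.cons_val_zero, Matrix.cons_val_one] at hc
    have h0 : (Pi.single 0 (T.loopElt K * fromLoop K z) : ℤ → T.Omega K) ∈
        T.chainMaps K none z := by
      have := mul_mem_chainMaps single_loopElt_mem (single_fromLoop_mem (K := K) (z := z))
      rwa [single_mul_eq, Pi.single_eq_same] at this
    have h1 : toLoop K z * T.loopElt K * (T.loopElt K * fromLoop K z) = 0 := by
      rw [← mul_assoc, mul_assoc (toLoop K z), toLoop_mul_loopElt_sq hz, zero_mul]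
    have h1' : toLoop K z * (T.loopElt K * fromLoop K z) = turn K d := by
      rw [← mul_assoc, toLoop_mul_loopElt_mul_fromLoop, hd.through_self]
    have h2 := null_mul hc h0
    rw [mul_single_eq] at h2
    simp only [Pi.add_apply, Pi.smul_apply, Pi.single_eq_same, add_mul, smul_mul_assoc, h1, h1',
      smul_zero, add_zero] at h2
    have h3 := turn_not_null hd h2
    rw [h3, zero_smul, zero_add] at hc
    have h4 := null_mul hc (single_fromLoop_mem (K := K) (z := z))
    rw [mul_single_eq] at h4
    simp only [Pi.smul_apply, Pi.single_eq_same, smul_mul_assoc,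
      toLoop_mul_loopElt_mul_fromLoop, hd.through_self] at h4
    have h5 := turn_not_null hd h4
    intro i
    fin_cases i
    · exact h3
    · exact h5

/-- The complex `Q(1)` is concentrated in degree `0`, so its endomorphism algebra is the corner of
`Ω(T)` at the loop. -/
theorem finrank_loop :
    Module.finrank K (T.toHomotopy K (T.Q K none) ⟶ T.toHomotopy K (T.Q K none)) = 4 := by
  have hmem : (Pi.single 0 (T.loopElt K * fromLoop K (none : T.Edge)) : ℤ → T.Omega K) ∈
      T.chainMaps K none none := by
    have := mul_mem_chainMaps single_loopElt_mem
      (single_fromLoop_mem (K := K) (z := (none : T.Edge)))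
    rwa [single_mul_eq, Pi.single_eq_same] at this
  refine finrank_hom ![T.idem K none, Pi.single 0 (T.loopElt K),
    Pi.single 0 (fromLoop K (none : T.Edge)),
    Pi.single 0 (T.loopElt K * fromLoop K (none : T.Edge))] ?_ ?_ ?_
  · intro i
    fin_cases i
    · exact idem_mem_chainMaps
    · exact single_loopElt_mem
    · exact single_fromLoop_mem
    · exact hmem
  · intro f hf
    obtain ⟨a, b, c, d, hab⟩ := exists_of_loop hf
    refine ⟨![a, b, c, d], ?_⟩
    simp only [Fin.sum_univ_four, Matrix.cons_val]
    rw [hab, sub_self]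
    exact Submodule.zero_mem _
  · intro c hc
    rw [Fin.sum_univ_four] at hc
    have h0 := congrFun (nullMaps_none hc) 0
    simp only [Matrix.cons_val, Pi.add_apply, Pi.smul_apply, Pi.single_eq_same,
      Pi.zero_apply] at h0
    set α := T.loopElt K
    set w := fromLoop K (none : T.Edge)
    have hne : α * w ≠ 0 := by
      rw [loopElt_mul_fromLoop, pos_none, ← T.val_inr false]
      exact T.turn_ne_zero K _
    have hαα : α * α = α * w := loopElt_sq
    have hwα : w * α = - (α * w) := fromLoop_mul_loopElt
    have hww : w * w = 0 := fromLoop_none_mul_fromLoop _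
    have hααw : α * α * w = 0 := loopElt_sq_mul_fromLoop _
    have hααw' : α * (α * w) = 0 := by rw [← mul_assoc, hααw]
    have hew : T.idem K none 0 * w = w := T.e_mul_word K (Sum.inr true) _
    have heα : T.idem K none 0 * α = α := T.e_mul_word K (Sum.inr false) _
    have hwαw : w * (α * w) = 0 := by rw [← mul_assoc, hwα, neg_mul, mul_assoc, hww]; simp
    have hαwαw : α * w * (α * w) = 0 := by rw [mul_assoc, hwαw, mul_zero]
    have hαww : α * w * w = 0 := by rw [mul_assoc, hww, mul_zero]
    have h1 := congrArg (· * (α * w)) h0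
    simp only [add_mul, smul_mul_assoc, hααw', hwαw, hαwαw, smul_zero, add_zero, zero_mul] at h1
    rw [← mul_assoc, heα] at h1
    have c0 := (smul_eq_zero.1 h1).resolve_right hne
    have h2 := congrArg (· * w) h0
    simp only [c0, zero_smul, zero_add, add_mul, smul_mul_assoc, hww, hαww, smul_zero, add_zero,
      zero_mul] at h2
    have c1 := (smul_eq_zero.1 h2).resolve_right hne
    have h3 := congrArg (α * ·) h0
    simp only [c0, c1, zero_smul, zero_add, mul_add, mul_smul_comm, hααw', smul_zero, add_zero,
      mul_zero] at h3
    have c2 := (smul_eq_zero.1 h3).resolve_right hne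
    simp only [c0, c1, c2, zero_smul, zero_add] at h0
    have c3 := (smul_eq_zero.1 h0).resolve_right hne
    intro i
    fin_cases i
    · exact c0
    · exact c1
    · exact c2
    · exact c3

/-- The spaces of homomorphisms between consecutive terms of `Q(z)` are one-dimensional and
spanned by the differentials. -/
theorem finrank_differential (z : T.Edge) (j : ℕ) (hj : j + 1 < (T.route z).length) :
    Module.finrank K ((T.Q K z).X j ⟶ (T.Q K z).X (j + 1)) = 1 ∧ (T.Q K z).d j (j + 1) ≠ 0 := by
  have hz : z ≠ none := by rintro rfl; simp [route] at hj
  have h1 : T.routeAt z ((j + 1 : ℕ) : ℤ) ≠ none := by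
    rw [routeAt_natCast, List.getElem?_eq_getElem hj]; simp
  obtain ⟨d', hd'⟩ := onRoute_of_ne_none hz h1
  obtain ⟨d, hd, -⟩ := hd'.pred
  obtain ⟨k, h2, h3, h4⟩ := hd.exists_pow hd'
  have hD := hd.diffElt hd' h2 h3 h4 (K := K)
  have hidem := hd'.idem (K := K)
  rw [Nat.cast_succ] at hidem
  have hne : (T.Q K z).d j (j + 1) ≠ 0 := by
    rw [Q_d]
    intro h
    have h5 := (T.rightMul_eq_zero_iff K).1 h
    rw [idem_mul_diffElt, diffElt_mul_idem, hD] at h5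
    exact T.word_ne_zero K h3.le h5
  refine ⟨finrank_eq_one _ hne fun f => ?_, hne⟩
  obtain ⟨p, hp, hf⟩ := T.exists_eq_rightMul K (T.idem_mul_idem K z j)
    (T.idem_mul_idem K z (j + 1)) f
  obtain ⟨c, hc⟩ := T.corner_adjacent K h2 h3 h4 (x := p)
    (by rw [edge_symm, ← hd.idem, ← hp, ← mul_assoc, ← mul_assoc, idem_mul_idem])
    (by rw [← hidem, ← hp, mul_assoc, idem_mul_idem])
  refine ⟨c, ?_⟩
  rw [hf, Q_d, hD, hc]
  exact (T.rightMul_smul K _ _ _ _).symm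

end LoopBrauerGraph

/-! ### `Ω(n)` as a cyclic system -/

namespace NormalForm

universe u

variable (K : Type u) [Field K] (n : ℕ) [NeZero n]

/-- The quotient map from the path algebra to `Ω(n)`. -/
noncomputable def mk : PathAlgebra K (source n) (target n) →ₐ[K] NormalForm K n :=
  RingQuot.mkAlgHom K (Rel K n)

variable {K n} in
theorem mk_rel {x y : PathAlgebra K (source n) (target n)} (h : Rel K n x y) :
    mk K n x = mk K n y :=
  RingQuot.mkAlgHom_rel K h

/-- The letters of `Ω(n)` in their cyclic order `α, β₁, …, βₙ`. -/
noncomputable def letter : Fin (n + 1) → NormalForm K n :=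
  Fin.cases (mk K n (α K n)) (fun i => mk K n (β K n i))

/-- The vertex of the quiver at which a letter starts. -/
def letterSource : Fin (n + 1) → Fin n := Fin.cases 0 id

/-- The trivial paths in `Ω(n)`. -/
noncomputable def vertex (i : Fin n) : NormalForm K n := mk K n (PathAlgebra.vertex K _ _ i)

theorem fin_add_one {n : ℕ} [NeZero n] (i : Fin n) (h : (i : ℕ) + 1 < n) :
    i + 1 = ⟨i + 1, h⟩ := by
  ext
  simp [Fin.val_add, Nat.mod_eq_of_lt h]

theorem fin_add_one_eq_zero {n : ℕ} [NeZero n] (i : Fin n) (h : (i : ℕ) + 1 = n) :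
    i + 1 = 0 := by
  ext
  simp [Fin.val_add, h]

theorem fin_add_one_ne_zero {n : ℕ} [NeZero n] (i : Fin n) (h : (i : ℕ) + 1 < n) :
    i + 1 ≠ 0 := by
  rw [fin_add_one i h, Ne, Fin.ext_iff]
  simp

variable {K n} in
theorem βs_append (l l' : List (Fin n)) :
    βs K n (l ++ l') = βs K n l * βs K n l' := by
  simp [βs]

variable {K n} in
/-- A path consisting of arrows `β` starts at its first vertex. -/
theorem vertex_mul_βs (i : Fin n) (k : ℕ) :
    PathAlgebra.vertex K _ _ i *
      βs K n (((List.finRange n).drop i).take (k + 1)) =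
      βs K n (((List.finRange n).drop i).take (k + 1)) := by
  have h : (i : ℕ) < (List.finRange n).length := by simp
  rw [List.drop_eq_getElem_cons h, List.take_succ_cons]
  simp only [βs, List.map_cons, List.prod_cons, List.getElem_finRange, Fin.cast_mk]
  rw [← mul_assoc]
  congr 1
  exact PathAlgebra.vertex_mul_arrow K _ _ (some i)

theorem addRight_one_apply {m : ℕ} [NeZero m] (h : Fin m) : Equiv.addRight 1 h = h + 1 := rfl

theorem ofNat_one {m : ℕ} [NeZero m] : Fin.ofNat m 1 = 1 := rfl

theorem pow_addRight_apply {m : ℕ} [NeZero m] (h : Fin m) (k : ℕ) :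
    ((Equiv.addRight (1 : Fin m)) ^ k) h = h + Fin.ofNat m k := by
  induction k with
  | zero => ext; simp
  | succ k ih =>
    rw [pow_succ', Equiv.Perm.mul_apply, ih, addRight_one_apply]
    ext
    simp [Fin.val_add, add_assoc]

/-- The path `β_{i+1} ⋯ β_{i+k}` in `Ω(n)` as a word in the letters. -/
theorem mk_βs_take_drop (i k : ℕ) (h : i + k ≤ n) :
    mk K n (βs K n (((List.finRange n).drop i).take k)) =
      cycProd (Equiv.addRight 1) (letter K n) (Fin.ofNat (n + 1) (i + 1)) k := by
  induction k with
  | zero => simp [βs]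
  | succ k ih =>
    have h1 : k < ((List.finRange n).drop i).length := by simp; omega
    have h2 : (Fin.ofNat (n + 1) (i + 1)) + Fin.ofNat (n + 1) k =
        Fin.succ (⟨i + k, by omega⟩ : Fin n) := by
      ext
      simp only [Fin.val_add, Fin.val_ofNat, Fin.val_succ]
      rw [← Nat.add_mod, Nat.mod_eq_of_lt (by omega)]
      omega
    rw [cycProd_succ, ← ih (by omega), List.take_succ_eq_append_getElem h1, pow_addRight_apply, h2]
    simp [βs, letter]

theorem one_eq_succ : (1 : Fin (n + 1)) = Fin.succ 0 := by
  ext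
  simp

theorem succ_add_one_eq_zero_or (i : Fin n) :
    (i.succ + 1 = 0 ∧ i + 1 = 0) ∨ (i.succ + 1 = (i + 1).succ ∧ i + 1 ≠ 0) := by
  obtain ⟨m, rfl⟩ := Nat.exists_eq_succ_of_ne_zero (NeZero.ne n)
  by_cases h : i = Fin.last m
  · left
    subst h
    exact ⟨by rw [Fin.succ_last, Fin.last_add_one], Fin.last_add_one m⟩
  · right
    have h1 : (i : ℕ) < m := Fin.val_lt_last h
    refine ⟨?_, (Fin.add_one_pos i h1).ne'⟩
    ext
    rw [Fin.val_add_one_of_lt (by rw [Fin.lt_def]; simp; omega), Fin.val_succ, Fin.val_succ,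
      Fin.val_add_one_of_lt (by rw [Fin.lt_def]; simpa using h1)]

theorem letterSource_add_one (h : Fin (n + 1)) :
    letterSource n (h + 1) = Fin.cases (motive := fun _ => Fin n) 0 (fun i => i + 1) h := by
  cases h using Fin.cases with
  | zero => rw [zero_add, one_eq_succ]; rfl
  | succ i =>
    rcases succ_add_one_eq_zero_or n i with ⟨h1, h2⟩ | ⟨h1, -⟩
    · rw [h1]; exact h2.symm
    · rw [h1]; rfl

theorem one_ne_zero : (1 : Fin (n + 1)) ≠ 0 := by
  rw [one_eq_succ]; exact Fin.succ_ne_zero 0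

/-- The path `β₁ ⋯ βₙ` in `Ω(n)` as a word in the letters. -/
theorem mk_βs_finRange : mk K n (βs K n (List.finRange n)) =
    cycProd (Equiv.addRight 1) (letter K n) 1 n := by
  have h := mk_βs_take_drop K n 0 n (by omega)
  rwa [List.drop_zero, List.take_of_length_le (by simp), zero_add, ofNat_one] at h

/-- `Ω(n)` obeys the same laws as `Ω(T)`, with a single cycle of `n + 1` letters `α, β₁, …, βₙ`. -/
theorem isCyclicSystem : IsCyclicSystem K (Equiv.addRight (1 : Fin (n + 1))) (letterSource n)
    (vertex K n) (letter K n) (fun _ => n + 1) 0 where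
  e_mul_self i := by rw [vertex, ← map_mul, PathAlgebra.vertex_mul_self]
  e_orth i j h := by rw [vertex, vertex, ← map_mul, PathAlgebra.vertex_mul_vertex_of_ne K _ _ h, map_zero]
  sum_e := by
    simp_rw [vertex]
    rw [← map_sum, PathAlgebra.sum_vertex, map_one]
  edge_surj := fun i => ⟨i.succ, rfl⟩
  e_mul_a h := by
    cases h using Fin.cases with
    | zero => exact (map_mul _ _ _).symm.trans (congrArg _ (PathAlgebra.vertex_mul_arrow K _ _ none))
    | succ i =>
      exact (map_mul _ _ _).symm.trans (congrArg _ (PathAlgebra.vertex_mul_arrow K _ _ (some i)))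
  a_mul_e h := by
    rw [addRight_one_apply, letterSource_add_one]
    cases h using Fin.cases with
    | zero => exact (map_mul _ _ _).symm.trans (congrArg _ (PathAlgebra.arrow_mul_vertex K _ _ none))
    | succ i =>
      exact (map_mul _ _ _).symm.trans (congrArg _ (PathAlgebra.arrow_mul_vertex K _ _ (some i)))
  adjoin_eq_top := by
    have h1 : Set.range (vertex K n) ∪ Set.range (letter K n) =
        mk K n '' (Set.range (PathAlgebra.vertex K (source n) (target n)) ∪
          Set.range (PathAlgebra.arrow K (source n) (target n))) := by
      rw [Set.image_union, ← Set.range_comp, ← Set.range_comp]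
      congr 1
      ext x
      constructor
      · rintro ⟨h, rfl⟩
        cases h using Fin.cases with
        | zero => exact ⟨none, rfl⟩
        | succ i => exact ⟨some i, rfl⟩
      · rintro ⟨_ | i, rfl⟩
        · exact ⟨0, rfl⟩
        · exact ⟨i.succ, rfl⟩
    rw [h1, ← AlgHom.map_adjoin, PathAlgebra.adjoin_eq_top, Algebra.map_top, AlgHom.range_eq_top]
    exact RingQuot.mkAlgHom_surjective K _
  p_apply := fun _ => rfl
  pow_p h := by
    rw [pow_addRight_apply]
    simp
  two_le := Nat.succ_le_succ (Nat.pos_of_neZero n)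
  loop_ne := by rw [addRight_one_apply, zero_add]; exact one_ne_zero n
  edge_loop := by rw [addRight_one_apply, letterSource_add_one]; rfl
  mul_eq_zero h k h1 h2 h3 := by
    rw [addRight_one_apply] at h1 h2
    rw [letterSource_add_one] at h1
    cases h using Fin.cases with
    | zero =>
      cases k using Fin.cases with
      | zero => exact absurd ⟨rfl, rfl⟩ h3
      | succ j =>
        have h4 : 0 = j := h1
        rw [zero_add, one_eq_succ, h4] at h2
        exact absurd rfl h2
    | succ i =>
      have h1' : i + 1 = letterSource n k := h1
      rcases succ_add_one_eq_zero_or n i with ⟨h4, h5⟩ | ⟨h4, h5⟩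
      · cases k using Fin.cases with
        | zero => exact absurd h4.symm h2
        | succ j =>
          have h6 : j = 0 := h1'.symm.trans h5
          have h7 : i = -1 := eq_neg_of_add_eq_zero_left h5
          subst h6 h7
          exact (map_mul _ _ _).symm.trans ((mk_rel .zero).trans (map_zero _))
      · cases k using Fin.cases with
        | zero => exact absurd h1' h5
        | succ j => exact absurd (h4.trans (congrArg _ h1')).symm h2
  sq := by
    rw [cycProd_succ', addRight_one_apply, zero_add, ← mk_βs_finRange]
    exact (map_mul _ _ _).symm.trans ((mk_rel .sq).trans (map_mul _ _ _))
  anti := by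
    have h1 : (1 : Fin (n + 1)) + Fin.ofNat (n + 1) n = 0 := by
      ext
      simp [add_comm]
    rw [cycProd_succ', cycProd_succ, addRight_one_apply, zero_add, pow_addRight_apply, h1, ← mk_βs_finRange]
    have := mk_rel (K := K) (n := n) .anti
    rw [map_add, map_mul, map_mul, map_zero] at this
    exact this
  long h h1 h2 := by
    rw [addRight_one_apply, zero_add] at h2
    obtain ⟨i, rfl⟩ := Fin.exists_succ_eq.2 h1
    have hi : i ≠ 0 := by rintro rfl; exact h2 (one_eq_succ n).symm
    have h3 := mk_rel (K := K) (.cycle i hi)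
    have h4 : i.succ = (Fin.ofNat (n + 1) (i + 1)) := by
      ext
      rw [Fin.val_ofNat, Nat.mod_eq_of_lt (by omega), Fin.val_succ]
    have h5 : i.succ + Fin.ofNat (n + 1) (n - i) = 0 := by
      have : (i : ℕ) + 1 + (n - i) = n + 1 := by omega
      ext
      rw [h4]
      simp [Fin.val_add, this]
    have h6 := mk_βs_take_drop K n i (n - i) (by omega)
    have h7 := mk_βs_take_drop K n 0 (i + 1) (by omega)
    rw [List.take_of_length_le (by simp), ← h4] at h6
    rw [List.drop_zero, zero_add, ofNat_one] at h7
    have h8 : n + 1 + 1 = n - i + (1 + (i + 1)) := by omega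
    rw [map_mul, map_mul, map_zero, h6, h7] at h3
    rw [h8, cycProd_add, cycProd_add _ _ _ 1, pow_addRight_apply, h5, cycProd_one, ← mul_assoc,
      pow_one, addRight_one_apply, zero_add]
    exact h3

/-- The algebra is spanned by the words of length at most `n + 1`.  Those which start with `β₁` and
have length `0` or `n + 1` are, up to sign, words which start with `α`.  There remain `n` words
which start with `β₁` and `n + 2` words for each of the other `n` letters. -/
theorem finrank_le : Module.Finite K (NormalForm K n) ∧
    Module.finrank K (NormalForm K n) ≤ n ^ 2 + 3 * n := by
  have hs := isCyclicSystem K n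
  let W := cycWord (Equiv.addRight (1 : Fin (n + 1))) (letterSource n) (vertex K n) (letter K n)
  let v : Fin n ⊕ (Fin n × Fin (n + 2)) → NormalForm K n :=
    Sum.elim (fun k => W 1 (k + 1)) (fun x => W (Fin.succAbove 1 x.1) x.2)
  have hne : (0 : Fin (n + 1)) ≠ 1 := by rw [one_eq_succ]; exact (Fin.succ_ne_zero 0).symm
  have mem {h : Fin (n + 1)} (hh : h ≠ 1) {k : ℕ} (hk : k ≤ n + 1) :
      W h k ∈ Submodule.span K (Set.range v) := by
    obtain ⟨i, rfl⟩ := Fin.exists_succAbove_eq hh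
    exact Submodule.subset_span ⟨Sum.inr (i, ⟨k, by omega⟩), rfl⟩
  have hv : Submodule.span K (Set.range v) = ⊤ := by
    rw [eq_top_iff, ← hs.span_words, Submodule.span_le]
    rintro x ⟨h, k, hk, rfl⟩
    by_cases hh : h = 1
    · subst hh
      rcases k with - | k
      · have : W 1 0 = W 0 0 := by
          have h1 := hs.edge_loop
          rw [addRight_one_apply, zero_add] at h1
          change cycWord _ _ _ _ _ _ = cycWord _ _ _ _ _ _
          rw [cycWord_zero, cycWord_zero, h1]
        change W 1 0 ∈ Submodule.span K (Set.range v)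
        rw [this]
        exact mem hne (by omega)
      · rcases hk.lt_or_eq with hk | hk
        · exact Submodule.subset_span ⟨Sum.inl ⟨k, by omega⟩, rfl⟩
        · have h1 := hs.word_turn_loop
          rw [addRight_one_apply, zero_add] at h1
          rw [hk, h1]
          exact Submodule.neg_mem _ (mem hne le_rfl)
    · exact mem hh hk
  refine ⟨⟨hv ▸ Submodule.fg_span (Set.finite_range v)⟩, ?_⟩
  have h1 := finrank_range_le_card (R := K) v
  rw [Set.finrank, hv, finrank_top] at h1
  refine h1.trans_eq ?_
  simp
  ring

end NormalForm

/-! ### The endomorphism algebra of `Q` -/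

/-- The endomorphisms of a finite direct sum are the matrices of morphisms between the summands. -/
def endEquivMatrix {K C ι : Type*} [Field K] [Category C] [Preadditive C] [Linear K C] [Fintype ι]
    {X : C} {Y : ι → C} (i : ∀ j, Y j ⟶ X) (p : ∀ j, X ⟶ Y j) (self : ∀ j, i j ≫ p j = 𝟙 _)
    (ne : ∀ j k, j ≠ k → i j ≫ p k = 0) (total : ∑ j, p j ≫ i j = 𝟙 X) :
    End X ≃ₗ[K] ∀ q : ι × ι, Y q.1 ⟶ Y q.2 where
  toFun x q := i q.1 ≫ End.asHom x ≫ p q.2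
  map_add' x y := by
    funext q
    change i q.1 ≫ (End.asHom x + End.asHom y) ≫ p q.2 = _
    simp
  map_smul' c x := by
    funext q
    change i q.1 ≫ (c • End.asHom x) ≫ p q.2 = _
    simp
  invFun y := End.of (∑ q : ι × ι, p q.1 ≫ y q ≫ i q.2)
  left_inv x := by
    change ∑ q : ι × ι, p q.1 ≫ (i q.1 ≫ End.asHom x ≫ p q.2) ≫ i q.2 = x
    have : (∑ j, p j ≫ i j) ≫ End.asHom x ≫ ∑ j, p j ≫ i j = x := by
      rw [total, Category.id_comp, Category.comp_id]
    refine Eq.trans ?_ this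
    simp only [Fintype.sum_prod_type, Preadditive.sum_comp, Preadditive.comp_sum, Category.assoc]
    exact Finset.sum_comm
  right_inv y := by
    funext q
    change i q.1 ≫ (∑ r : ι × ι, p r.1 ≫ y r ≫ i r.2) ≫ p q.2 = y q
    rw [Preadditive.sum_comp, Preadditive.comp_sum, Finset.sum_eq_single q]
    · rw [Category.assoc, Category.assoc, self, Category.comp_id, ← Category.assoc, self,
        Category.id_comp]
    · intro r _ h
      by_cases h1 : q.1 = r.1
      · have h2 : r.2 ≠ q.2 := fun h2 => h (Prod.ext h1.symm h2)
        rw [Category.assoc, Category.assoc, ne _ _ h2, comp_zero, comp_zero, comp_zero]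
      · rw [Category.assoc, ← Category.assoc (i q.1), ne _ _ h1, zero_comp]
    · simp

namespace LoopBrauerGraph

universe u v

variable {V : Type v} [Finite V] {T : LoopBrauerGraph V} {K : Type u} [Field K]
  {z z' z'' z₁ : T.Edge} {f f' g : ℤ → T.Omega K}

variable (T K z) in
/-- The inclusion of the complex `Q(z)` into `Q`. -/
noncomputable def tiltingInc : T.Q K z ⟶ T.tilting K := biproduct.ι (fun z : T.Edge => T.Q K z) z

variable (T K z) in
/-- The projection of the complex `Q` onto `Q(z)`. -/
noncomputable def tiltingProj : T.tilting K ⟶ T.Q K z := biproduct.π (fun z : T.Edge => T.Q K z) z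

variable (T K z) in
/-- The inclusion of `Q(z)` into `Q` in the homotopy category. -/
noncomputable def inc : T.toHomotopy K (T.Q K z) ⟶ T.toHomotopy K (T.tilting K) :=
  (HomotopyCategory.quotient _ _).map (T.tiltingInc K z)

variable (T K z) in
/-- The projection from `Q` onto `Q(z)` in the homotopy category. -/
noncomputable def proj : T.toHomotopy K (T.tilting K) ⟶ T.toHomotopy K (T.Q K z) :=
  (HomotopyCategory.quotient _ _).map (T.tiltingProj K z)

theorem inc_proj_self : T.inc K z ≫ T.proj K z = 𝟙 _ := by
  have : T.tiltingInc K z ≫ T.tiltingProj K z = 𝟙 _ :=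
    biproduct.ι_π_self (fun z : T.Edge => T.Q K z) z
  rw [inc, proj, ← Functor.map_comp, this, CategoryTheory.Functor.map_id]

theorem inc_proj_ne (h : z ≠ z') : T.inc K z ≫ T.proj K z' = 0 := by
  have : T.tiltingInc K z ≫ T.tiltingProj K z' = 0 :=
    biproduct.ι_π_ne (fun z : T.Edge => T.Q K z) h
  rw [inc, proj, ← Functor.map_comp, this, Functor.map_zero]

theorem sum_proj_inc : ∑ z, T.proj K z ≫ T.inc K z = 𝟙 (T.toHomotopy K (T.tilting K)) := by
  have : ∑ z, T.tiltingProj K z ≫ T.tiltingInc K z = 𝟙 (T.tilting K) :=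
    IsBilimit.total (biproduct.isBilimit (fun z : T.Edge => T.Q K z))
  simp_rw [inc, proj, ← Functor.map_comp]
  rw [← Functor.map_sum, this, CategoryTheory.Functor.map_id]

variable (T K) in
/-- An endomorphism of `Q` is a matrix of morphisms between the summands. -/
noncomputable def endEquiv : End (T.toHomotopy K (T.tilting K)) ≃ₗ[K]
    ∀ p : T.Edge × T.Edge, T.toHomotopy K (T.Q K p.1) ⟶ T.toHomotopy K (T.Q K p.2) :=
  endEquivMatrix (T.inc K) (T.proj K) (fun _ => inc_proj_self) (fun _ _ => inc_proj_ne) sum_proj_inc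

/-- The endomorphism of `Q` whose only component is the morphism `Q(z) → Q(z')` described by a
family of elements of `Ω(T)`. -/
noncomputable def endo (hf : f ∈ T.chainMaps K z z') : End (T.toHomotopy K (T.tilting K)) :=
  End.of (T.proj K z ≫ T.toHom K z z' ⟨f, hf⟩ ≫ T.inc K z')

theorem endo_add (hf : f ∈ T.chainMaps K z z') (hg : g ∈ T.chainMaps K z z') :
    endo (Submodule.add_mem _ hf hg) = endo hf + endo hg := by
  have : T.toHom K z z' ⟨f + g, Submodule.add_mem _ hf hg⟩ =
    T.toHom K z z' ⟨f, hf⟩ + T.toHom K z z' ⟨g, hg⟩ :=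
    map_add (T.toHom K z z') ⟨f, hf⟩ ⟨g, hg⟩
  rw [endo, this, Preadditive.add_comp, Preadditive.comp_add]
  rfl

theorem endo_smul (c : K) (hf : f ∈ T.chainMaps K z z') :
    endo (Submodule.smul_mem _ c hf) = c • endo hf := by
  have : T.toHom K z z' ⟨c • f, Submodule.smul_mem _ c hf⟩ = c • T.toHom K z z' ⟨f, hf⟩ :=
    map_smul (T.toHom K z z') c ⟨f, hf⟩
  rw [endo, this, Linear.smul_comp, Linear.comp_smul]
  rfl

theorem endo_eq_zero (hf : f ∈ T.nullMaps K z z') : endo (nullMaps_le_chainMaps hf) = 0 := by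
  rw [endo, (toHom_eq_zero_iff ⟨f, nullMaps_le_chainMaps hf⟩).2 hf, zero_comp, comp_zero]

/-- The multiplication of `End(Q)` is composition of maps, so it reverses that of the families. -/
theorem endo_mul (hf : f ∈ T.chainMaps K z z') (hg : g ∈ T.chainMaps K z' z'') :
    endo hg * endo hf = endo (mul_mem_chainMaps hf hg) := by
  have := toHom_comp ⟨f, hf⟩ ⟨g, hg⟩
  change (T.proj K z ≫ T.toHom K z z' ⟨f, hf⟩ ≫ T.inc K z') ≫
    (T.proj K z' ≫ T.toHom K z' z'' ⟨g, hg⟩ ≫ T.inc K z'') = T.proj K z ≫ _ ≫ T.inc K z''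
  rw [← this]
  simp only [Category.assoc]
  rw [← Category.assoc (T.inc K z'), inc_proj_self, Category.id_comp]

theorem endo_mul_of_ne (h : z' ≠ z₁) (hf : f ∈ T.chainMaps K z z')
    (hg : g ∈ T.chainMaps K z₁ z'') : endo hg * endo hf = 0 := by
  change (T.proj K z ≫ T.toHom K z z' ⟨f, hf⟩ ≫ T.inc K z') ≫
    (T.proj K z₁ ≫ T.toHom K z₁ z'' ⟨g, hg⟩ ≫ T.inc K z'') = 0
  simp only [Category.assoc]
  rw [← Category.assoc (T.inc K z'), inc_proj_ne h, zero_comp, comp_zero, comp_zero]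

theorem sum_endo_idem : ∑ z, endo (T := T) (K := K) (idem_mem_chainMaps (z := z)) = 1 := by
  simp_rw [endo, toHom_idem, Category.id_comp]
  exact sum_proj_inc

/-- A subspace which contains all endomorphisms with a single component is everything, as an
endomorphism of `Q` is the sum of its components. -/
theorem mem_of_endo_mem (R : Submodule K (End (T.toHomotopy K (T.tilting K))))
    (h : ∀ z z' f, ∀ hf : f ∈ T.chainMaps K z z', endo hf ∈ R)
    (x : End (T.toHomotopy K (T.tilting K))) : x ∈ R := by
  have h1 : x = (endEquiv T K).symm (endEquiv T K x) := by simp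
  rw [h1]
  change ∑ p : T.Edge × T.Edge, T.proj K p.1 ≫ (endEquiv T K x) p ≫ T.inc K p.2 ∈ R
  refine Submodule.sum_mem _ fun p _ => ?_
  obtain ⟨⟨f, hf⟩, hf'⟩ := toHom_surjective (endEquiv T K x p)
  rw [← hf']
  exact h _ _ _ hf

/-- Each pair of edges contributes `1`, with a further `1` for each of `z = z'`, `z = 1`, `z' = 1`. -/
theorem finrank_end : Module.Finite K (End (T.toHomotopy K (T.tilting K))) ∧
    Module.finrank K (End (T.toHomotopy K (T.tilting K))) =
      Nat.card T.Edge ^ 2 + 3 * Nat.card T.Edge := by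
  classical
  have h1 (p : T.Edge × T.Edge) :
      Module.finrank K (T.toHomotopy K (T.Q K p.1) ⟶ T.toHomotopy K (T.Q K p.2)) =
        1 + (if p.1 = p.2 then 1 else 0) + (if p.1 = none then 1 else 0) +
          (if p.2 = none then 1 else 0) := by
    obtain ⟨z, z'⟩ := p
    by_cases hz : z = none
    · subst hz
      by_cases hz' : z' = none
      · subst hz'; simp [finrank_loop]
      · simp [finrank_from_loop hz', hz', Ne.symm hz']
    · by_cases hz' : z' = none
      · subst hz'; simp [finrank_to_loop hz, hz]
      · by_cases h : z = z'
        · subst h; simp [finrank_self hz, hz]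
        · simp [finrank_ne hz hz' h, hz, hz', h]
  have h2 (p : T.Edge × T.Edge) :
      Module.Finite K (T.toHomotopy K (T.Q K p.1) ⟶ T.toHomotopy K (T.Q K p.2)) :=
    Module.finite_of_finrank_pos (by rw [h1]; omega)
  refine ⟨Module.Finite.equiv (endEquiv T K).symm, ?_⟩
  rw [(endEquiv T K).finrank_eq, Module.finrank_pi_fintype, Finset.sum_congr rfl fun p _ => h1 p,
    Nat.card_eq_fintype_card]
  have h3 : ∑ x : T.Edge, ∑ _y : T.Edge, (if x = none then 1 else 0) = Fintype.card T.Edge := by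
    rw [Finset.sum_comm]
    simp
  simp only [Finset.sum_add_distrib, Fintype.sum_prod_type, h3, Finset.sum_const, Finset.sum_ite_eq,
    Finset.sum_ite_eq', Finset.mem_univ, if_true, smul_eq_mul, Finset.card_univ, mul_one,
    Fintype.card_prod]
  ring

end LoopBrauerGraph

/-! ### The homomorphism from `Ω(n)` to the endomorphism algebra -/

namespace LoopBrauerGraph

universe u v

variable {V : Type v} [Finite V] {T : LoopBrauerGraph V} {K : Type u} [Field K]
  {z z' z'' w w' : T.Edge} {f f' g : ℤ → T.Omega K} {x x' : T.Omega K}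

theorem endo_congr (hz : z = w) (hz' : z' = w') (h : f = f') (hf : f ∈ T.chainMaps K z z')
    (hf' : f' ∈ T.chainMaps K w w') : endo hf = endo hf' := by
  subst hz hz' h; rfl

theorem endo_zero (hf : (0 : ℤ → T.Omega K) ∈ T.chainMaps K z z') : endo hf = 0 :=
  endo_eq_zero (Submodule.zero_mem _)

theorem endo_idem_mul (hf : f ∈ T.chainMaps K z z') :
    endo (idem_mem_chainMaps (z := z')) * endo hf = endo hf := by
  rw [endo_mul]
  exact endo_congr rfl rfl (funext fun j => chainMaps_mul_idem hf j) _ _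

theorem endo_mul_idem (hf : f ∈ T.chainMaps K z z') :
    endo hf * endo (idem_mem_chainMaps (z := z)) = endo hf := by
  rw [endo_mul]
  exact endo_congr rfl rfl (funext fun j => chainMaps_idem_mul hf j) _ _

theorem single_mul_single_mem (hx : (Pi.single 0 x : ℤ → T.Omega K) ∈ T.chainMaps K z z')
    (hx' : (Pi.single 0 x' : ℤ → T.Omega K) ∈ T.chainMaps K z' z'') :
    (Pi.single 0 (x * x') : ℤ → T.Omega K) ∈ T.chainMaps K z z'' := by
  have := mul_mem_chainMaps hx hx'
  rwa [single_mul_eq, Pi.single_eq_same] at this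

theorem endo_single_mul (hx : (Pi.single 0 x : ℤ → T.Omega K) ∈ T.chainMaps K z z')
    (hx' : (Pi.single 0 x' : ℤ → T.Omega K) ∈ T.chainMaps K z' z'') :
    endo hx' * endo hx = endo (single_mul_single_mem hx hx') := by
  rw [endo_mul]
  exact endo_congr rfl rfl (by rw [single_mul_eq, Pi.single_eq_same]) _ _

theorem single_neg_fromLoop_mem :
    (Pi.single 0 (-fromLoop K z) : ℤ → T.Omega K) ∈ T.chainMaps K none z := by
  rw [Pi.single_neg]
  exact Submodule.neg_mem _ single_fromLoop_mem

theorem toLoop_mul_fromLoop (hz : z ≠ none) : toLoop K z * fromLoop K z' = 0 := by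
  have h1 := pos_lt hz
  rw [toLoop, fromLoop]
  exact T.word_mul_word_eq_zero K (by omega) (pos_pos z') (by rw [pow_start_none]; simp) (by simp)

theorem fromLoop_mul_between (h : pos z ≤ pos z') :
    fromLoop K z * between K z z' = fromLoop K z' := by
  rw [fromLoop, fromLoop, between, T.word_mul_word K (h' := start z) rfl]
  congr 1
  omega

/-- The path through the loop from one tree edge to a later one is null-homotopic: it is longer
than a full turn, or the two routes have the same first edge and it is the full turn of this
edge. -/
theorem single_through_mem_nullMaps (hz : z ≠ none) (hz' : z' ≠ none) (hne : z ≠ z')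
    (h : Precedes K z z') : (Pi.single 0 (through K z z') : ℤ → T.Omega K) ∈ T.nullMaps K z z' := by
  rcases h.1.lt_or_eq with h1 | h1
  · have h2 := pos_le z
    have : through K z z' = 0 := T.word_eq_zero K (by rw [val_start]; omega)
    rw [this, Pi.single_zero]
    exact Submodule.zero_mem _
  · obtain ⟨d, hd⟩ := exists_onRoute hz
    have h2 : through K z z' = through K z z := by rw [through, through, h1]
    rw [h2, hd.through_self]
    rcases exists_separates hz hz' hne (routeAt_eq_of_pos hz hz' h1) with
      ⟨k, c, e, i, hs⟩ | ⟨k, c, e, i, hs⟩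
    · exact hs.turn_mem_nullMaps hd
    · exact absurd h (hs.not_precedes h1.symm)

variable (T K) in
/-- The edges can be numbered such that chain maps as in `Precedes` lead to smaller numbers. -/
theorem exists_order : ∃ y : Fin (Nat.card T.Edge) ≃ T.Edge,
    ∀ i j, i ≤ j → Precedes K (y j) (y i) := by
  classical
  let _ : LinearOrder T.Edge :=
    { le := fun z z' => Precedes K z' z
      lt := fun z z' => Precedes K z' z ∧ ¬ Precedes K z z'
      lt_iff_le_not_ge := fun _ _ => Iff.rfl
      le_refl := precedes_refl
      le_trans := fun _ _ _ h h' => h'.trans h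
      le_antisymm := fun _ _ h h' => h'.antisymm h
      le_total := fun z z' => precedes_total z' z
      toDecidableLE := fun _ _ => Classical.propDecidable _ }
  have e := Fintype.orderIsoFinOfCardEq T.Edge (Nat.card_eq_fintype_card (α := T.Edge)).symm
  exact ⟨e.toEquiv, fun i j h => e.monotone h⟩

open NormalForm in
/-- The images of the vertices and arrows of the quiver of `Ω(n)` in `End(Q)`.  The edges are
numbered by `y` such that `0` is the loop and chain maps `Q(y j) → Q(y i)` as in `Precedes` exist
for `i ≤ j`; the arrow `β_{i+1}` is mapped to such a chain map `g i`, with the exception of the last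
one, which is mapped to minus the path from the loop.  The sign turns `α₁² = α₁β₁⋯βᵣ` in `Ω(T)`,
where `α₁β₁⋯βᵣ = -β₁⋯βᵣα₁`, into the same relation between the images, as the multiplication of
`End(Q)` is opposite to that of `Ω(T)`. -/
structure IsRealization (y : Fin (Nat.card T.Edge) ≃ T.Edge)
    (g : Fin (Nat.card T.Edge) → ℤ → T.Omega K)
    (F : PathAlgebra K (source (Nat.card T.Edge)) (target (Nat.card T.Edge)) →ₐ[K]
      End (T.toHomotopy K (T.tilting K))) : Prop where
  precedes (i j : Fin (Nat.card T.Edge)) : i ≤ j → Precedes K (y j) (y i)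
  mem (i : Fin (Nat.card T.Edge)) : g i ∈ T.chainMaps K (y (i + 1)) (y i)
  apply_zero (i : Fin (Nat.card T.Edge)) : i + 1 ≠ 0 → g i 0 = between K (y (i + 1)) (y i)
  eq_single (i : Fin (Nat.card T.Edge)) : i + 1 = 0 → g i = Pi.single 0 (-fromLoop K (y i))
  map_vertex (i : Fin (Nat.card T.Edge)) :
    F (PathAlgebra.vertex K _ _ i) = endo (idem_mem_chainMaps (z := y i))
  map_α : F (α K _) = endo single_loopElt_mem
  map_β (i : Fin (Nat.card T.Edge)) : F (β K _ i) = endo (mem i)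

theorem apply_zero_eq_none {y : Fin (Nat.card T.Edge) ≃ T.Edge}
    (hy : ∀ i j, i ≤ j → Precedes K (y j) (y i)) : y 0 = none := by
  have h := hy 0 (y.symm none) (Fin.zero_le _)
  rw [Equiv.apply_symm_apply] at h
  exact (precedes_none _).antisymm h

variable (T K) in
theorem exists_isRealization : ∃ y g F, IsRealization (T := T) (K := K) y g F := by
  obtain ⟨y, hy⟩ := exists_order T K
  have h0 := apply_zero_eq_none hy
  have hg (i : Fin (Nat.card T.Edge)) : ∃ g ∈ T.chainMaps K (y (i + 1)) (y i),
      (i + 1 ≠ 0 → g 0 = between K (y (i + 1)) (y i)) ∧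
      (i + 1 = 0 → g = Pi.single 0 (-fromLoop K (y i))) := by
    by_cases h : i + 1 = 0
    · exact ⟨_, by rw [h, h0]; exact single_neg_fromLoop_mem, fun h' => absurd h h', fun _ => rfl⟩
    · have h1 : (i : ℕ) + 1 < Nat.card T.Edge := by
        by_contra h2
        exact h (NormalForm.fin_add_one_eq_zero i (by omega))
      obtain ⟨-, f, hf, hf0⟩ := hy i (i + 1) (by rw [NormalForm.fin_add_one i h1, Fin.le_def]; simp)
      exact ⟨f, hf, fun _ => hf0, fun h' => absurd h' h⟩
  choose g hg hg1 hg2 using hg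
  obtain ⟨F, hF1, hF2⟩ := PathAlgebra.exists_lift K (NormalForm.source (Nat.card T.Edge))
    (NormalForm.target _) (fun i => endo (idem_mem_chainMaps (K := K) (z := y i)))
    (fun a => match a with
      | none => endo (T := T) (K := K) single_loopElt_mem
      | some i => endo (hg i))
    (fun i => endo_mul_idem _)
    (fun i j h => endo_mul_of_ne (fun h' => h (y.injective h').symm) _ _)
    ((Equiv.sum_comp y fun z => endo (idem_mem_chainMaps (K := K) (z := z))).trans sum_endo_idem)
    (by
      rintro (_ | i)
      · exact (congrArg (· * _) (endo_congr h0 h0 (by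
          change T.idem K (y 0) = _; rw [h0]) _ _)).trans (endo_idem_mul _)
      · exact endo_idem_mul _)
    (by
      rintro (_ | i)
      · exact (congrArg (_ * ·) (endo_congr h0 h0 (by
          change T.idem K (y 0) = _; rw [h0]) _ _)).trans (endo_mul_idem _)
      · exact endo_mul_idem _)
  exact ⟨y, g, F, hy, hg, hg1, hg2, hF1, hF2 none, fun i => hF2 (some i)⟩

end LoopBrauerGraph

/-! ### The relations of `Ω(n)` in the endomorphism algebra -/

namespace LoopBrauerGraph

universe u v

variable {V : Type v} [Finite V] {T : LoopBrauerGraph V} {K : Type u} [Field K]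
  {z z' z'' w w' : T.Edge} {f f' : ℤ → T.Omega K} {x x' : T.Omega K}

namespace IsRealization

open NormalForm

variable {y : Fin (Nat.card T.Edge) ≃ T.Edge} {g : Fin (Nat.card T.Edge) → ℤ → T.Omega K}
  {F : PathAlgebra K (source (Nat.card T.Edge)) (target (Nat.card T.Edge)) →ₐ[K]
    End (T.toHomotopy K (T.tilting K))} (hF : IsRealization y g F)

include hF

theorem y_zero : y 0 = none := apply_zero_eq_none hF.precedes

/-- A path of arrows `β` which does not pass through the last one is mapped to a chain map as in
`Precedes`. -/
theorem map_segment (a k : ℕ) (h : a + k < Nat.card T.Edge) :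
    ∃ (G : ℤ → T.Omega K) (hG : G ∈ T.chainMaps K (y ⟨a + k, h⟩) (y ⟨a, by omega⟩)),
      G 0 = between K (y ⟨a + k, h⟩) (y ⟨a, by omega⟩) ∧
      F (PathAlgebra.vertex K _ _ ⟨a, by omega⟩ *
        βs K _ (((List.finRange _).drop a).take k)) = endo hG := by
  induction k with
  | zero =>
    refine ⟨_, idem_mem_chainMaps, (between_eq rfl).symm, ?_⟩
    simp only [List.take_zero, βs, List.map_nil, List.prod_nil, mul_one]
    exact hF.map_vertex _
  | succ k ih =>
    obtain ⟨G, hG, hG0, hFG⟩ := ih (by omega)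
    have h1 : k < ((List.finRange (Nat.card T.Edge)).drop a).length := by
      rw [List.length_drop, List.length_finRange]; omega
    set i : Fin (Nat.card T.Edge) := ⟨a + k, by omega⟩ with hi
    have h2 : i + 1 = ⟨a + (k + 1), h⟩ := NormalForm.fin_add_one i h
    have h3 : ((List.finRange (Nat.card T.Edge)).drop a)[k] = i := by simp [hi]
    rw [List.take_succ_eq_append_getElem h1, h3, NormalForm.βs_append, ← mul_assoc, map_mul, hFG, ← h2]
    refine ⟨g i * G, mul_mem_chainMaps (hF.mem i) hG, ?_, ?_⟩
    · rw [Pi.mul_apply, hF.apply_zero i (NormalForm.fin_add_one_ne_zero i h), hG0]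
      refine between_mul_between (hF.precedes _ _ ?_).1 (hF.precedes _ _ ?_).1
      · rw [h2, Fin.le_def]; simp [hi]
      · rw [Fin.le_def]; simp [hi]
    · rw [← endo_mul (hF.mem i) hG]
      congr 1
      simp only [βs, List.map_cons, List.map_nil, List.prod_singleton]
      exact hF.map_β i

/-- The path of arrows `β` from a vertex to the end of the cycle is mapped to minus the path
`β₁⋯β` from the loop; the sign is that of the last arrow. -/
theorem map_drop (j : Fin (Nat.card T.Edge)) :
    F (βs K _ ((List.finRange _).drop j)) = endo (single_neg_fromLoop_mem (z := y j)) := by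
  obtain ⟨k, hk⟩ : ∃ k, (j : ℕ) + k + 1 = Nat.card T.Edge :=
    ⟨Nat.card T.Edge - 1 - j, by omega⟩
  obtain ⟨G, hG, hG0, hFG⟩ := hF.map_segment j k (by omega)
  have h1 : k < ((List.finRange (Nat.card T.Edge)).drop j).length := by
    rw [List.length_drop, List.length_finRange]; omega
  set i : Fin (Nat.card T.Edge) := ⟨j + k, by omega⟩ with hi
  have h2 : i + 1 = 0 := NormalForm.fin_add_one_eq_zero i hk
  have h3 : ((List.finRange (Nat.card T.Edge)).drop j)[k] = i := by simp [hi]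
  have h4 : ((List.finRange (Nat.card T.Edge)).drop j) =
      ((List.finRange (Nat.card T.Edge)).drop j).take (k + 1) :=
    (List.take_of_length_le (by rw [List.length_drop, List.length_finRange]; omega)).symm
  have h5 : y (i + 1) = none := by rw [h2, hF.y_zero]
  rw [h4, ← NormalForm.vertex_mul_βs, List.take_succ_eq_append_getElem h1, h3, NormalForm.βs_append, ← mul_assoc,
    map_mul, hFG]
  have h6 : F (βs K _ [i]) = endo (hF.mem i) := by
    simp only [βs, List.map_cons, List.map_nil, List.prod_singleton]
    exact hF.map_β i
  rw [h6, endo_mul]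
  refine endo_congr h5 rfl ?_ _ _
  rw [hF.eq_single i h2, single_mul_eq, hG0, neg_mul, fromLoop_mul_between]
  refine (hF.precedes _ _ ?_).1
  rw [Fin.le_def]; simp [hi]

theorem map_full : F (βs K _ (List.finRange _)) =
    endo (single_neg_fromLoop_mem (K := K) (z := (none : T.Edge))) := by
  have h := hF.map_drop 0
  rw [Fin.val_zero, List.drop_zero] at h
  rw [h]
  exact endo_congr rfl hF.y_zero (by rw [hF.y_zero]) _ _

/-- The images of the arrows satisfy the relations of `Ω(n)`. -/
theorem map_rel {a b : PathAlgebra K (source (Nat.card T.Edge)) (target (Nat.card T.Edge))}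
    (h : NormalForm.Rel K _ a b) : F a = F b := by
  rcases h with _ | _ | _ | ⟨j, hj⟩
  -- `α² = α β₁ ⋯ βₙ`
  · rw [map_mul, map_mul, hF.map_full, hF.map_α, endo_single_mul, endo_single_mul]
    exact endo_congr rfl rfl (by rw [neg_mul, fromLoop_mul_loopElt, neg_neg, loopElt_sq]) _ _
  -- `α β₁ ⋯ βₙ + β₁ ⋯ βₙ α = 0`
  · rw [map_add, map_mul, map_mul, hF.map_full, hF.map_α, endo_single_mul, endo_single_mul,
      ← endo_add, map_zero]
    refine (endo_congr rfl rfl ?_ _ _).trans (endo_zero (Submodule.zero_mem _))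
    rw [← Pi.single_add, neg_mul, fromLoop_mul_loopElt, neg_neg, mul_neg, add_neg_cancel,
      Pi.single_zero]
  -- `βₙ β₁ = 0`
  · rw [map_mul, hF.map_β, hF.map_β, map_zero F]
    have h1 : y (-1 + 1) = none := by rw [neg_add_cancel, hF.y_zero]
    have h2 : endo (hF.mem (-1)) = endo (single_neg_fromLoop_mem (K := K) (z := y (-1))) :=
      endo_congr h1 rfl (hF.eq_single _ (neg_add_cancel 1)) _ _
    have h3 : g 0 ∈ T.chainMaps K (y (0 + 1)) none := by
      have := hF.mem 0
      rwa [hF.y_zero] at this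
    have h4 : endo (hF.mem 0) = endo h3 := endo_congr rfl hF.y_zero rfl _ _
    rw [h2, h4, endo_mul]
    refine (endo_congr rfl rfl ?_ _ _).trans (endo_zero (Submodule.zero_mem _))
    rw [mul_single_eq]
    by_cases h5 : (0 : Fin (Nat.card T.Edge)) + 1 = 0
    · rw [hF.eq_single 0 h5, Pi.single_eq_same, hF.y_zero, neg_mul_neg, fromLoop_none_mul_fromLoop,
        Pi.single_zero]
    · have h6 : y (0 + 1) ≠ none := fun h => h5 (y.injective (h.trans hF.y_zero.symm))
      rw [hF.apply_zero 0 h5, hF.y_zero, between_none, mul_neg, toLoop_mul_fromLoop h6, neg_zero,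
        Pi.single_zero]
  -- `βⱼ ⋯ βₙ α β₁ ⋯ βⱼ = 0`: the image is a path through the loop from an edge to a later one,
  -- or, for `j = n`, a multiple of `β₁ ⋯ βᵣ β₁ = 0`
  · rw [map_mul, map_mul, hF.map_drop, hF.map_α, map_zero, endo_single_mul]
    have hjn : y j ≠ none := fun h => hj (y.injective (h.trans hF.y_zero.symm))
    by_cases h1 : (j : ℕ) + 1 = Nat.card T.Edge
    · rw [List.take_of_length_le (by rw [List.length_finRange]; omega), hF.map_full,
        endo_single_mul]
      refine (endo_congr rfl rfl ?_ _ _).trans (endo_zero (Submodule.zero_mem _))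
      rw [mul_neg, neg_mul_neg, ← mul_assoc, fromLoop_mul_loopElt, neg_mul, mul_assoc,
        fromLoop_none_mul_fromLoop, mul_zero, neg_zero, Pi.single_zero]
    · have h2 : 0 + ((j : ℕ) + 1) < Nat.card T.Edge := by omega
      obtain ⟨G, hG, hG0, hFG⟩ := hF.map_segment 0 (j + 1) h2
      have h3 := NormalForm.vertex_mul_βs (K := K) (0 : Fin (Nat.card T.Edge)) j
      rw [Fin.val_zero] at h3
      have h4 : F (βs K _ ((List.finRange (Nat.card T.Edge)).take (j + 1))) = endo hG := by
        rw [← hFG]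
        exact congrArg F h3.symm
      set z := y ⟨0 + (j + 1), h2⟩ with hz
      have h5 : G ∈ T.chainMaps K z none := by
        have := hG
        rwa [show y ⟨0, by omega⟩ = none from hF.y_zero] at this
      have h6 : endo hG = endo h5 := endo_congr rfl hF.y_zero rfl _ _
      have h7 : G 0 = toLoop K z := by
        rw [hG0, show y ⟨0, by omega⟩ = none from hF.y_zero, between_none]
      have hzn : z ≠ none := by
        intro h
        have := y.injective (h.trans hF.y_zero.symm)
        rw [Fin.ext_iff] at this
        simp at this
      have hne : z ≠ y j := by
        intro h
        have := y.injective h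
        rw [Fin.ext_iff] at this
        simp at this
      have hpr : Precedes K z (y j) := hF.precedes _ _ (by rw [Fin.le_def]; simp)
      rw [h4, h6, endo_mul]
      refine (endo_congr rfl rfl ?_ _ _).trans
        (endo_eq_zero (Submodule.neg_mem _ (single_through_mem_nullMaps hzn hjn hne hpr)))
      rw [mul_single_eq, h7, mul_neg, mul_neg, ← mul_assoc, toLoop_mul_loopElt_mul_fromLoop,
        Pi.single_neg]

/-- The chain maps as in `Precedes` represent endomorphisms in the range of `F`. -/
theorem exists_mem_range (h : Precedes K z z') : ∃ (G : ℤ → T.Omega K) (hG : G ∈ T.chainMaps K z z'),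
    G 0 = between K z z' ∧ endo hG ∈ F.range := by
  obtain ⟨a, rfl⟩ := y.surjective z'
  obtain ⟨b, rfl⟩ := y.surjective z
  have hab : a ≤ b := by
    by_contra h1
    exact h1 (y.injective (h.antisymm (hF.precedes b a (by omega)))).ge
  obtain ⟨k, hk⟩ := Nat.exists_eq_add_of_le (Fin.le_def.1 hab)
  have hb : b = ⟨a + k, by omega⟩ := Fin.ext hk
  obtain ⟨G, hG, hG0, hFG⟩ := hF.map_segment a k (by omega)
  rw [hb]
  exact ⟨G, hG, hG0, _, hFG⟩

/-- All generators of the spaces of chain maps are products of images of vertices and arrows. -/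
theorem endo_mem_range (hf : f ∈ T.chainMaps K z z') : endo hf ∈ F.range := by
  -- the chain maps which represent endomorphisms in the range
  let R (z z' : T.Edge) : Submodule K (ℤ → T.Omega K) :=
    { carrier := {f | ∃ hf : f ∈ T.chainMaps K z z', endo hf ∈ F.range}
      add_mem' := by
        rintro f g ⟨hf, hf'⟩ ⟨hg, hg'⟩
        exact ⟨Submodule.add_mem _ hf hg, by rw [endo_add hf hg]; exact add_mem hf' hg'⟩
      zero_mem' := ⟨Submodule.zero_mem _, by rw [endo_zero]; exact zero_mem _⟩
      smul_mem' := by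
        rintro c f ⟨hf, hf'⟩
        exact ⟨Submodule.smul_mem _ c hf, by rw [endo_smul c hf]; exact Subalgebra.smul_mem _ hf' c⟩ }
  have hmul {z z' z'' : T.Edge} {f g : ℤ → T.Omega K} (hf : f ∈ R z z') (hg : g ∈ R z' z'') :
      f * g ∈ R z z'' := by
    obtain ⟨hf, hf'⟩ := hf
    obtain ⟨hg, hg'⟩ := hg
    exact ⟨mul_mem_chainMaps hf hg, by rw [← endo_mul hf hg]; exact mul_mem hg' hf'⟩
  have hnull {z z' : T.Edge} {f g : ℤ → T.Omega K} (hg : g ∈ R z z')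
      (h : f - g ∈ T.nullMaps K z z') : f ∈ R z z' := by
    have : f = f - g + g := by abel
    rw [this]
    exact (R z z').add_mem ⟨nullMaps_le_chainMaps h, by rw [endo_eq_zero h]; exact zero_mem _⟩ hg
  have hidem (z : T.Edge) : T.idem K z ∈ R z z := by
    obtain ⟨i, rfl⟩ := y.surjective z
    exact ⟨idem_mem_chainMaps, _, hF.map_vertex i⟩
  have hα : (Pi.single 0 (T.loopElt K) : ℤ → T.Omega K) ∈ R none none :=
    ⟨single_loopElt_mem, _, hF.map_α⟩
  have hfrom (z : T.Edge) : (Pi.single 0 (fromLoop K z) : ℤ → T.Omega K) ∈ R none z := by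
    obtain ⟨i, rfl⟩ := y.surjective z
    rw [← neg_neg (fromLoop K (y i)), Pi.single_neg]
    exact (R _ _).neg_mem ⟨single_neg_fromLoop_mem, _, hF.map_drop i⟩
  have hto {z : T.Edge} (hz : z ≠ none) :
      (Pi.single 0 (toLoop K z) : ℤ → T.Omega K) ∈ R z none := by
    obtain ⟨G, hG, hG0, h⟩ := hF.exists_mem_range (precedes_none (K := K) z)
    rw [← between_none, ← hG0, ← eq_single_of_ne hG (Or.inr (Or.inl rfl))]
    exact ⟨hG, h⟩
  have hαfrom (z : T.Edge) :
      (Pi.single 0 (T.loopElt K * fromLoop K z) : ℤ → T.Omega K) ∈ R none z := by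
    have := hmul hα (hfrom z)
    rwa [single_mul_eq, Pi.single_eq_same] at this
  have htoα {z : T.Edge} (hz : z ≠ none) :
      (Pi.single 0 (toLoop K z * T.loopElt K) : ℤ → T.Omega K) ∈ R z none := by
    have := hmul (hto hz) hα
    rwa [single_mul_eq, Pi.single_eq_same] at this
  have hthrough {z : T.Edge} (z' : T.Edge) (hz : z ≠ none) :
      (Pi.single 0 (through K z z') : ℤ → T.Omega K) ∈ R z z' := by
    have := hmul (htoα hz) (hfrom z')
    rwa [single_mul_eq, Pi.single_eq_same, toLoop_mul_loopElt_mul_fromLoop] at this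
  have key : f ∈ R z z' := by
    by_cases hz : z = none
    · subst hz
      by_cases hz' : z' = none
      · subst hz'
        obtain ⟨a, b, c, d, rfl⟩ := exists_of_loop hf
        exact add_mem (add_mem (add_mem (Submodule.smul_mem _ _ (hidem _))
          (Submodule.smul_mem _ _ hα)) (Submodule.smul_mem _ _ (hfrom _)))
          (Submodule.smul_mem _ _ (hαfrom _))
      · obtain ⟨a, b, rfl⟩ := exists_of_fromLoop hz' hf
        exact add_mem (Submodule.smul_mem _ _ (hfrom _)) (Submodule.smul_mem _ _ (hαfrom _))
    · by_cases hz' : z' = none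
      · subst hz'
        obtain ⟨a, b, rfl⟩ := exists_of_toLoop hz hf
        exact add_mem (Submodule.smul_mem _ _ (hto hz)) (Submodule.smul_mem _ _ (htoα hz))
      · by_cases hne : z = z'
        · subst hne
          obtain ⟨a, b, h⟩ := exists_smul_add_smul hz hf
          exact hnull (add_mem (Submodule.smul_mem _ _ (hidem _))
            (Submodule.smul_mem _ _ (hthrough _ hz))) h
        · by_cases h : Precedes K z z'
          · obtain ⟨G, hG, hG0, hGR⟩ := hF.exists_mem_range h
            obtain ⟨c, hc⟩ := exists_smul_of_precedes hz hz' hne hG h.1 hG0 hf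
            exact hnull (Submodule.smul_mem _ _ ⟨hG, hGR⟩) hc
          · obtain ⟨c, hc⟩ := exists_smul_of_not_precedes hz hz' h hf
            exact hnull (Submodule.smul_mem _ _ (hthrough _ hz)) hc
  exact key.2

theorem surjective : Function.Surjective F := fun x =>
  mem_of_endo_mem (Subalgebra.toSubmodule F.range) (fun _ _ _ => hF.endo_mem_range) x

end IsRealization

variable (T K) in
/-- The algebras `End(Q)` and `Ω(n)` are isomorphic: there is a surjection from `Ω(n)`, and
the dimension of `Ω(n)` is at most that of `End(Q)`. -/
theorem nonempty_algEquiv : Nonempty (End (T.toHomotopy K (T.tilting K)) ≃ₐ[K]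
    NormalForm K (Nat.card T.Edge)) := by
  obtain ⟨y, g, F, hF⟩ := exists_isRealization T K
  let Φ : NormalForm K (Nat.card T.Edge) →ₐ[K] End (T.toHomotopy K (T.tilting K)) :=
    RingQuot.liftAlgHom K ⟨F, fun _ _ h => hF.map_rel h⟩
  have hΦ (a) : Φ (NormalForm.mk K _ a) = F a :=
    RingQuot.liftAlgHom_mkAlgHom_apply K F (fun _ _ h => hF.map_rel h) a
  have hsurj : Function.Surjective Φ := fun x => by
    obtain ⟨a, rfl⟩ := hF.surjective x
    exact ⟨_, hΦ a⟩
  obtain ⟨hfin, hle⟩ := NormalForm.finrank_le K (Nat.card T.Edge)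
  obtain ⟨hfin', heq⟩ := finrank_end (T := T) (K := K)
  have hge := Φ.toLinearMap.finrank_le_finrank_of_surjective hsurj
  have hinj : Function.Injective Φ :=
    (LinearMap.injective_iff_surjective_of_finrank_eq_finrank (f := Φ.toLinearMap)
      (by omega)).2 hsurj
  exact ⟨(AlgEquiv.ofBijective Φ ⟨hinj, hsurj⟩).symm⟩

end LoopBrauerGraph

theorem mainTheorem3 {K : Type*} [Field K] {V : Type*} [Finite V] (T : LoopBrauerGraph V) :
    (∀ (z : T.Edge) (j : ℕ), j + 1 < (T.route z).length →
      Module.finrank K ((T.Q K z).X j ⟶ (T.Q K z).X (j + 1)) = 1 ∧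
      (T.Q K z).d j (j + 1) ≠ 0) ∧
    (∀ z z' : T.Edge,
      (z = none → z' = none →
        Module.finrank K (T.toHomotopy K (T.Q K z) ⟶ T.toHomotopy K (T.Q K z')) = 4) ∧
      (z = z' → z ≠ none →
        Module.finrank K (T.toHomotopy K (T.Q K z) ⟶ T.toHomotopy K (T.Q K z')) = 2) ∧
      (z ≠ z' → (z = none ∨ z' = none) →
        Module.finrank K (T.toHomotopy K (T.Q K z) ⟶ T.toHomotopy K (T.Q K z')) = 2) ∧
      (z ≠ z' → z ≠ none → z' ≠ none →
        Module.finrank K (T.toHomotopy K (T.Q K z) ⟶ T.toHomotopy K (T.Q K z')) = 1)) ∧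
    Nonempty (End (T.toHomotopy K (T.tilting K)) ≃ₐ[K]
      NormalForm K (Nat.card T.Edge)) := by
  refine ⟨fun z j hj => LoopBrauerGraph.finrank_differential z j hj, fun z z' => ⟨?_, ?_, ?_, ?_⟩,
    LoopBrauerGraph.nonempty_algEquiv T K⟩
  · rintro rfl rfl
    exact LoopBrauerGraph.finrank_loop
  · rintro rfl hz
    exact LoopBrauerGraph.finrank_self hz
  · rintro hne (rfl | rfl)
    · exact LoopBrauerGraph.finrank_from_loop hne.symm
    · exact LoopBrauerGraph.finrank_to_loop hne
  · exact fun hne hz hz' => LoopBrauerGraph.finrank_ne hz hz' hne
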